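/- **Setting.** Let $n\ge 2$, let $\Omega\subset\mathbb R^n$ be a bounded domain with smooth boundary, $\gamma\ge 0$, and let $\Gamma\subset\mathbb R^n$ be an open convex symmetric cone with vertex at the origin containing $\{\lambda:\lambda_i>0\ \forall i\}$. Let $f\in C^2(\Gamma)\cap C(\overline\Gamma)$ be symmetric and satisfy $f_i=\partial f/\partial\lambda_i>0$ in $\Gamma$ for all $i$, $f$ concave in $\Gamma$, $f>0$ in $\Gamma$ and $f=0$ on $\partial\Gamma$. For a symmetric matrix $A$ with eigenvalues $\lambda[A]$ put $F[A]=f(\lambda[A])$ and $F^{ij}[A]=\partial F/\partial A_{ij}$. Let $\psi\in C^\infty(\overline\Omega)$, $\psi\ge0$ in $\Omega$, let $\varphi\in C^\infty(\overline\Omega)$, and let $\underline u\in C^2(\overline\Omega)$ satisfy $\lambda[D^2\underline u+\gamma\Delta\underline u\,I]\in\Gamma$ on $\overline\Omega$, $F[D^2\underline u+\gamma\Delta\underline u\,I]\ge\psi$ in $\Omega$, $\underline u=\varphi$ on $\partial\Omega$. Let $\varepsilon_0>0$ be such that $F[D^2\underline u+\gamma\Delta\underline u\,I]\ge\varepsilon_0$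 on $\overline\Omega$, and let $\eta\in C^\infty[0,\infty)$, $0\le\eta\le1$, $\eta=1$ on $[0,\varepsilon_0/4]$, $\eta=0$ on $[\varepsilon_0/2,\infty)$. For $0<\varepsilon\le\varepsilon_0/2$ consider admissible solutions $u\in C^4(\overline\Omega)$ (that is, $\lambda[D^2u+\gamma\Delta u\,I]\in\overline\Gamma$ in $\Omega$) of $$F[D^2u+\gamma\Delta u\,I]=\psi+\varepsilon\,\eta(\psi)\ \text{ in }\Omega,\qquad u=\varphi\ \text{ on }\partial\Omega, \qquad (\ast)$$ and write $F^{ij}=F^{ij}[D^2u+\gamma\Delta u\,I]$ and $\mathcal Lv=F^{ij}v_{ij}+\gamma\,\Delta v\sum F^{ii}$. For $x_0\in\partial\Omega$ let $\Omega_\delta=\{x\in\Omega:|x-x_0|<\delta\}$ and $d(x)=\operatorname{dist}(x,\partial\Omega)$. Let $r,\Lambda>0$. An adapted frame at $x_0$ consists of smooth orthonormal vector fields $e_1,\dots,e_n$ on $\overline\Omega\cap B_r(x_0)$ such that on $\partial\Omega$ the fields $e_1,\dots,e_{n-1}$ are tangential (and hence $e_n$ is normal), and such that the fields and their first and second derivatives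 are bounded by $\Lambda$. With $\nabla_l$ the derivative in direction $e_l$, set $$\Psi=\frac1{\delta^2}\Big(A_1(u-\underline u)+t\,d-\frac N2d^2+A_3|x-x_0|^2\Big)-A_2(u-\underline u)-A_4\sum_{l<n}|\nabla_l(u-\varphi)|^2 .$$ **Theorem (barrier).** For all $K>0$, $\overline C\in\mathbb R$ and $A_4>0$ there exist positive constants $t,\delta$ (with $\delta<r$) and $A_1,A_2,A_3,N$ with $A_1>2A_2$, where $t,\delta$ can be taken smaller and $A_1,A_2,A_3,N$ larger than any prescribed positive number, depending only on the data $n,\Omega,\gamma,\Gamma,f,\psi,\varphi,\underline u,\varepsilon_0,\eta,r,\Lambda,K,\overline C,A_4$ and the prescribed number (in particular not on $\varepsilon$, $u$, $x_0$, the frame or $h$), such that for every $\varepsilon\in(0,\varepsilon_0/2]$, every admissible solution $u\in C^4(\overline\Omega)$ of $(\ast)$, every $x_0\in\partial\Omega$ and every adapted frame at $x_0$: 1. for every $h\in C(\overline{\Omega}_\delta)$ with $h\le\overline C|x-x_0|^2$ on $\overline\Omega_\delta\cap\partial\Omega$ and $h\le\overline C$ on $\overline\Omega_\delta$ one has $\Psi\ge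 h$ on $\partial\Omega_\delta$; 2. $\Psi\in C^2(\Omega_\delta)$ and $\mathcal L\Psi\le-K\big(1+\sum F^{ii}\big)$ in $\Omega_\delta$. -/

import Mathlib

open scoped ContDiff

noncomputable section

namespace HessianBarrier

/-- Euclidean `n`-space. -/
abbrev E (n : ℕ) : Type := EuclideanSpace ℝ (Fin n)

/-- `Ω` is a bounded domain of `ℝⁿ` with smooth boundary: near each boundary point it is the set
where a smooth function with non-vanishing differential is positive. -/
structure IsSmoothBoundedDomain {n : ℕ} (Ω : Set (E n)) : Prop where
  isOpen : IsOpen Ω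
  isConnected : IsConnected Ω
  isBounded : Bornology.IsBounded Ω
  smooth_boundary : ∀ x₀ ∈ frontier Ω, ∃ (V : Set (E n)) (ρ : E n → ℝ),
    IsOpen V ∧ x₀ ∈ V ∧ ContDiffOn ℝ ∞ ρ V ∧ fderiv ℝ ρ x₀ ≠ 0 ∧
      ∀ x ∈ V, (x ∈ Ω ↔ 0 < ρ x)

/-- `Γ` is an open convex symmetric cone in `ℝⁿ` with vertex at the origin that contains the
positive cone `{λ : λᵢ > 0 for all i}`. -/
structure IsSymmetricCone {n : ℕ} (Γ : Set (Fin n → ℝ)) : Prop where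
  isOpen : IsOpen Γ
  convex : Convex ℝ Γ
  smul_mem : ∀ s : ℝ, 0 < s → ∀ l ∈ Γ, s • l ∈ Γ
  perm_mem : ∀ σ : Equiv.Perm (Fin n), ∀ l ∈ Γ, l ∘ σ ∈ Γ
  pos_mem : ∀ l : Fin n → ℝ, (∀ i, 0 < l i) → l ∈ Γ

/-- The structure conditions on `f ∈ C²(Γ) ∩ C(closure Γ)`: it is symmetric, all partial derivatives
`fᵢ` are positive in `Γ`, it is concave in `Γ`, positive in `Γ`, and zero on `∂Γ`. -/
structure StructureConditions {n : ℕ} (Γ : Set (Fin n → ℝ)) (f : (Fin n → ℝ) → ℝ) : Prop where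
  contDiffOn : ContDiffOn ℝ 2 f Γ
  continuousOn : ContinuousOn f (closure Γ)
  symm : ∀ σ : Equiv.Perm (Fin n), ∀ l ∈ closure Γ, f (l ∘ σ) = f l
  deriv_pos : ∀ l ∈ Γ, ∀ i, 0 < fderiv ℝ f l (Pi.single i 1)
  concave : ConcaveOn ℝ Γ f
  pos : ∀ l ∈ Γ, 0 < f l
  zero : ∀ l ∈ frontier Γ, f l = 0

theorem isHermitian_symmPart {n : ℕ} (A : Matrix (Fin n) (Fin n) ℝ) :
    ((1 / 2 : ℝ) • (A + A.transpose)).IsHermitian := by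
  ext i j
  simp only [Matrix.conjTranspose_apply, Matrix.smul_apply, Matrix.add_apply, Matrix.transpose_apply,
    star_trivial]
  rw [add_comm]

/-- The eigenvalues `λ[A]` of a symmetric matrix `A` (counted with multiplicity). To have a function
of all `n²` entries, a general matrix is first replaced by its symmetric part, which does not change
symmetric matrices. -/
def eigs {n : ℕ} (A : Matrix (Fin n) (Fin n) ℝ) : Fin n → ℝ :=
  (isHermitian_symmPart A).eigenvalues

/-- `F[A] = f(λ[A])`. -/
def specFun {n : ℕ} (f : (Fin n → ℝ) → ℝ) (A : Matrix (Fin n) (Fin n) ℝ) : ℝ :=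
  f (eigs A)

/-- `F^{ij}[A] = ∂F/∂A_{ij}`, the matrix of partial derivatives of `F` at `A`. -/
def specDeriv {n : ℕ} (f : (Fin n → ℝ) → ℝ) (A : Matrix (Fin n) (Fin n) ℝ) :
    Matrix (Fin n) (Fin n) ℝ :=
  Matrix.of fun i j => lineDeriv ℝ (specFun f) A (Matrix.single i j 1)

/-- The Hessian matrix `D²v(x)` of a function `v` on `closure Ω` (up to the boundary; for `x` in the
open set `Ω` it is the usual Hessian). -/
def hess {n : ℕ} (Ω : Set (E n)) (v : E n → ℝ) (x : E n) : Matrix (Fin n) (Fin n) ℝ :=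
  Matrix.of fun i j => iteratedFDerivWithin ℝ 2 v (closure Ω) x
    ![EuclideanSpace.single i 1, EuclideanSpace.single j 1]

/-- The matrix `D²v + γ Δv I` at `x`. -/
def augHess {n : ℕ} (Ω : Set (E n)) (γ : ℝ) (v : E n → ℝ) (x : E n) :
    Matrix (Fin n) (Fin n) ℝ :=
  hess Ω v x + (γ * (hess Ω v x).trace) • (1 : Matrix (Fin n) (Fin n) ℝ)

/-- `∑ᵢ F^{ii}` at `x`, the coefficients being evaluated at `D²u + γ Δu I`. -/
def traceCoeff {n : ℕ} (Ω : Set (E n)) (γ : ℝ) (f : (Fin n → ℝ) → ℝ) (u : E n → ℝ) (x : E n) : ℝ :=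
  (specDeriv f (augHess Ω γ u x)).trace

/-- The linearized operator `𝓛v = F^{ij} v_{ij} + γ Δv ∑ F^{ii}`, the coefficients being evaluated
at `D²u + γ Δu I`. -/
def linOp {n : ℕ} (Ω : Set (E n)) (γ : ℝ) (f : (Fin n → ℝ) → ℝ) (u v : E n → ℝ) (x : E n) : ℝ :=
  (∑ i, ∑ j, specDeriv f (augHess Ω γ u x) i j * hess Ω v x i j) +
    γ * (hess Ω v x).trace * traceCoeff Ω γ f u x

/-- `w ∈ C²(closure Ω)`, `λ(D²w + γ Δw I) ∈ Γ` on `closure Ω`, `f(λ(D²w + γ Δw I)) ≥ ψ` in `Ω` and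
`w = φ` on `∂Ω`. -/
structure IsSubsolution {n : ℕ} (Ω : Set (E n)) (γ : ℝ) (Γ : Set (Fin n → ℝ))
    (f : (Fin n → ℝ) → ℝ) (ψ φ w : E n → ℝ) : Prop where
  contDiffOn : ContDiffOn ℝ 2 w (closure Ω)
  mem_cone : ∀ x ∈ closure Ω, eigs (augHess Ω γ w x) ∈ Γ
  ge_rhs : ∀ x ∈ Ω, ψ x ≤ specFun f (augHess Ω γ w x)
  boundary : ∀ x ∈ frontier Ω, w x = φ x

/-- The cut-off `η ∈ C^∞[0,∞)` with values in `[0,1]`, equal to `1` on `[0, ε₀/4]` and to `0` on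
`[ε₀/2, ∞)`. -/
structure IsCutoff (ε₀ : ℝ) (η : ℝ → ℝ) : Prop where
  contDiffOn : ContDiffOn ℝ ∞ η (Set.Ici 0)
  mem_Icc : ∀ s, 0 ≤ s → η s ∈ Set.Icc (0 : ℝ) 1
  eq_one : ∀ s ∈ Set.Icc 0 (ε₀ / 4), η s = 1
  eq_zero : ∀ s ∈ Set.Ici (ε₀ / 2), η s = 0

/-- `u ∈ C⁴(closure Ω)` is an admissible solution of the approximating problem
`f(λ(D²u + γ Δu I)) = ψ + ε η(ψ)` in `Ω`, `u = φ` on `∂Ω`. -/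
structure IsApproxSolution {n : ℕ} (Ω : Set (E n)) (γ : ℝ) (Γ : Set (Fin n → ℝ))
    (f : (Fin n → ℝ) → ℝ) (ψ φ : E n → ℝ) (η : ℝ → ℝ) (ε : ℝ) (u : E n → ℝ) : Prop where
  contDiffOn : ContDiffOn ℝ 4 u (closure Ω)
  admissible : ∀ x ∈ Ω, eigs (augHess Ω γ u x) ∈ closure Γ
  equation : ∀ x ∈ Ω, specFun f (augHess Ω γ u x) = ψ x + ε * η (ψ x)
  boundary : ∀ x ∈ frontier Ω, u x = φ x

/-- `e₁, …, eₙ` are smooth orthonormal vector fields on `closure Ω ∩ B_r(x₀)` such that on `∂Ω` the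
first `n - 1` of them are tangent to `∂Ω` (so that `eₙ` is normal to `∂Ω`); the fields and their
first and second derivatives are bounded by `Λ`. -/
structure IsAdaptedFrame {n : ℕ} (Ω : Set (E n)) (x₀ : E n) (r Λ : ℝ)
    (e : Fin n → E n → E n) : Prop where
  contDiffOn : ∀ i, ContDiffOn ℝ ∞ (e i) (closure Ω ∩ Metric.ball x₀ r)
  orthonormal : ∀ x ∈ closure Ω ∩ Metric.ball x₀ r, Orthonormal ℝ fun i => e i x
  tangent : ∀ x ∈ frontier Ω ∩ Metric.ball x₀ r, ∀ i : Fin n, (i : ℕ) + 1 < n →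
    e i x ∈ tangentConeAt ℝ (frontier Ω) x
  bound : ∀ x ∈ Ω ∩ Metric.ball x₀ r, ∀ i, ∀ k ≤ 2, ‖iteratedFDeriv ℝ k (e i) x‖ ≤ Λ

/-- `Ω_δ = {x ∈ Ω : |x - x₀| < δ}`. -/
def localDomain {n : ℕ} (Ω : Set (E n)) (x₀ : E n) (δ : ℝ) : Set (E n) :=
  Ω ∩ Metric.ball x₀ δ

/-- The barrier, with `d` the distance to `∂Ω` and `∇_l` the derivative in the direction `e_l`:
`Ψ = δ⁻² (A₁ (u - w) + t d - (N/2) d² + A₃ |x - x₀|²) - A₂ (u - w) - A₄ ∑_{l<n} |∇_l (u - φ)|²`. -/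
def barrier {n : ℕ} (Ω : Set (E n)) (φ w u : E n → ℝ) (x₀ : E n) (e : Fin n → E n → E n)
    (t δ A₁ A₂ A₃ A₄ N : ℝ) (x : E n) : ℝ :=
  1 / δ ^ 2 * (A₁ * (u x - w x) + t * Metric.infDist x (frontier Ω)
      - N / 2 * Metric.infDist x (frontier Ω) ^ 2 + A₃ * ‖x - x₀‖ ^ 2)
    - A₂ * (u x - w x)
    - A₄ * ∑ l ∈ (Finset.univ : Finset (Fin n)).filter (fun l : Fin n => (l : ℕ) + 1 < n),
        (fderivWithin ℝ (fun y => u y - φ y) (closure Ω) x (e l x)) ^ 2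

end HessianBarrier

end

/-!
# A boundary barrier for approximate solutions of `f(λ(D²u + γ Δu I)) = ψ`

Why the barrier works. Since `f` is symmetric and concave, so is `F = f ∘ λ` as a function of
matrices, and its gradient at a symmetric matrix has the same eigenvectors with the partial
derivatives of `f` as eigenvalues (`specFun_le_tangent`, `specDeriv_eq`). Hence at each point
there is an orthonormal basis `b` that diagonalizes both `D²u` and the linearized operator, which
becomes `𝓛v = ∑ₐ qₐ D²v(bₐ, bₐ)` with positive `qₐ`. Everything that is needed about this operator,
with constants independent of `ε` and `u`, is collected in `IsLinearization` and proved in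
`exists_isLinearization`. The decisive entry is an alternative. At each point `F` is at least as
large at `D²w + γ Δw I` as at `D²u + γ Δu I`, and the former matrices lie in a compact subset of the
domain of `F`; therefore either all `qₐ` are comparable to their sum, or `𝓛(u - w)` is at most a
negative multiple of `1 + ∑ F^{ii}` (`exists_elliptic_or_large`). In the
first case the term `-(N/2) d²` of the barrier wins, because `|∇d| ≥ 1`; in the second one
`A₁ (u - w)` does.

The remaining terms are of lower order. The distance to the boundary is `C²` near the boundary by
the inverse function theorem (`exists_dist_regular`). The gradient of `u` is bounded uniformly: at
the boundary `u` lies between `w` and a supersolution `φ + C (d - N d²)` of the Laplace equation,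
and in the interior the differentiated equation and the maximum principle apply
(`exists_gradient_bound`). The squares of the tangential derivatives contribute
`-2 A₄ ∑ₐ qₐ λₐ² ∑_{l<n} ⟨bₐ, e_l⟩²`, up to terms that are linear in the eigenvalues `λₐ` of `D²u`.
At most one of the inner sums is less than `1/2`, and the one linear term that is not
absorbed directly is controlled by the others through the bounds on `∑ₐ qₐ λₐ = 𝓛u`
(`exists_frame_term_bound`). All of these terms are bounded by a multiple of `1 + ∑ F^{ii}`, which
the factor `δ⁻²` beats (`linOp_barrier_le`). On the boundary of the local domain, the term
`A₃ |x - x₀|²` provides the required lower bound, since the tangential derivatives of `u - φ` vanish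
on `∂Ω` and `u ≥ w` by the comparison principle (`le_barrier`).
-/

namespace HessianBarrier

/-! ### Concave functions on symmetric cones -/

section ConeFunction

variable {n : ℕ} {Γ : Set (Fin n → ℝ)} {f : (Fin n → ℝ) → ℝ}

theorem IsSymmetricCone.add_mem (hΓ : IsSymmetricCone Γ) {l m : Fin n → ℝ} (hl : l ∈ Γ)
    (hm : m ∈ Γ) : l + m ∈ Γ := by
  have h := hΓ.convex hl hm (by norm_num : (0 : ℝ) ≤ 1 / 2) (by norm_num : (0 : ℝ) ≤ 1 / 2)
    (by norm_num)
  have h2 := hΓ.smul_mem 2 (by norm_num) _ h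
  convert h2 using 1
  rw [← smul_add, smul_smul]
  norm_num

theorem IsSymmetricCone.add_nonneg_mem (hΓ : IsSymmetricCone Γ) {l y : Fin n → ℝ} (hl : l ∈ Γ)
    (hy : ∀ i, 0 ≤ y i) : l + y ∈ Γ := by
  have hc : Filter.Tendsto (fun s : ℝ => l - fun _ => s) (nhdsWithin 0 (Set.Ioi 0)) (nhds l) := by
    have : Continuous (fun s : ℝ => l - fun _ : Fin n => s) := by fun_prop
    have h0 := this.tendsto 0
    have h1 : (l - fun _ : Fin n => (0 : ℝ)) = l := by ext; simp
    rw [h1] at h0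
    exact h0.mono_left nhdsWithin_le_nhds
  obtain ⟨s, hs, hs0⟩ := ((hc.eventually (hΓ.isOpen.mem_nhds hl)).and
    self_mem_nhdsWithin).exists
  have h := hΓ.add_mem hs (hΓ.pos_mem (fun i => s + y i) fun i => by
    have := hy i
    have : (0 : ℝ) < s := hs0
    linarith)
  convert h using 1
  ext i
  simp only [Pi.add_apply, Pi.sub_apply]
  ring

/-- The derivative of a function along a line. -/
theorem hasDerivAt_comp_line {X F : Type*} [NormedAddCommGroup X] [NormedSpace ℝ X]
    [NormedAddCommGroup F] [NormedSpace ℝ F] {v : X → F} {x : X} (hv : DifferentiableAt ℝ v x)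
    (ξ : X) : HasDerivAt (fun s : ℝ => v (x + s • ξ)) (fderiv ℝ v x ξ) 0 := by
  have h1 : HasDerivAt (fun s : ℝ => x + s • ξ) ξ 0 := by
    simpa using ((hasDerivAt_id (0 : ℝ)).smul_const ξ).const_add x
  have hv' : HasFDerivAt v (fderiv ℝ v x) (x + (0 : ℝ) • ξ) := by simpa using hv.hasFDerivAt
  exact hv'.comp_hasDerivAt (0 : ℝ) h1

/-- The partial derivatives of `f`. -/
noncomputable def grad (f : (Fin n → ℝ) → ℝ) (l : Fin n → ℝ) (i : Fin n) : ℝ :=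
  fderiv ℝ f l (Pi.single i 1)

theorem fderiv_eq_sum_grad (l y : Fin n → ℝ) : fderiv ℝ f l y = ∑ i, grad f l i * y i := by
  conv_lhs => rw [← Finset.univ_sum_single y]
  rw [map_sum]
  refine Finset.sum_congr rfl fun i _ => ?_
  have : Pi.single i (y i) = y i • (Pi.single i 1 : Fin n → ℝ) := by
    rw [← Pi.single_smul]; simp
  rw [this, map_smul, smul_eq_mul, mul_comm, grad]

theorem StructureConditions.differentiableAt (hΓ : IsSymmetricCone Γ)
    (hf : StructureConditions Γ f) {l : Fin n → ℝ} (hl : l ∈ Γ) : DifferentiableAt ℝ f l :=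
  (hf.contDiffOn.contDiffAt (hΓ.isOpen.mem_nhds hl)).differentiableAt (by norm_num)

theorem StructureConditions.continuousOn_grad (hΓ : IsSymmetricCone Γ)
    (hf : StructureConditions Γ f) (i : Fin n) : ContinuousOn (fun l => grad f l i) Γ :=
  (hf.contDiffOn.continuousOn_fderiv_of_isOpen hΓ.isOpen (by norm_num)).clm_apply
    continuousOn_const

/-- The graph of a concave function lies below its tangent planes. -/
theorem StructureConditions.le_tangent (hΓ : IsSymmetricCone Γ)
    (hf : StructureConditions Γ f) {l m : Fin n → ℝ} (hl : l ∈ Γ) (hm : m ∈ Γ) :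
    f m ≤ f l + ∑ i, grad f l i * (m i - l i) := by
  have hline := hasDerivAt_comp_line (hf.differentiableAt hΓ hl) (m - l)
  have hs := (hasDerivAt_iff_tendsto_slope.1 hline).mono_left
    (nhdsWithin_mono _ (fun x (hx : x ∈ Set.Ioi (0 : ℝ)) => ne_of_gt hx))
  have key : f m - f l ≤ fderiv ℝ f l (m - l) := by
    refine ge_of_tendsto hs ?_
    filter_upwards [Ioo_mem_nhdsGT (show (0 : ℝ) < 1 by norm_num)] with s hs
    have hc := hf.concave.2 hl hm (by linarith [hs.2] : (0 : ℝ) ≤ 1 - s) hs.1.le (by ring)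
    have e1 : (1 - s) • l + s • m = l + s • (m - l) := by
      rw [sub_smul, smul_sub, one_smul]; abel
    rw [e1] at hc
    simp only [smul_eq_mul] at hc
    rw [slope_def_field]
    simp only [zero_smul, add_zero, sub_zero]
    rw [le_div_iff₀ hs.1]
    linarith
  rw [fderiv_eq_sum_grad] at key
  simp only [Pi.sub_apply] at key
  linarith

/-- `f` is strictly increasing in every non-negative direction. -/
theorem StructureConditions.lt_add_nonneg (hΓ : IsSymmetricCone Γ)
    (hf : StructureConditions Γ f) {l y : Fin n → ℝ} (hl : l ∈ Γ) (hy : ∀ i, 0 ≤ y i)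
    (hy0 : ∃ i, 0 < y i) : f l < f (l + y) := by
  have hm := hΓ.add_nonneg_mem hl hy
  have h := hf.le_tangent hΓ hm hl
  have : 0 < ∑ i, grad f (l + y) i * y i := by
    obtain ⟨i, hi⟩ := hy0
    refine Finset.sum_pos' (fun j _ => mul_nonneg (hf.deriv_pos _ hm j).le (hy j))
      ⟨i, Finset.mem_univ i, mul_pos (hf.deriv_pos _ hm i) hi⟩
  have e : ∑ i, grad f (l + y) i * (l i - (l + y) i) = - ∑ i, grad f (l + y) i * y i := by
    rw [← Finset.sum_neg_distrib]
    refine Finset.sum_congr rfl fun i _ => ?_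
    simp
  rw [e] at h
  linarith

/-- Positivity of `f` near the vertex on the ray through `l` bounds the radial derivative from
above. -/
theorem StructureConditions.sum_grad_mul_le (hΓ : IsSymmetricCone Γ)
    (hf : StructureConditions Γ f) {l : Fin n → ℝ} (hl : l ∈ Γ) :
    ∑ i, grad f l i * l i ≤ f l := by
  refine le_of_forall_pos_le_add fun τ hτ => ?_
  by_contra! hcon
  set S := ∑ i, grad f l i * l i
  have hS : 0 < S := lt_of_le_of_lt (by have := hf.pos l hl; linarith) hcon
  have hs : 0 < τ / S := by positivity
  have h := hf.le_tangent hΓ hl (hΓ.smul_mem (τ / S) hs l hl)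
  have e : ∑ i, grad f l i * (((τ / S) • l) i - l i) = (τ / S - 1) * S := by
    rw [Finset.mul_sum]
    refine Finset.sum_congr rfl fun i _ => ?_
    simp; ring
  rw [e, sub_mul, div_mul_cancel₀ _ hS.ne'] at h
  have := hf.pos _ (hΓ.smul_mem (τ / S) hs l hl)
  linarith

/-- Positivity of `f` far out on the ray through `l` bounds the radial derivative from below. -/
theorem StructureConditions.sum_grad_mul_nonneg (hΓ : IsSymmetricCone Γ)
    (hf : StructureConditions Γ f) {l : Fin n → ℝ} (hl : l ∈ Γ) :
    0 ≤ ∑ i, grad f l i * l i := by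
  by_contra! hcon
  set S := ∑ i, grad f l i * l i
  have hp := hf.pos l hl
  have hs : 0 < 1 + f l / (-S) := by
    have : 0 < f l / (-S) := div_pos hp (by linarith)
    linarith
  have h := hf.le_tangent hΓ hl (hΓ.smul_mem (1 + f l / (-S)) hs l hl)
  have e : ∑ i, grad f l i * (((1 + f l / (-S)) • l) i - l i) = (f l / (-S)) * S := by
    rw [Finset.mul_sum]
    refine Finset.sum_congr rfl fun i _ => ?_
    simp; ring
  have e2 : (f l / (-S)) * S = - f l := by
    rw [div_neg, neg_mul, div_mul_cancel₀ _ hcon.ne]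
  rw [e, e2] at h
  have := hf.pos _ (hΓ.smul_mem (1 + f l / (-S)) hs l hl)
  linarith

/-- The vertex does not belong to `Γ`: otherwise `f` would be a positive concave function on a
whole line without being constant. -/
theorem StructureConditions.zero_notMem (hn : 0 < n) (hΓ : IsSymmetricCone Γ)
    (hf : StructureConditions Γ f) : (0 : Fin n → ℝ) ∉ Γ := by
  intro h0
  have h := hf.sum_grad_mul_nonneg hΓ h0
  have hlt := hf.lt_add_nonneg hΓ h0 (y := fun _ => 1) (fun _ => zero_le_one)
    ⟨⟨0, hn⟩, zero_lt_one⟩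
  have hneg : ∀ s : ℝ, (fun _ => s : Fin n → ℝ) ∈ Γ := by
    -- `Γ` contains a neighbourhood of the origin, hence by homogeneity everything
    intro s
    have hc : Continuous (fun τ : ℝ => (fun _ => τ * s : Fin n → ℝ)) := by fun_prop
    have ht := hc.tendsto 0
    have e0 : (fun _ => 0 * s : Fin n → ℝ) = 0 := by ext; simp
    rw [e0] at ht
    obtain ⟨τ, hτ, hτ0⟩ := (((ht.mono_left nhdsWithin_le_nhds).eventually
      (hΓ.isOpen.mem_nhds h0)).and (self_mem_nhdsWithin (s := Set.Ioi (0 : ℝ)))).exists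
    have hτ0' : (0 : ℝ) < τ := hτ0
    have := hΓ.smul_mem τ⁻¹ (inv_pos.2 hτ0') _ hτ
    convert this using 1
    ext
    simp [hτ0'.ne']
  set D := ∑ i, grad f (0 : Fin n → ℝ) i
  have hD : 0 < D := Finset.sum_pos (fun i _ => hf.deriv_pos 0 h0 i) ⟨⟨0, hn⟩, Finset.mem_univ _⟩
  have h1 := hf.le_tangent hΓ h0 (hneg (-(f 0 / D)))
  have e : ∑ i, grad f (0 : Fin n → ℝ) i * (-(f 0 / D) - (0 : Fin n → ℝ) i) = -f 0 := by
    simp only [Pi.zero_apply, sub_zero]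
    rw [← Finset.sum_mul]
    change D * _ = _
    field_simp
  rw [e] at h1
  have := hf.pos _ (hneg (-(f 0 / D)))
  linarith

section DoublyStochastic

variable {D : Matrix (Fin n) (Fin n) ℝ}

/-- Birkhoff's theorem applied to vectors. -/
theorem mulVec_eq_sum_perm (hD : D ∈ doublyStochastic ℝ (Fin n)) :
    ∃ c : Equiv.Perm (Fin n) → ℝ, (∀ σ, 0 ≤ c σ) ∧ ∑ σ, c σ = 1 ∧
      ∀ l : Fin n → ℝ, D.mulVec l = ∑ σ, c σ • (l ∘ σ) := by
  obtain ⟨c, hc0, hc1, hc⟩ := exists_eq_sum_perm_of_mem_doublyStochastic hD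
  refine ⟨c, hc0, hc1, fun l => ?_⟩
  rw [← hc, Matrix.sum_mulVec]
  refine Finset.sum_congr rfl fun σ _ => ?_
  rw [Matrix.smul_mulVec, Matrix.permMatrix_mulVec]

theorem IsSymmetricCone.mulVec_mem (hΓ : IsSymmetricCone Γ)
    (hD : D ∈ doublyStochastic ℝ (Fin n)) {l : Fin n → ℝ} (hl : l ∈ Γ) : D.mulVec l ∈ Γ := by
  obtain ⟨c, hc0, hc1, hc⟩ := mulVec_eq_sum_perm hD
  rw [hc]
  exact hΓ.convex.sum_mem (fun σ _ => hc0 σ) hc1 fun σ _ => hΓ.perm_mem σ l hl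

theorem StructureConditions.le_mulVec (hΓ : IsSymmetricCone Γ) (hf : StructureConditions Γ f)
    (hD : D ∈ doublyStochastic ℝ (Fin n)) {l : Fin n → ℝ} (hl : l ∈ Γ) :
    f l ≤ f (D.mulVec l) := by
  obtain ⟨c, hc0, hc1, hc⟩ := mulVec_eq_sum_perm hD
  rw [hc]
  have h := hf.concave.le_map_sum (t := Finset.univ) (fun σ _ => hc0 σ) hc1
    fun σ _ => hΓ.perm_mem σ l hl
  refine le_trans (le_of_eq ?_) h
  simp_rw [hf.symm _ l (subset_closure hl)]
  rw [← Finset.sum_smul, hc1, one_smul]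

end DoublyStochastic

/-- On `Γ` the sum of the coordinates is positive. -/
theorem StructureConditions.sum_pos (hn : 0 < n) (hΓ : IsSymmetricCone Γ)
    (hf : StructureConditions Γ f) {l : Fin n → ℝ} (hl : l ∈ Γ) : 0 < ∑ i, l i := by
  by_contra! hcon
  have hn' : (0 : ℝ) < n := by exact_mod_cast hn
  -- averaging over all permutations stays in `Γ`
  have hD : (Matrix.of fun _ _ => (n : ℝ)⁻¹ : Matrix (Fin n) (Fin n) ℝ) ∈
      doublyStochastic ℝ (Fin n) := by
    rw [mem_doublyStochastic_iff_sum]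
    refine ⟨fun i j => by simp, fun i => ?_, fun i => ?_⟩ <;> simp [hn'.ne']
  have hm := hΓ.mulVec_mem hD hl
  have h0 := hΓ.add_nonneg_mem hm (y := fun _ => -((n : ℝ)⁻¹ * ∑ i, l i)) fun _ => by
    have : (n : ℝ)⁻¹ * ∑ i, l i ≤ 0 := mul_nonpos_of_nonneg_of_nonpos (by positivity) hcon
    linarith
  refine hf.zero_notMem hn hΓ ?_
  convert h0 using 1
  ext i
  simp [Matrix.mulVec, dotProduct, Finset.mul_sum]

/-- Equal coordinates have equal partial derivatives. -/
theorem StructureConditions.grad_eq_of_eq (hΓ : IsSymmetricCone Γ)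
    (hf : StructureConditions Γ f) {l : Fin n → ℝ} (hl : l ∈ Γ) {i j : Fin n} (hij : l i = l j) :
    grad f l i = grad f l j := by
  let L : (Fin n → ℝ) →L[ℝ] (Fin n → ℝ) :=
    ContinuousLinearMap.pi fun k => ContinuousLinearMap.proj (Equiv.swap i j k)
  have hL : ∀ m : Fin n → ℝ, L m = m ∘ Equiv.swap i j := fun m => rfl
  have hLl : L l = l := by
    rw [hL]
    ext k
    simp only [Function.comp_apply, Equiv.swap_apply_def]
    split_ifs with h1 h2
    · rw [h1, hij]
    · rw [h2, hij]
    · rfl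
  have hd := (hf.differentiableAt hΓ hl).hasFDerivAt
  have hcomp : HasFDerivAt (f ∘ L) ((fderiv ℝ f l).comp L) l := by
    refine HasFDerivAt.comp l ?_ L.hasFDerivAt
    rw [hLl]
    exact hd
  have heq : (f ∘ L) =ᶠ[nhds l] f := by
    filter_upwards [hΓ.isOpen.mem_nhds hl] with m hm
    simp only [Function.comp_apply]
    rw [hL, hf.symm _ m (subset_closure hm)]
  have huniq := (hcomp.congr_of_eventuallyEq heq.symm).unique hd
  have := congrArg (fun T : (Fin n → ℝ) →L[ℝ] ℝ => T (Pi.single i 1)) huniq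
  simp only [ContinuousLinearMap.comp_apply] at this
  rw [hL] at this
  have e : (Pi.single i 1 : Fin n → ℝ) ∘ Equiv.swap i j = Pi.single j 1 := by
    ext k
    simp only [Function.comp_apply, Pi.single_apply, Equiv.swap_apply_eq_iff,
      Equiv.swap_apply_left]
  rw [e] at this
  exact this.symm

end ConeFunction

/-! ### Diagonalization and continuity of eigenvalues -/

section Spectral

variable {n : ℕ}

/-- The symmetric matrix with orthonormal eigenvectors `b a` and eigenvalues `p a`. -/
noncomputable def spectralMat (b : OrthonormalBasis (Fin n) ℝ (E n)) (p : Fin n → ℝ) :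
    Matrix (Fin n) (Fin n) ℝ :=
  Matrix.of fun i j => ∑ a, p a * (b a i * b a j)

/-- The quadratic form of a matrix. -/
def quad (X : Matrix (Fin n) (Fin n) ℝ) (ξ : E n) : ℝ := ∑ i, ∑ j, X i j * (ξ i * ξ j)

/-- The symmetric part of a matrix, as it enters the definition of `eigs`. -/
noncomputable def symPart (X : Matrix (Fin n) (Fin n) ℝ) : Matrix (Fin n) (Fin n) ℝ :=
  (1 / 2 : ℝ) • (X + X.transpose)

/-- An orthonormal basis of eigenvectors of the symmetric part of a matrix. -/
noncomputable def eigBasis (X : Matrix (Fin n) (Fin n) ℝ) : OrthonormalBasis (Fin n) ℝ (E n) :=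
  (isHermitian_symmPart X).eigenvectorBasis

theorem symPart_of_isSymm {X : Matrix (Fin n) (Fin n) ℝ} (hX : X.IsSymm) : symPart X = X := by
  rw [symPart, hX.eq, ← two_smul ℝ X, smul_smul]
  norm_num

theorem inner_eq_sum (x y : E n) : inner ℝ x y = ∑ i, x i * y i := by
  rw [PiLp.inner_apply]
  refine Finset.sum_congr rfl fun i _ => ?_
  simp [mul_comm]

theorem symPart_eq_spectralMat (X : Matrix (Fin n) (Fin n) ℝ) :
    symPart X = spectralMat (eigBasis X) (eigs X) := by
  have h := (isHermitian_symmPart X).spectral_theorem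
  change symPart X = _ at h
  rw [h, Unitary.conjStarAlgAut_apply]
  ext i j
  simp only [spectralMat, Matrix.mul_apply, Matrix.of_apply, Matrix.star_apply, star_trivial,
    Matrix.diagonal_apply, Matrix.IsHermitian.eigenvectorUnitary_apply]
  refine Finset.sum_congr rfl fun a _ => ?_
  simp [eigBasis, eigs]
  ring

theorem sum_basis_mul (b : OrthonormalBasis (Fin n) ℝ (E n)) (i j : Fin n) :
    ∑ a, b a i * b a j = if i = j then 1 else 0 := by
  have h := b.sum_inner_mul_inner (EuclideanSpace.single i (1 : ℝ)) (EuclideanSpace.single j 1)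
  simpa [EuclideanSpace.inner_single_left, EuclideanSpace.inner_single_right,
    eq_comm] using h

theorem quad_spectralMat (b : OrthonormalBasis (Fin n) ℝ (E n)) (p : Fin n → ℝ) (ξ : E n) :
    quad (spectralMat b p) ξ = ∑ a, p a * inner ℝ (b a) ξ ^ 2 := by
  simp only [quad, spectralMat, Matrix.of_apply, inner_eq_sum, sq, Finset.mul_sum, Finset.sum_mul]
  rw [Finset.sum_comm_cycle]
  refine Finset.sum_congr rfl fun _ _ => Finset.sum_congr rfl fun _ _ =>
    Finset.sum_congr rfl fun _ _ => ?_
  ring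

/-- Contraction of `∑ₐ pₐ bₐ ⊗ bₐ` with a matrix. -/
theorem sum_spectralMat_mul (b : OrthonormalBasis (Fin n) ℝ (E n)) (p : Fin n → ℝ)
    (X : Matrix (Fin n) (Fin n) ℝ) :
    ∑ i, ∑ j, spectralMat b p i j * X i j = ∑ a, p a * quad X (b a) := by
  simp only [quad, spectralMat, Matrix.of_apply, Finset.mul_sum, Finset.sum_mul]
  rw [Finset.sum_comm_cycle]
  refine Finset.sum_congr rfl fun _ _ => Finset.sum_congr rfl fun _ _ =>
    Finset.sum_congr rfl fun _ _ => ?_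
  ring

theorem trace_spectralMat (b : OrthonormalBasis (Fin n) ℝ (E n)) (p : Fin n → ℝ) :
    (spectralMat b p).trace = ∑ a, p a := by
  simp only [Matrix.trace, Matrix.diag_apply, spectralMat, Matrix.of_apply]
  rw [Finset.sum_comm]
  refine Finset.sum_congr rfl fun a _ => ?_
  rw [← Finset.mul_sum, ← inner_eq_sum, real_inner_self_eq_norm_sq, b.norm_eq_one]
  ring

theorem inner_basis_basis (b : OrthonormalBasis (Fin n) ℝ (E n)) (a c : Fin n) :
    inner ℝ (b a) (b c) = if a = c then (1 : ℝ) else 0 := by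
  rw [orthonormal_iff_ite.1 b.orthonormal]

theorem quad_spectralMat_self (b : OrthonormalBasis (Fin n) ℝ (E n)) (p : Fin n → ℝ) (a : Fin n) :
    quad (spectralMat b p) (b a) = p a := by
  rw [quad_spectralMat]
  simp [inner_basis_basis]

/-- The squared entries of the transition matrix between two orthonormal bases. -/
theorem inner_sq_mem_doublyStochastic (b c : OrthonormalBasis (Fin n) ℝ (E n)) :
    (Matrix.of fun a j => inner ℝ (c j) (b a) ^ 2 : Matrix (Fin n) (Fin n) ℝ) ∈
      doublyStochastic ℝ (Fin n) := by
  rw [mem_doublyStochastic_iff_sum]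
  refine ⟨fun i j => by simp only [Matrix.of_apply]; positivity, fun a => ?_, fun j => ?_⟩
  · have h := c.sum_sq_norm_inner_right (b a)
    simpa [b.norm_eq_one] using h
  · have h := b.sum_sq_norm_inner_left (c j)
    simpa [c.norm_eq_one] using h

theorem quad_basis_eq_mulVec (b c : OrthonormalBasis (Fin n) ℝ (E n)) (m : Fin n → ℝ) :
    (fun a => quad (spectralMat c m) (b a)) =
      (Matrix.of fun a j => inner ℝ (c j) (b a) ^ 2 : Matrix (Fin n) (Fin n) ℝ).mulVec m := by
  ext a
  rw [quad_spectralMat]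
  simp only [Matrix.mulVec, dotProduct, Matrix.of_apply]
  exact Finset.sum_congr rfl fun j _ => mul_comm _ _

theorem abs_basis_apply_le (b : OrthonormalBasis (Fin n) ℝ (E n)) (a i : Fin n) :
    |b a i| ≤ 1 := by
  have h := PiLp.norm_apply_le (b a) i
  rwa [b.norm_eq_one, Real.norm_eq_abs] at h

theorem abs_quad_basis_le (X : Matrix (Fin n) (Fin n) ℝ) (b : OrthonormalBasis (Fin n) ℝ (E n))
    (a : Fin n) : |quad X (b a)| ≤ ∑ i, ∑ j, |X i j| := by
  refine (Finset.abs_sum_le_sum_abs _ _).trans (Finset.sum_le_sum fun i _ => ?_)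
  refine (Finset.abs_sum_le_sum_abs _ _).trans (Finset.sum_le_sum fun j _ => ?_)
  rw [abs_mul, abs_mul]
  have h1 := abs_basis_apply_le b a i
  have h2 := abs_basis_apply_le b a j
  have : |b a i| * |b a j| ≤ 1 := mul_le_one₀ h1 (abs_nonneg _) h2
  exact mul_le_of_le_one_right (abs_nonneg _) this

theorem abs_eigs_le (X : Matrix (Fin n) (Fin n) ℝ) (a : Fin n) :
    |eigs X a| ≤ ∑ i, ∑ j, |symPart X i j| := by
  have h := abs_quad_basis_le (symPart X) (eigBasis X) a
  have e : quad (symPart X) (eigBasis X a) = eigs X a := by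
    rw [symPart_eq_spectralMat, quad_spectralMat_self]
  rwa [e] at h

theorem eigs_antitone_comp (X : Matrix (Fin n) (Fin n) ℝ) :
    Antitone (eigs X ∘ (Fintype.equivOfCardEq (Fintype.card_fin _) :
      Fin (Fintype.card (Fin n)) ≃ Fin n)) := by
  intro i j hij
  have := (isHermitian_symmPart X).eigenvalues₀_antitone hij
  simpa [eigs, Matrix.IsHermitian.eigenvalues] using this

/-- A decreasing list of numbers that diagonalizes the symmetric part of `X` is the list of
eigenvalues. -/
theorem eq_eigs_of_diagonalizes {X : Matrix (Fin n) (Fin n) ℝ} {U : Matrix (Fin n) (Fin n) ℝ}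
    {l : Fin n → ℝ} (hU : U * U.transpose = 1)
    (hX : symPart X = U * Matrix.diagonal l * U.transpose)
    (hl : Antitone (l ∘ (Fintype.equivOfCardEq (Fintype.card_fin _) :
      Fin (Fintype.card (Fin n)) ≃ Fin n))) : l = eigs X := by
  set e : Fin (Fintype.card (Fin n)) ≃ Fin n := Fintype.equivOfCardEq (Fintype.card_fin _)
  have hU' : U.transpose * U = 1 := mul_eq_one_comm.1 hU
  have hroots : Multiset.map (eigs X) Finset.univ.val = Multiset.map l Finset.univ.val := by
    have h1 := (isHermitian_symmPart X).roots_charpoly_eq_eigenvalues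
    change (symPart X).charpoly.roots = _ at h1
    rw [hX, Matrix.charpoly_mul_comm, ← Matrix.mul_assoc, hU', Matrix.one_mul,
      Matrix.charpoly_diagonal, Polynomial.roots_prod _ _
        (Finset.prod_ne_zero_iff.2 fun _ _ => Polynomial.X_sub_C_ne_zero _)] at h1
    simp only [Polynomial.roots_X_sub_C, Multiset.bind_singleton] at h1
    exact h1.symm
  have hcomp : ∀ m : Fin n → ℝ, Multiset.map m Finset.univ.val =
      (List.ofFn (m ∘ e) : Multiset ℝ) := by
    intro m
    have : (List.ofFn (m ∘ e) : Multiset ℝ) = Multiset.map (m ∘ e) Finset.univ.val := by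
      rw [Fin.univ_val_map]
    rw [this, ← Multiset.map_map]
    congr 1
    simp
  rw [hcomp, hcomp, Multiset.coe_eq_coe] at hroots
  have h3 := hroots.symm.eq_of_sortedGE hl.sortedGE_ofFn
    (eigs_antitone_comp X).sortedGE_ofFn
  have h4 := List.ofFn_injective h3
  ext i
  have := congrFun h4 (e.symm i)
  simp only [Function.comp_apply] at this
  rwa [Equiv.apply_symm_apply] at this

theorem continuous_symPart : Continuous (symPart : Matrix (Fin n) (Fin n) ℝ → _) := by
  unfold symPart
  fun_prop

/-- The ordered eigenvalues depend continuously on the matrix: a limit of diagonalizations is a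
diagonalization of the limit. -/
theorem continuous_eigs : Continuous (eigs : Matrix (Fin n) (Fin n) ℝ → Fin n → ℝ) := by
  rw [continuous_iff_continuousAt]
  intro A
  rw [ContinuousAt, Filter.tendsto_iff_ultrafilter]
  intro g hg
  -- along an ultrafilter the eigenvectors and eigenvalues converge
  have hUc : ∃ U₀ : Fin n → Fin n → ℝ,
      Filter.Tendsto (fun X (i a : Fin n) => eigBasis X a i) g (nhds U₀) := by
    have hK : IsCompact (Set.univ.pi fun _ : Fin n => Set.univ.pi fun _ : Fin n =>
        Set.Icc (-1 : ℝ) 1) := isCompact_univ_pi fun _ => isCompact_univ_pi fun _ => isCompact_Icc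
    obtain ⟨U₀, -, hU₀⟩ := hK.ultrafilter_le_nhds
      (g.map (fun X (i a : Fin n) => eigBasis X a i)) (by
        rw [Filter.le_principal_iff]
        refine Filter.mem_map.2 (Filter.Eventually.of_forall fun X i _ a _ => ?_)
        exact abs_le.1 (abs_basis_apply_le (eigBasis X) a i))
    exact ⟨U₀, hU₀⟩
  have hlc : ∃ l : Fin n → ℝ, Filter.Tendsto eigs g (nhds l) := by
    set R := (∑ i, ∑ j, |symPart A i j|) + 1
    have hcont : Continuous fun X : Matrix (Fin n) (Fin n) ℝ => ∑ i, ∑ j, |symPart X i j| := by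
      have := continuous_symPart (n := n)
      fun_prop
    have hev : ∀ᶠ X in (g : Filter (Matrix (Fin n) (Fin n) ℝ)), ∑ i, ∑ j, |symPart X i j| < R :=
      hg ((hcont.tendsto A).eventually (gt_mem_nhds (lt_add_one _)))
    have hK : IsCompact (Set.univ.pi fun _ : Fin n => Set.Icc (-R) R) :=
      isCompact_univ_pi fun _ => isCompact_Icc
    obtain ⟨l, -, hl⟩ := hK.ultrafilter_le_nhds (g.map eigs) (by
        rw [Filter.le_principal_iff]
        refine hev.mono fun X hX a _ => ?_
        exact abs_le.1 ((abs_eigs_le X a).trans hX.le))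
    exact ⟨l, hl⟩
  obtain ⟨U₀, hU₀⟩ := hUc
  obtain ⟨l, hl⟩ := hlc
  have hU₀' : ∀ i a, Filter.Tendsto (fun X => eigBasis X a i) g (nhds (U₀ i a)) := fun i a =>
    tendsto_pi_nhds.1 (tendsto_pi_nhds.1 hU₀ i) a
  have hl' : ∀ a, Filter.Tendsto (fun X => eigs X a) g (nhds (l a)) := tendsto_pi_nhds.1 hl
  have hsym : Filter.Tendsto symPart g (nhds (symPart A)) :=
    (continuous_symPart.tendsto A).mono_left hg
  rwa [eq_eigs_of_diagonalizes (X := A) (U := Matrix.of U₀) (l := l)] at hl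
  · ext i j
    simp only [Matrix.mul_apply, Matrix.transpose_apply, Matrix.of_apply, Matrix.one_apply]
    refine tendsto_nhds_unique (tendsto_finsetSum _ fun a _ => (hU₀' i a).mul (hU₀' j a)) ?_
    simp_rw [sum_basis_mul]
    exact tendsto_const_nhds
  · ext i j
    have h1 : Filter.Tendsto (fun X => symPart X i j) g (nhds (symPart A i j)) :=
      tendsto_pi_nhds.1 (tendsto_pi_nhds.1 hsym i) j
    have h2 : Filter.Tendsto (fun X => symPart X i j) g
        (nhds (∑ a, l a * (U₀ i a * U₀ j a))) := by
      simp_rw [symPart_eq_spectralMat, spectralMat, Matrix.of_apply]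
      exact tendsto_finsetSum _ fun a _ => (hl' a).mul ((hU₀' i a).mul (hU₀' j a))
    rw [tendsto_nhds_unique h1 h2]
    simp only [Matrix.mul_apply (N := Matrix.transpose _), Matrix.mul_diagonal,
      Matrix.transpose_apply, Matrix.of_apply]
    exact Finset.sum_congr rfl fun a _ => by ring
  · intro i j hij
    exact le_of_tendsto_of_tendsto (hl' _) (hl' _)
      (Filter.Eventually.of_forall fun X => eigs_antitone_comp X hij)

/-- A polynomial of a diagonalized matrix. -/
theorem aeval_spectralMat (b : OrthonormalBasis (Fin n) ℝ (E n)) (m : Fin n → ℝ)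
    (q : Polynomial ℝ) :
    Polynomial.aeval (spectralMat b m) q = spectralMat b fun a => q.eval (m a) := by
  have hmul : ∀ m₁ m₂ : Fin n → ℝ, spectralMat b m₁ * spectralMat b m₂ =
      spectralMat b fun a => m₁ a * m₂ a := by
    intro m₁ m₂
    ext i j
    simp only [Matrix.mul_apply, spectralMat, Matrix.of_apply, Finset.sum_mul_sum]
    rw [Finset.sum_comm]
    refine Finset.sum_congr rfl fun a _ => ?_
    rw [Finset.sum_comm]
    have : ∀ c, ∑ k, m₁ a * (b a i * b a k) * (m₂ c * (b c k * b c j)) =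
        if a = c then m₁ a * m₂ c * (b a i * b c j) else 0 := by
      intro c
      have h := inner_basis_basis b a c
      rw [inner_eq_sum] at h
      calc _ = m₁ a * m₂ c * (b a i * b c j) * ∑ k, b a k * b c k := by
            rw [Finset.mul_sum]
            exact Finset.sum_congr rfl fun k _ => by ring
        _ = _ := by rw [h]; split_ifs <;> simp
    simp_rw [this]
    simp
  have hone : spectralMat b (fun _ => 1) = 1 := by
    ext i j
    simp only [spectralMat, Matrix.of_apply, one_mul, sum_basis_mul, Matrix.one_apply]
  have hsmul : ∀ (s : ℝ) (m₁ : Fin n → ℝ), spectralMat b (fun a => s * m₁ a) =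
      s • spectralMat b m₁ := by
    intro s m₁
    ext i j
    simp only [spectralMat, Matrix.of_apply, Matrix.smul_apply, smul_eq_mul, Finset.mul_sum,
      mul_assoc]
  induction q using Polynomial.induction_on' with
  | add p q hp hq =>
    rw [map_add, hp, hq]
    ext i j
    simp only [spectralMat, Matrix.of_apply, Matrix.add_apply, Polynomial.eval_add, add_mul,
      Finset.sum_add_distrib]
  | monomial k c =>
    rw [Polynomial.aeval_monomial]
    simp only [Polynomial.eval_monomial]
    rw [hsmul, Algebra.algebraMap_eq_smul_one, smul_mul_assoc, one_mul]
    congr 1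
    induction k with
    | zero => simp [hone]
    | succ k ih => rw [pow_succ, ih, hmul]; simp only [pow_succ]

end Spectral

/-! ### Concave functions of the eigenvalues -/

section SpectralFunction

variable {n : ℕ} {Γ : Set (Fin n → ℝ)} {f : (Fin n → ℝ) → ℝ}

/-- The gradient of `F = f ∘ λ` at `X`: it has the eigenvectors of `X`, and the partial derivatives
of `f` as eigenvalues. -/
noncomputable def gradMat (f : (Fin n → ℝ) → ℝ) (X : Matrix (Fin n) (Fin n) ℝ) :
    Matrix (Fin n) (Fin n) ℝ :=
  spectralMat (eigBasis X) (grad f (eigs X))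

theorem quad_symPart (X : Matrix (Fin n) (Fin n) ℝ) (ξ : E n) : quad (symPart X) ξ = quad X ξ := by
  have h : ∑ i, ∑ j, X j i * (ξ i * ξ j) = quad X ξ := by
    rw [Finset.sum_comm, quad]
    exact Finset.sum_congr rfl fun i _ => Finset.sum_congr rfl fun j _ => by ring
  have e : quad (symPart X) ξ = 1 / 2 * (quad X ξ + ∑ i, ∑ j, X j i * (ξ i * ξ j)) := by
    simp only [quad, symPart, Matrix.smul_apply, Matrix.add_apply, Matrix.transpose_apply,
      smul_eq_mul, ← Finset.sum_add_distrib, Finset.mul_sum]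
    exact Finset.sum_congr rfl fun i _ => Finset.sum_congr rfl fun j _ => by ring
  rw [e, h]
  ring

theorem quad_add (X Y : Matrix (Fin n) (Fin n) ℝ) (ξ : E n) :
    quad (X + Y) ξ = quad X ξ + quad Y ξ := by
  simp only [quad, Matrix.add_apply, add_mul, Finset.sum_add_distrib]

theorem quad_sub (X Y : Matrix (Fin n) (Fin n) ℝ) (ξ : E n) :
    quad (X - Y) ξ = quad X ξ - quad Y ξ := by
  simp only [quad, Matrix.sub_apply, sub_mul, Finset.sum_sub_distrib]

theorem quad_smul_one (s : ℝ) (ξ : E n) :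
    quad (s • (1 : Matrix (Fin n) (Fin n) ℝ)) ξ = s * ‖ξ‖ ^ 2 := by
  rw [← real_inner_self_eq_norm_sq, inner_eq_sum, quad, Finset.mul_sum]
  refine Finset.sum_congr rfl fun i _ => ?_
  simp [Matrix.one_apply]

theorem quad_vecMulVec (v ξ : E n) : quad (Matrix.vecMulVec v v) ξ = inner ℝ v ξ ^ 2 := by
  rw [inner_eq_sum, sq, Finset.sum_mul_sum, quad]
  refine Finset.sum_congr rfl fun i _ => Finset.sum_congr rfl fun j _ => ?_
  rw [Matrix.vecMulVec_apply]
  ring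

theorem quad_eigBasis_self (X : Matrix (Fin n) (Fin n) ℝ) (a : Fin n) :
    quad X (eigBasis X a) = eigs X a := by
  rw [← quad_symPart, symPart_eq_spectralMat, quad_spectralMat_self]

/-- The diagonal of `X` in an orthonormal basis is a doubly stochastic average of the
eigenvalues. -/
theorem exists_quad_basis_eq_mulVec (X : Matrix (Fin n) (Fin n) ℝ)
    (b : OrthonormalBasis (Fin n) ℝ (E n)) :
    ∃ D ∈ doublyStochastic ℝ (Fin n), (fun a => quad X (b a)) = D.mulVec (eigs X) := by
  refine ⟨_, inner_sq_mem_doublyStochastic b (eigBasis X), ?_⟩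
  rw [← quad_basis_eq_mulVec, ← symPart_eq_spectralMat]
  simp_rw [quad_symPart]

/-- `F` lies below its tangent planes. -/
theorem StructureConditions.specFun_le_tangent (hΓ : IsSymmetricCone Γ)
    (hf : StructureConditions Γ f) {A X : Matrix (Fin n) (Fin n) ℝ} (hA : eigs A ∈ Γ)
    (hX : eigs X ∈ Γ) :
    specFun f X ≤ specFun f A + ∑ i, ∑ j, gradMat f A i j * (X - A) i j := by
  obtain ⟨D, hD, hDe⟩ := exists_quad_basis_eq_mulVec X (eigBasis A)
  have h1 := hf.le_mulVec hΓ hD hX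
  have h2 := hf.le_tangent hΓ hA (hΓ.mulVec_mem hD hX)
  rw [gradMat, sum_spectralMat_mul]
  simp_rw [quad_sub, quad_eigBasis_self]
  rw [← hDe] at h1 h2
  exact h1.trans h2

theorem isOpen_eigs_mem (hΓ : IsSymmetricCone Γ) :
    IsOpen {X : Matrix (Fin n) (Fin n) ℝ | eigs X ∈ Γ} :=
  hΓ.isOpen.preimage continuous_eigs

theorem StructureConditions.continuousAt_specFun (hΓ : IsSymmetricCone Γ)
    (hf : StructureConditions Γ f) {A : Matrix (Fin n) (Fin n) ℝ} (hA : eigs A ∈ Γ) :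
    ContinuousAt (specFun f) A :=
  ContinuousAt.comp (g := f) (hf.differentiableAt hΓ hA).continuousAt continuous_eigs.continuousAt

/-- The gradient of `F` is continuous. Near `A` it is uniformly close to the polynomial of the
matrix that interpolates the values of the partial derivatives of `f` at the eigenvalues of `A`;
this polynomial exists because equal eigenvalues have equal partial derivatives. -/
theorem StructureConditions.continuousAt_gradMat (hΓ : IsSymmetricCone Γ)
    (hf : StructureConditions Γ f) {A : Matrix (Fin n) (Fin n) ℝ} (hA : eigs A ∈ Γ) :
    ContinuousAt (gradMat f) A := by
  obtain ⟨q, hq⟩ : ∃ q : Polynomial ℝ, ∀ a, q.eval (eigs A a) = grad f (eigs A) a := by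
    classical
    let r : ℝ → ℝ := fun y => if h : ∃ a, eigs A a = y then grad f (eigs A) h.choose else 0
    refine ⟨Lagrange.interpolate (Finset.univ.image (eigs A)) id r, fun a => ?_⟩
    have h := Lagrange.eval_interpolate_at_node (s := Finset.univ.image (eigs A)) (v := id) r
      Function.injective_id.injOn (Finset.mem_image_of_mem _ (Finset.mem_univ a))
    rw [id] at h
    rw [h]
    have hex : ∃ c, eigs A c = eigs A a := ⟨a, rfl⟩
    simp only [r, dif_pos hex]
    exact hf.grad_eq_of_eq hΓ hA hex.choose_spec
  have hgc : ∀ a, ContinuousAt (fun X : Matrix (Fin n) (Fin n) ℝ => grad f (eigs X) a) A :=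
    fun a => ContinuousAt.comp (g := fun l => grad f l a)
      ((hf.continuousOn_grad hΓ a).continuousAt (hΓ.isOpen.mem_nhds hA))
      continuous_eigs.continuousAt
  have hqc : ∀ a, Continuous (fun X : Matrix (Fin n) (Fin n) ℝ => q.eval (eigs X a)) :=
    fun a => q.continuous.comp ((continuous_apply a).comp continuous_eigs)
  have hpoly : Continuous fun X : Matrix (Fin n) (Fin n) ℝ => Polynomial.aeval (symPart X) q :=
    (Polynomial.continuous_aeval q).comp continuous_symPart
  have hpolyA : Polynomial.aeval (symPart A) q = gradMat f A := by
    rw [symPart_eq_spectralMat, aeval_spectralMat, gradMat]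
    simp_rw [hq]
  have hdiff : Filter.Tendsto (fun X => ∑ a, |grad f (eigs X) a - q.eval (eigs X a)|) (nhds A)
      (nhds 0) := by
    have h : ContinuousAt (fun X => ∑ a, |grad f (eigs X) a - q.eval (eigs X a)|) A :=
      tendsto_finsetSum _ fun a _ => ((hgc a).sub (hqc a).continuousAt).abs
    have h0 : ∑ a, |grad f (eigs A) a - q.eval (eigs A a)| = 0 :=
      Finset.sum_eq_zero fun a _ => by rw [hq, sub_self, abs_zero]
    rw [← h0]
    exact h
  have hentry : ∀ i j, Filter.Tendsto (fun X => gradMat f X i j) (nhds A)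
      (nhds (gradMat f A i j)) := by
    intro i j
    have h1 : Filter.Tendsto (fun X => gradMat f X i j - Polynomial.aeval (symPart X) q i j)
        (nhds A) (nhds 0) := by
      refine squeeze_zero_norm (fun X => ?_) hdiff
      rw [symPart_eq_spectralMat, aeval_spectralMat, gradMat]
      simp only [spectralMat, Matrix.of_apply, ← Finset.sum_sub_distrib, ← sub_mul]
      refine (norm_sum_le _ _).trans (Finset.sum_le_sum fun a _ => ?_)
      rw [norm_mul, norm_mul]
      have : ‖eigBasis X a i‖ * ‖eigBasis X a j‖ ≤ 1 :=
        mul_le_one₀ (abs_basis_apply_le _ a i) (norm_nonneg _) (abs_basis_apply_le _ a j)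
      exact mul_le_of_le_one_right (norm_nonneg _) this
    have h2 : Filter.Tendsto (fun X => Polynomial.aeval (symPart X) q i j) (nhds A)
        (nhds (gradMat f A i j)) := by
      rw [← hpolyA]
      exact tendsto_pi_nhds.1 (tendsto_pi_nhds.1 (hpoly.tendsto A) i) j
    simpa using h1.add h2
  exact tendsto_pi_nhds.2 fun i => tendsto_pi_nhds.2 fun j => hentry i j

/-- The chain rule for `F` along a differentiable curve of matrices. The difference quotient is
squeezed between the ones given by the tangent planes at the two end points. -/
theorem StructureConditions.hasDerivAt_specFun_comp (hΓ : IsSymmetricCone Γ)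
    (hf : StructureConditions Γ f) {A : ℝ → Matrix (Fin n) (Fin n) ℝ}
    {A' : Matrix (Fin n) (Fin n) ℝ} (hA : eigs (A 0) ∈ Γ)
    (hd : ∀ i j, HasDerivAt (fun s => A s i j) (A' i j) 0) :
    HasDerivAt (fun s => specFun f (A s)) (∑ i, ∑ j, gradMat f (A 0) i j * A' i j) 0 := by
  have hc : ContinuousAt A 0 :=
    tendsto_pi_nhds.2 fun i => tendsto_pi_nhds.2 fun j => (hd i j).continuousAt
  rw [hasDerivAt_iff_tendsto_slope]
  have hs : ∀ i j, Filter.Tendsto (fun s => slope (fun s => A s i j) 0 s)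
      (nhdsWithin 0 {0}ᶜ) (nhds (A' i j)) := fun i j => hasDerivAt_iff_tendsto_slope.1 (hd i j)
  have hg : ∀ i j, Filter.Tendsto (fun s => gradMat f (A s) i j) (nhdsWithin 0 {0}ᶜ)
      (nhds (gradMat f (A 0) i j)) := fun i j =>
    (tendsto_pi_nhds.1 (tendsto_pi_nhds.1
      (ContinuousAt.comp (hf.continuousAt_gradMat hΓ hA) hc) i) j).mono_left nhdsWithin_le_nhds
  have hlow : Filter.Tendsto (fun s => ∑ i, ∑ j, gradMat f (A 0) i j *
      slope (fun s => A s i j) 0 s) (nhdsWithin 0 {0}ᶜ)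
      (nhds (∑ i, ∑ j, gradMat f (A 0) i j * A' i j)) :=
    tendsto_finsetSum _ fun i _ => tendsto_finsetSum _ fun j _ => (hs i j).const_mul _
  have hup : Filter.Tendsto (fun s => ∑ i, ∑ j, gradMat f (A s) i j *
      slope (fun s => A s i j) 0 s) (nhdsWithin 0 {0}ᶜ)
      (nhds (∑ i, ∑ j, gradMat f (A 0) i j * A' i j)) :=
    tendsto_finsetSum _ fun i _ => tendsto_finsetSum _ fun j _ => (hg i j).mul (hs i j)
  have hmin := hlow.min hup
  have hmax := hlow.max hup
  rw [min_self] at hmin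
  rw [max_self] at hmax
  have hmem : ∀ᶠ s in nhdsWithin (0 : ℝ) {0}ᶜ, eigs (A s) ∈ Γ :=
    (hc.eventually ((isOpen_eigs_mem hΓ).mem_nhds hA)).filter_mono nhdsWithin_le_nhds
  have key : ∀ᶠ s in nhdsWithin (0 : ℝ) {0}ᶜ,
      slope (fun s => specFun f (A s)) 0 s ∈ Set.uIcc
        (∑ i, ∑ j, gradMat f (A 0) i j * slope (fun s => A s i j) 0 s)
        (∑ i, ∑ j, gradMat f (A s) i j * slope (fun s => A s i j) 0 s) := by
    filter_upwards [hmem, self_mem_nhdsWithin] with s hs hs0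
    have h1 := hf.specFun_le_tangent hΓ hA hs
    have h2 := hf.specFun_le_tangent hΓ hs hA
    have e : ∀ P : Matrix (Fin n) (Fin n) ℝ,
        ∑ i, ∑ j, P i j * slope (fun s => A s i j) 0 s =
          (∑ i, ∑ j, P i j * (A s - A 0) i j) / s := by
      intro P
      simp only [slope_def_field, sub_zero, Finset.sum_div, Matrix.sub_apply, mul_div_assoc]
    have e2 : ∑ i, ∑ j, gradMat f (A s) i j * (A 0 - A s) i j =
        - ∑ i, ∑ j, gradMat f (A s) i j * (A s - A 0) i j := by
      simp only [← Finset.sum_neg_distrib, Matrix.sub_apply]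
      exact Finset.sum_congr rfl fun i _ => Finset.sum_congr rfl fun j _ => by ring
    rw [e, e, slope_def_field, sub_zero]
    rw [e2] at h2
    rcases lt_or_gt_of_ne hs0 with h | h
    · rw [Set.mem_uIcc]
      left
      constructor <;> rw [div_le_div_right_of_neg h] <;> linarith
    · rw [Set.mem_uIcc]
      right
      constructor <;> rw [div_le_div_iff_of_pos_right h] <;> linarith
  refine tendsto_of_tendsto_of_tendsto_of_le_of_le' hmin hmax ?_ ?_
  · filter_upwards [key] with s hs using hs.1
  · filter_upwards [key] with s hs using hs.2

/-- The matrix of partial derivatives `F^{ij}` is the gradient of `F`. -/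
theorem StructureConditions.specDeriv_eq (hΓ : IsSymmetricCone Γ)
    (hf : StructureConditions Γ f) {A : Matrix (Fin n) (Fin n) ℝ} (hA : eigs A ∈ Γ) :
    specDeriv f A = gradMat f A := by
  ext i j
  have h := hf.hasDerivAt_specFun_comp hΓ (A := fun s => A + s • Matrix.single i j 1)
    (A' := Matrix.single i j 1) (by simpa using hA) (fun k l => by
      simp only [Matrix.add_apply, Matrix.smul_apply, smul_eq_mul]
      simpa using ((hasDerivAt_id (0 : ℝ)).mul_const (Matrix.single i j (1 : ℝ) k l)).const_add
        (A k l))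
  have h2 : specDeriv f A i j = ∑ k, ∑ l, gradMat f (A + (0 : ℝ) • Matrix.single i j 1) k l *
      (Matrix.single i j 1 : Matrix (Fin n) (Fin n) ℝ) k l := h.deriv
  rw [h2]
  simp [Matrix.single_apply, ite_and]

theorem eigs_add_eq (X Y : Matrix (Fin n) (Fin n) ℝ) :
    ∃ D ∈ doublyStochastic ℝ (Fin n), ∃ b : OrthonormalBasis (Fin n) ℝ (E n),
      eigs (X + Y) = D.mulVec (eigs X) + fun a => quad Y (b a) := by
  obtain ⟨D, hD, hDe⟩ := exists_quad_basis_eq_mulVec X (eigBasis (X + Y))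
  refine ⟨D, hD, eigBasis (X + Y), ?_⟩
  rw [← hDe]
  ext a
  rw [← quad_eigBasis_self, quad_add]
  rfl

theorem IsSymmetricCone.eigs_add_mem (hΓ : IsSymmetricCone Γ) {X Y : Matrix (Fin n) (Fin n) ℝ}
    (hX : eigs X ∈ Γ) (hY : ∀ ξ, 0 ≤ quad Y ξ) : eigs (X + Y) ∈ Γ := by
  obtain ⟨D, hD, b, h⟩ := eigs_add_eq X Y
  rw [h]
  exact hΓ.add_nonneg_mem (hΓ.mulVec_mem hD hX) fun a => hY _

/-- `F` strictly increases when a non-zero projection is added. -/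
theorem StructureConditions.specFun_lt_add_vecMulVec (hΓ : IsSymmetricCone Γ)
    (hf : StructureConditions Γ f) {X : Matrix (Fin n) (Fin n) ℝ} (hX : eigs X ∈ Γ) {v : E n}
    (hv : v ≠ 0) : specFun f X < specFun f (X + Matrix.vecMulVec v v) := by
  obtain ⟨D, hD, b, h⟩ := eigs_add_eq X (Matrix.vecMulVec v v)
  unfold specFun
  rw [h]
  refine (hf.le_mulVec hΓ hD hX).trans_lt (hf.lt_add_nonneg hΓ (hΓ.mulVec_mem hD hX) ?_ ?_)
  · intro a
    rw [quad_vecMulVec]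
    positivity
  · by_contra! hcon
    apply hv
    have hz : ∀ a, inner ℝ v (b a) = 0 := fun a => by
      have := hcon a
      rw [quad_vecMulVec] at this
      exact pow_eq_zero_iff (two_ne_zero) |>.1 (le_antisymm this (sq_nonneg _))
    rw [← b.sum_repr' v]
    refine Finset.sum_eq_zero fun a _ => ?_
    rw [real_inner_comm, hz, zero_smul]

end SpectralFunction

/-! ### Ellipticity -/

section UniformEllipticity

variable {n : ℕ} {Γ : Set (Fin n → ℝ)} {f : (Fin n → ℝ) → ℝ}

theorem sum_gradMat_mul (f : (Fin n → ℝ) → ℝ) (A X : Matrix (Fin n) (Fin n) ℝ) :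
    ∑ i, ∑ j, gradMat f A i j * X i j = ∑ a, grad f (eigs A) a * quad X (eigBasis A a) :=
  sum_spectralMat_mul _ _ _

/-- The trace of the gradient of `F` is bounded below at all matrices where `F` does not exceed
its value at some point of a fixed compact set: compare with a large multiple of the identity. -/
theorem StructureConditions.exists_trace_lower_bound (hn : 0 < n) (hΓ : IsSymmetricCone Γ)
    (hf : StructureConditions Γ f) {S : Set (Matrix (Fin n) (Fin n) ℝ)} (hS : IsCompact S)
    (hSΓ : ∀ X ∈ S, eigs X ∈ Γ) :
    ∃ c > 0, ∀ X ∈ S, ∀ A, eigs A ∈ Γ → specFun f A ≤ specFun f X →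
      c ≤ ∑ a, grad f (eigs A) a := by
  obtain ⟨R, hR⟩ := ((hS.image continuous_eigs).isBounded).exists_norm_le
  set s := max R 0 + 1
  have hs : 0 < s := by positivity
  have hlt : ∀ X ∈ S, 0 < f (fun _ => s) - specFun f X := by
    intro X hX
    have hb : ∀ a, eigs X a < s := fun a => by
      have h1 := hR _ (Set.mem_image_of_mem _ hX)
      have h2 := norm_le_pi_norm (eigs X) a
      have h3 := le_abs_self (eigs X a)
      rw [Real.norm_eq_abs] at h2
      have h4 := le_max_left R 0
      linarith
    have h := hf.lt_add_nonneg hΓ (hSΓ X hX) (y := fun a => s - eigs X a)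
      (fun a => by linarith [hb a]) ⟨⟨0, hn⟩, by linarith [hb ⟨0, hn⟩]⟩
    have e : eigs X + (fun a => s - eigs X a) = fun _ => s := by ext; simp
    rw [e] at h
    exact sub_pos.2 h
  have hcont : ContinuousOn (fun X => f (fun _ => s) - specFun f X) S := fun X hX =>
    (continuousAt_const.sub (hf.continuousAt_specFun hΓ (hSΓ X hX))).continuousWithinAt
  obtain ⟨c, hc, hcS⟩ := hS.exists_forall_le' hcont hlt
  refine ⟨c / s, by positivity, fun X hX A hA hAX => ?_⟩
  have h1 := hf.le_tangent hΓ hA (hΓ.pos_mem (fun _ => s) fun _ => hs)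
  have h2 := hf.sum_grad_mul_nonneg hΓ hA
  have h3 := hcS X hX
  simp only [mul_sub, Finset.sum_sub_distrib, ← Finset.sum_mul] at h1
  rw [div_le_iff₀ hs]
  change f (eigs A) ≤ _ at hAX
  linarith

/-- The basic alternative: where `F[A] ≤ F[X]`, with `X` in a fixed compact set, either the
gradient of `F` at `A` is uniformly elliptic or the derivative of `F` at `A` towards `X` is large.
If the eigenvalue of the gradient in the direction `v` is small, then `X` may be replaced by
`X + v ⊗ v - a I`, which for small `a` still has a larger value of `F` than `X`. -/
theorem StructureConditions.exists_elliptic_or_large (hΓ : IsSymmetricCone Γ)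
    (hf : StructureConditions Γ f) {S : Set (Matrix (Fin n) (Fin n) ℝ)} (hS : IsCompact S)
    (hSΓ : ∀ X ∈ S, eigs X ∈ Γ) :
    ∃ θ > 0, ∀ X ∈ S, ∀ A, eigs A ∈ Γ → specFun f A ≤ specFun f X →
      (∀ a, θ * ∑ c, grad f (eigs A) c ≤ grad f (eigs A) a) ∨
        θ * (1 + ∑ c, grad f (eigs A) c) ≤ ∑ i, ∑ j, gradMat f A i j * (X - A) i j := by
  let Y : (Matrix (Fin n) (Fin n) ℝ × E n) × ℝ → Matrix (Fin n) (Fin n) ℝ := fun z =>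
    z.1.1 + Matrix.vecMulVec z.1.2 z.1.2 - z.2 • (1 : Matrix (Fin n) (Fin n) ℝ)
  have hY : Continuous Y := by
    refine continuous_pi fun i => continuous_pi fun j => ?_
    simp only [Y, Matrix.sub_apply, Matrix.add_apply, Matrix.vecMulVec_apply, Matrix.smul_apply]
    have : Continuous fun z : (Matrix (Fin n) (Fin n) ℝ × E n) × ℝ => z.1.1 i j :=
      (continuous_apply_apply i j).comp (continuous_fst.comp continuous_fst)
    fun_prop
  let W : Set ((Matrix (Fin n) (Fin n) ℝ × E n) × ℝ) :=
    {z | eigs z.1.1 ∈ Γ ∧ eigs (Y z) ∈ Γ ∧ specFun f z.1.1 < specFun f (Y z)}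
  have hfst : Continuous fun z : (Matrix (Fin n) (Fin n) ℝ × E n) × ℝ => z.1.1 := by fun_prop
  have hW : IsOpen W := by
    rw [isOpen_iff_mem_nhds]
    rintro z ⟨h1, h2, h3⟩
    have c1 : ContinuousAt (fun z : (Matrix (Fin n) (Fin n) ℝ × E n) × ℝ => specFun f z.1.1) z :=
      ContinuousAt.comp (g := specFun f) (hf.continuousAt_specFun hΓ h1) hfst.continuousAt
    have c2 : ContinuousAt (fun z => specFun f (Y z)) z :=
      ContinuousAt.comp (g := specFun f) (hf.continuousAt_specFun hΓ h2) hY.continuousAt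
    filter_upwards [hfst.continuousAt.eventually ((isOpen_eigs_mem hΓ).mem_nhds h1),
      hY.continuousAt.eventually ((isOpen_eigs_mem hΓ).mem_nhds h2),
      c1.eventually_lt c2 h3] with z' h1' h2' h3' using ⟨h1', h2', h3'⟩
  have hK : IsCompact (S ×ˢ Metric.sphere (0 : E n) 1) := hS.prod (isCompact_sphere 0 1)
  obtain ⟨u, v, -, hv, hu, h0v, huv⟩ := generalized_tube_lemma hK
    (isCompact_singleton (x := (0 : ℝ))) hW (by
      rintro ⟨⟨X, ξ⟩, a⟩ ⟨⟨hX, hξ⟩, ha⟩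
      obtain rfl : a = 0 := ha
      have hξ0 : ξ ≠ 0 := by
        rintro rfl
        simp at hξ
      have e : Y ((X, ξ), 0) = X + Matrix.vecMulVec ξ ξ := by simp [Y]
      refine ⟨hSΓ X hX, ?_, ?_⟩
      · rw [e]
        exact hΓ.eigs_add_mem (hSΓ X hX) fun ζ => by rw [quad_vecMulVec]; positivity
      · rw [e]
        exact hf.specFun_lt_add_vecMulVec hΓ (hSΓ X hX) hξ0)
  obtain ⟨a, hav, ha⟩ : ∃ a ∈ v, 0 < a := by
    have h := hv.mem_nhds (h0v rfl)
    obtain ⟨a, ha, ha0⟩ := ((Filter.Eventually.filter_mono nhdsWithin_le_nhds h).and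
      (self_mem_nhdsWithin (a := (0 : ℝ)) (s := Set.Ioi 0))).exists
    exact ⟨a, ha, ha0⟩
  have hmem : ∀ z ∈ S ×ˢ Metric.sphere (0 : E n) 1, (z, a) ∈ W := fun z hz => huv ⟨hu hz, hav⟩
  obtain ⟨c, hc, hcS⟩ := hK.exists_forall_le'
    (f := fun z => specFun f (Y (z, a)) - specFun f z.1) (a := 0) (by
      intro z hz
      obtain ⟨h1, h2, -⟩ := hmem z hz
      have hYz : Continuous fun z => Y (z, a) := by fun_prop
      have c1 : ContinuousAt (fun z : Matrix (Fin n) (Fin n) ℝ × E n => specFun f z.1) z :=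
        ContinuousAt.comp (g := specFun f) (hf.continuousAt_specFun hΓ h1) continuousAt_fst
      have c2 : ContinuousAt (fun z => specFun f (Y (z, a))) z :=
        ContinuousAt.comp (g := specFun f) (hf.continuousAt_specFun hΓ h2) hYz.continuousAt
      exact (c2.sub c1).continuousWithinAt) (fun z hz => sub_pos.2 (hmem z hz).2.2)
  refine ⟨min c (a / 2), lt_min hc (by positivity), fun X hX A hA hAX => ?_⟩
  set T := ∑ c, grad f (eigs A) c
  have hT : 0 ≤ T := Finset.sum_nonneg fun c _ => (hf.deriv_pos _ hA c).le
  have hθ1 : min c (a / 2) ≤ c := min_le_left _ _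
  have hθ2 : min c (a / 2) * T ≤ a / 2 * T := mul_le_mul_of_nonneg_right (min_le_right _ _) hT
  by_cases hcase : ∀ d, min c (a / 2) * T ≤ grad f (eigs A) d
  · exact Or.inl hcase
  right
  push Not at hcase
  obtain ⟨d, hd⟩ := hcase
  have hz : (X, eigBasis A d) ∈ S ×ˢ Metric.sphere (0 : E n) 1 :=
    ⟨hX, by simp [(eigBasis A).norm_eq_one]⟩
  obtain ⟨-, h2, -⟩ := hmem _ hz
  have h3 := hcS _ hz
  have h4 := hf.specFun_le_tangent hΓ hA h2
  have e : ∑ i, ∑ j, gradMat f A i j * (Y ((X, eigBasis A d), a) - A) i j =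
      (∑ i, ∑ j, gradMat f A i j * (X - A) i j) + grad f (eigs A) d - a * T := by
    have e1 : Y ((X, eigBasis A d), a) - A = (X - A) +
        Matrix.vecMulVec (eigBasis A d) (eigBasis A d) -
          a • (1 : Matrix (Fin n) (Fin n) ℝ) := by
      simp only [Y]
      abel
    rw [e1, sum_gradMat_mul, sum_gradMat_mul]
    simp only [quad_sub, quad_add, quad_vecMulVec, quad_smul_one, inner_basis_basis,
      (eigBasis A).norm_eq_one, T, mul_sub, mul_add, Finset.sum_add_distrib,
      Finset.sum_sub_distrib, Finset.mul_sum]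
    simp [mul_comm]
  rw [e] at h4
  simp only at h3
  linarith

end UniformEllipticity

/-! ### Domains with smooth boundary -/

section Domain

variable {n : ℕ} {Ω : Set (E n)}

theorem IsSmoothBoundedDomain.isCompact_closure (hΩ : IsSmoothBoundedDomain Ω) :
    IsCompact (closure Ω) := hΩ.isBounded.isCompact_closure

theorem IsSmoothBoundedDomain.isCompact_frontier (hΩ : IsSmoothBoundedDomain Ω) :
    IsCompact (frontier Ω) :=
  hΩ.isCompact_closure.of_isClosed_subset isClosed_frontier frontier_subset_closure

theorem IsSmoothBoundedDomain.notMem_of_mem_frontier (hΩ : IsSmoothBoundedDomain Ω) {x : E n}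
    (hx : x ∈ frontier Ω) : x ∉ Ω := by
  rw [hΩ.isOpen.frontier_eq] at hx
  exact hx.2

theorem IsSmoothBoundedDomain.mem_or_mem_frontier (hΩ : IsSmoothBoundedDomain Ω) {x : E n}
    (hx : x ∈ closure Ω) : x ∈ Ω ∨ x ∈ frontier Ω := by
  by_cases h : x ∈ Ω
  · exact Or.inl h
  · right
    rw [hΩ.isOpen.frontier_eq]
    exact ⟨hx, h⟩

theorem eventually_pos_of_fderiv_pos {ρ : E n → ℝ} {x h : E n} (hd : DifferentiableAt ℝ ρ x)
    (h0 : ρ x = 0) (hpos : 0 < fderiv ℝ ρ x h) :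
    ∀ᶠ t in nhdsWithin (0 : ℝ) (Set.Ioi 0), 0 < ρ (x + t • h) := by
  have hline := hasDerivAt_comp_line hd h
  have hs := (hasDerivAt_iff_tendsto_slope.1 hline).mono_left
    (nhdsWithin_mono _ (fun x (hx : x ∈ Set.Ioi (0 : ℝ)) => ne_of_gt hx))
  filter_upwards [hs.eventually (lt_mem_nhds hpos), self_mem_nhdsWithin] with t ht ht0
  rw [slope_def_field] at ht
  simp only [zero_smul, add_zero, h0, sub_zero] at ht
  have ht0' : (0 : ℝ) < t := ht0
  by_contra! hcon
  exact absurd ht (not_lt.2 (div_nonpos_of_nonpos_of_nonneg hcon ht0'.le))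

theorem exists_fderiv_pos {L : E n →L[ℝ] ℝ} (hL : L ≠ 0) : ∃ h, 0 < L h := by
  by_contra! hcon
  apply hL
  ext h
  have h1 := hcon h
  have h2 := hcon (-h)
  rw [map_neg] at h2
  simp only [zero_apply]
  linarith

/-- Near a boundary point the boundary is a regular level set of a defining function. -/
theorem IsSmoothBoundedDomain.exists_defining_function (hΩ : IsSmoothBoundedDomain Ω) {x₀ : E n}
    (hx₀ : x₀ ∈ frontier Ω) : ∃ (V : Set (E n)) (ρ : E n → ℝ), IsOpen V ∧ x₀ ∈ V ∧
      ContDiffOn ℝ ∞ ρ V ∧ (∀ x ∈ V, fderiv ℝ ρ x ≠ 0) ∧ (∀ x ∈ V, (x ∈ Ω ↔ 0 < ρ x)) ∧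
      ∀ x ∈ V, (x ∈ frontier Ω ↔ ρ x = 0) := by
  obtain ⟨V, ρ, hV, hxV, hρ, hρ0, hVΩ⟩ := hΩ.smooth_boundary x₀ hx₀
  have hcont : ContinuousOn (fderiv ℝ ρ) V := hρ.continuousOn_fderiv_of_isOpen hV (by simp)
  have hV' : IsOpen (V ∩ fderiv ℝ ρ ⁻¹' {0}ᶜ) :=
    hcont.isOpen_inter_preimage hV isOpen_compl_singleton
  refine ⟨V ∩ fderiv ℝ ρ ⁻¹' {0}ᶜ, ρ, hV', ⟨hxV, hρ0⟩, hρ.mono Set.inter_subset_left,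
    fun x hx => hx.2, fun x hx => hVΩ x hx.1, fun x hx => ⟨fun hxf => ?_, fun hx0 => ?_⟩⟩
  · refine le_antisymm ?_ ?_
    · exact not_lt.1 fun h => hΩ.notMem_of_mem_frontier hxf ((hVΩ x hx.1).2 h)
    · by_contra! hneg
      have hev : ∀ᶠ z in nhds x, ρ z < 0 :=
        (hρ.continuousOn.continuousAt (hV.mem_nhds hx.1)).eventually (gt_mem_nhds hneg)
      obtain ⟨z, ⟨hz1, hz2⟩, hzΩ⟩ := mem_closure_iff_nhds.1 (frontier_subset_closure hxf) _
        (Filter.inter_mem hev (hV.mem_nhds hx.1))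
      have h1 : ρ z < 0 := hz1
      exact absurd ((hVΩ z hz2).1 hzΩ) (not_lt.2 h1.le)
  · rw [hΩ.isOpen.frontier_eq]
    refine ⟨?_, fun hxΩ => by have := (hVΩ x hx.1).1 hxΩ; linarith⟩
    obtain ⟨h, hh⟩ := exists_fderiv_pos hx.2
    have hd : DifferentiableAt ℝ ρ x :=
      (hρ.contDiffAt (hV.mem_nhds hx.1)).differentiableAt (by simp)
    have hev := eventually_pos_of_fderiv_pos hd hx0 hh
    have ht : Filter.Tendsto (fun t : ℝ => x + t • h) (nhdsWithin 0 (Set.Ioi 0)) (nhds x) := by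
      have : Continuous (fun t : ℝ => x + t • h) := by fun_prop
      have h2 := this.tendsto 0
      simp only [zero_smul, add_zero] at h2
      exact h2.mono_left nhdsWithin_le_nhds
    refine mem_closure_of_tendsto ht ?_
    filter_upwards [hev, ht.eventually (hV.mem_nhds hx.1)] with t h1 h2
    exact (hVΩ _ h2).2 h1

/-- At a boundary point there is a nonzero linear form such that all directions in which it is
positive point into the domain. -/
theorem IsSmoothBoundedDomain.exists_inward (hΩ : IsSmoothBoundedDomain Ω) {x₀ : E n}
    (hx₀ : x₀ ∈ frontier Ω) : ∃ L : E n →L[ℝ] ℝ, L ≠ 0 ∧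
      ∀ h, 0 < L h → ∀ᶠ t in nhdsWithin (0 : ℝ) (Set.Ioi 0), x₀ + t • h ∈ Ω := by
  obtain ⟨V, ρ, hV, hxV, hρ, hρ0, hVΩ, hVf⟩ := hΩ.exists_defining_function hx₀
  refine ⟨fderiv ℝ ρ x₀, hρ0 x₀ hxV, fun h hh => ?_⟩
  have hd : DifferentiableAt ℝ ρ x₀ :=
    (hρ.contDiffAt (hV.mem_nhds hxV)).differentiableAt (by simp)
  have ht : Filter.Tendsto (fun t : ℝ => x₀ + t • h) (nhdsWithin 0 (Set.Ioi 0)) (nhds x₀) := by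
    have : Continuous (fun t : ℝ => x₀ + t • h) := by fun_prop
    have h2 := this.tendsto 0
    simp only [zero_smul, add_zero] at h2
    exact h2.mono_left nhdsWithin_le_nhds
  filter_upwards [eventually_pos_of_fderiv_pos hd ((hVf x₀ hxV).1 hx₀) hh,
    ht.eventually (hV.mem_nhds hxV)] with t h1 h2
  exact (hVΩ _ h2).2 h1

theorem mem_tangentConeAt_of_eventually {s : Set (E n)} {x h : E n}
    (hev : ∀ᶠ t in nhdsWithin (0 : ℝ) (Set.Ioi 0), x + t • h ∈ s) :
    h ∈ tangentConeAt ℝ s x := by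
  refine mem_tangentConeAt_of_add_smul_mem (l := nhdsWithin (0 : ℝ) (Set.Ioi 0))
    (c := fun t => t) ?_ hev
  exact Filter.tendsto_id.mono_right
    (nhdsWithin_mono _ (fun x (hx : x ∈ Set.Ioi (0 : ℝ)) => ne_of_gt hx))

theorem IsSmoothBoundedDomain.uniqueDiffOn (hΩ : IsSmoothBoundedDomain Ω) :
    UniqueDiffOn ℝ (closure Ω) := by
  intro x hx
  rcases hΩ.mem_or_mem_frontier hx with h | h
  · exact (hΩ.isOpen.uniqueDiffWithinAt h).mono subset_closure
  obtain ⟨L, hL, hLΩ⟩ := hΩ.exists_inward h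
  refine ⟨?_, subset_closure hx⟩
  -- the inward directions form a nonempty open set, hence span
  have hsub : {h | 0 < L h} ⊆ tangentConeAt ℝ (closure Ω) x := fun h hh =>
    tangentConeAt_mono subset_closure (mem_tangentConeAt_of_eventually (hLΩ h hh))
  have hopen : IsOpen {h | 0 < L h} := isOpen_lt continuous_const L.continuous
  have htop : Submodule.span ℝ (tangentConeAt ℝ (closure Ω) x) = ⊤ := by
    apply Submodule.eq_top_of_nonempty_interior'
    obtain ⟨h, hh⟩ := exists_fderiv_pos hL
    exact ⟨h, mem_interior.2 ⟨_, fun z hz => Submodule.subset_span (hsub hz), hopen, hh⟩⟩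
  rw [htop]
  exact dense_univ

/-- A linear form that is bounded on the inward directions at a boundary point is bounded. -/
theorem IsSmoothBoundedDomain.norm_le_of_inward (hΩ : IsSmoothBoundedDomain Ω) {x₀ : E n}
    (hx₀ : x₀ ∈ frontier Ω) {T : E n →L[ℝ] ℝ} {C : ℝ} (hC : 0 ≤ C)
    (hT : ∀ h, (∀ᶠ t in nhdsWithin (0 : ℝ) (Set.Ioi 0), x₀ + t • h ∈ Ω) → |T h| ≤ C * ‖h‖) :
    ‖T‖ ≤ C := by
  obtain ⟨L, hL, hLΩ⟩ := hΩ.exists_inward hx₀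
  refine T.opNorm_le_bound hC fun h => ?_
  rw [Real.norm_eq_abs]
  rcases lt_trichotomy (L h) 0 with hlt | heq | hgt
  · have := hT (-h) (hLΩ _ (by rw [map_neg]; linarith))
    rwa [map_neg, abs_neg, norm_neg] at this
  · -- approximate a tangential direction by inward ones
    obtain ⟨k, hk⟩ := exists_fderiv_pos hL
    have hc1 : Filter.Tendsto (fun s : ℝ => |T (h + s • k)|) (nhdsWithin 0 (Set.Ioi 0))
        (nhds |T h|) := by
      have : Continuous (fun s : ℝ => |T (h + s • k)|) := by fun_prop
      have h2 := this.tendsto 0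
      simp only [zero_smul, add_zero] at h2
      exact h2.mono_left nhdsWithin_le_nhds
    have hc2 : Filter.Tendsto (fun s : ℝ => C * ‖h + s • k‖) (nhdsWithin 0 (Set.Ioi 0))
        (nhds (C * ‖h‖)) := by
      have : Continuous (fun s : ℝ => C * ‖h + s • k‖) := by fun_prop
      have h2 := this.tendsto 0
      simp only [zero_smul, add_zero] at h2
      exact h2.mono_left nhdsWithin_le_nhds
    refine le_of_tendsto_of_tendsto hc1 hc2 ?_
    filter_upwards [self_mem_nhdsWithin] with s hs
    refine hT _ (hLΩ _ ?_)
    rw [map_add, map_smul, heq, zero_add, smul_eq_mul]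
    exact mul_pos hs hk
  · exact hT h (hLΩ h hgt)

end Domain

/-! ### The distance to the boundary -/

section Distance

variable {n : ℕ} {Ω : Set (E n)}

/-- Near a boundary point the distance to the boundary is, inside the domain, a `C²` function:
the nearest boundary point `y` and the multiplier `s` with `x = y + s ∇ρ(y)` depend smoothly on
`x` by the inverse function theorem. -/
theorem IsSmoothBoundedDomain.exists_local_dist (hΩ : IsSmoothBoundedDomain Ω) {x₀ : E n}
    (hx₀ : x₀ ∈ frontier Ω) : ∃ D : E n → ℝ, ContDiffAt ℝ 2 D x₀ ∧
      ∀ᶠ x in nhds x₀, x ∈ Ω → Metric.infDist x (frontier Ω) = D x := by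
  obtain ⟨V, ρ, hV, hxV, hρ, hρ0, hVΩ, hVf⟩ := hΩ.exists_defining_function hx₀
  let g : E n → E n := fun y => (InnerProductSpace.toDual ℝ (E n)).symm (fderiv ℝ ρ y)
  have hg_inner : ∀ y h, inner ℝ (g y) h = fderiv ℝ ρ y h := fun y h =>
    InnerProductSpace.toDual_symm_apply
  have hg_ne : ∀ y ∈ V, g y ≠ 0 := fun y hy h => hρ0 y hy (by
    ext k
    rw [← hg_inner, h, inner_zero_left]
    rfl)
  have hgs : ∀ y ∈ V, ContDiffAt ℝ 2 g y := fun y hy => by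
    have h1 : ContDiffAt ℝ 2 (fderiv ℝ ρ) y :=
      ((hρ.contDiffAt (hV.mem_nhds hy)).of_le (m := 3) (WithTop.coe_le_coe.2 le_top)).fderiv_right
        (by norm_num)
    exact (InnerProductSpace.toDual ℝ (E n)).symm.contDiff.contDiffAt.comp y h1
  let Φ : E n × ℝ → E n × ℝ := fun p => (p.1 + p.2 • g p.1, ρ p.1)
  have hΦs : ContDiffAt ℝ 2 Φ (x₀, 0) := by
    have h1 : ContDiffAt ℝ 2 (fun p : E n × ℝ => g p.1) (x₀, 0) :=
      ContDiffAt.comp (g := g) (x₀, (0 : ℝ)) (hgs x₀ hxV) contDiffAt_fst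
    have h2 : ContDiffAt ℝ 2 (fun p : E n × ℝ => ρ p.1) (x₀, 0) :=
      ContDiffAt.comp (g := ρ) (x₀, (0 : ℝ)) ((hρ.contDiffAt (hV.mem_nhds hxV)).of_le
        (WithTop.coe_le_coe.2 le_top)) contDiffAt_fst
    exact (contDiffAt_fst.add (contDiffAt_snd.smul h1)).prodMk h2
  let Φ' : E n × ℝ →L[ℝ] E n × ℝ :=
    (ContinuousLinearMap.fst ℝ (E n) ℝ +
      (ContinuousLinearMap.snd ℝ (E n) ℝ).smulRight (g x₀)).prod
        ((fderiv ℝ ρ x₀).comp (ContinuousLinearMap.fst ℝ (E n) ℝ))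
  have hΦ' : HasFDerivAt Φ Φ' (x₀, 0) := by
    have h1 : HasFDerivAt (fun p : E n × ℝ => g p.1)
        ((fderiv ℝ g x₀).comp (ContinuousLinearMap.fst ℝ (E n) ℝ)) (x₀, 0) :=
      HasFDerivAt.comp (g := g) (x₀, (0 : ℝ))
        ((hgs x₀ hxV).differentiableAt (by norm_num)).hasFDerivAt hasFDerivAt_fst
    have h2 : HasFDerivAt (fun p : E n × ℝ => ρ p.1)
        ((fderiv ℝ ρ x₀).comp (ContinuousLinearMap.fst ℝ (E n) ℝ)) (x₀, 0) :=
      HasFDerivAt.comp (g := ρ) (x₀, (0 : ℝ)) ((hρ.contDiffAt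
        (hV.mem_nhds hxV)).differentiableAt (by simp)).hasFDerivAt hasFDerivAt_fst
    have h3 := (hasFDerivAt_fst.add ((hasFDerivAt_snd (𝕜 := ℝ) (p := (x₀, (0 : ℝ)))).smul
      h1)).prodMk h2
    refine h3.congr_fderiv ?_
    ext p <;> simp [Φ']
  have hinj : Function.Injective (Φ' : E n × ℝ →ₗ[ℝ] E n × ℝ) := by
    rw [← LinearMap.ker_eq_bot, LinearMap.ker_eq_bot']
    rintro ⟨h, τ⟩ hz
    have h1 : h + τ • g x₀ = 0 := congrArg Prod.fst hz
    have h2 : fderiv ℝ ρ x₀ h = 0 := congrArg Prod.snd hz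
    rw [← hg_inner, eq_neg_of_add_eq_zero_left h1, inner_neg_right, inner_smul_right,
      real_inner_self_eq_norm_sq] at h2
    have h3 : ‖g x₀‖ ≠ 0 := norm_ne_zero_iff.2 (hg_ne x₀ hxV)
    have hτ : τ = 0 := by
      rcases mul_eq_zero.1 (neg_eq_zero.1 h2) with h | h
      · exact h
      · exact absurd (pow_eq_zero_iff two_ne_zero |>.1 h) h3
    rw [hτ, zero_smul, add_zero] at h1
    rw [h1, hτ]
    rfl
  let L : (E n × ℝ) ≃L[ℝ] (E n × ℝ) :=
    (LinearEquiv.ofInjectiveEndo (Φ' : E n × ℝ →ₗ[ℝ] E n × ℝ) hinj).toContinuousLinearEquiv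
  have hL : HasFDerivAt Φ (L : E n × ℝ →L[ℝ] E n × ℝ) (x₀, 0) := by
    refine hΦ'.congr_fderiv ?_
    exact ContinuousLinearMap.ext fun _ => rfl
  have hΦ0 : Φ (x₀, 0) = (x₀, 0) := by
    simp [Φ, (hVf x₀ hxV).1 hx₀]
  set Θ := hΦs.localInverse hL (by norm_num) with hΘ
  have hΘs : ContDiffAt ℝ 2 Θ (x₀, 0) := by
    have := hΦs.to_localInverse hL (by norm_num)
    rwa [hΦ0] at this
  have hΘl : ∀ᶠ p in nhds (x₀, (0 : ℝ)), Θ (Φ p) = p :=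
    (hΦs.hasStrictFDerivAt' hL (by norm_num)).eventually_left_inverse
  have hΘ0 : Θ (x₀, 0) = (x₀, 0) := by
    have := hΘl.self_of_nhds
    rwa [hΦ0] at this
  refine ⟨fun x => (Θ (x, 0)).2 * ‖g (Θ (x, 0)).1‖, ?_, ?_⟩
  · have h1 : ContDiffAt ℝ 2 (fun x : E n => Θ (x, 0)) x₀ :=
      ContDiffAt.comp (g := Θ) (f := fun x : E n => (x, (0 : ℝ))) x₀ hΘs
        (contDiffAt_id.prodMk contDiffAt_const)
    have h2 : ContDiffAt ℝ 2 (fun x : E n => g (Θ (x, 0)).1) x₀ := by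
      refine ContDiffAt.comp (g := g) (f := fun x : E n => (Θ (x, 0)).1) x₀ ?_ h1.fst
      rw [hΘ0]
      exact hgs x₀ hxV
    refine h1.snd.mul (h2.norm ℝ ?_)
    rw [hΘ0]
    exact hg_ne x₀ hxV
  · -- a radius on which all the local facts hold
    have hgc : ContinuousAt g x₀ := (hgs x₀ hxV).continuousAt
    have hin : ∀ᶠ p : E n × E n in nhds (x₀, x₀), ‖g x₀‖ ^ 2 / 2 < inner ℝ (g p.1) (g p.2) := by
      have hc : ContinuousAt (fun p : E n × E n => (inner ℝ (g p.1) (g p.2) : ℝ)) (x₀, x₀) :=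
        ContinuousAt.inner (ContinuousAt.comp (g := g) hgc continuousAt_fst)
          (ContinuousAt.comp (g := g) hgc continuousAt_snd)
      refine hc.eventually (lt_mem_nhds ?_)
      change ‖g x₀‖ ^ 2 / 2 < inner ℝ (g x₀) (g x₀)
      rw [real_inner_self_eq_norm_sq]
      have : 0 < ‖g x₀‖ := norm_pos_iff.2 (hg_ne x₀ hxV)
      have : 0 < ‖g x₀‖ ^ 2 := by positivity
      linarith
    obtain ⟨ε₁, hε₁, h₁⟩ := Metric.eventually_nhds_iff_ball.1 hΘl
    obtain ⟨ε₂, hε₂, h₂⟩ := Metric.eventually_nhds_iff_ball.1 hin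
    obtain ⟨ε₃, hε₃, h₃⟩ := Metric.isOpen_iff.1 hV x₀ hxV
    set ε := min ε₁ (min ε₂ ε₃) with hε
    have hεpos : 0 < ε := lt_min hε₁ (lt_min hε₂ hε₃)
    have hεle₁ : ε ≤ ε₁ := min_le_left _ _
    have hεle₂ : ε ≤ ε₂ := (min_le_right _ _).trans (min_le_left _ _)
    have hεle₃ : ε ≤ ε₃ := (min_le_right _ _).trans (min_le_right _ _)
    set m := ‖g x₀‖ / 2 with hm
    have hg0 : 0 < ‖g x₀‖ := norm_pos_iff.2 (hg_ne x₀ hxV)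
    have hmpos : 0 < m := by positivity
    have hinner : ∀ y ∈ Metric.ball x₀ ε, ∀ z ∈ Metric.ball x₀ ε,
        ‖g x₀‖ ^ 2 / 2 < inner ℝ (g y) (g z) := fun y hy z hz => h₂ (y, z) (by
      rw [← ball_prod_same]
      exact ⟨Metric.ball_subset_ball hεle₂ hy, Metric.ball_subset_ball hεle₂ hz⟩)
    refine Metric.eventually_nhds_iff_ball.2 ⟨min (ε / 2) (ε * m), by positivity,
      fun x hx hxΩ => ?_⟩
    have hxε : dist x x₀ < ε / 2 := lt_of_lt_of_le hx (min_le_left _ _)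
    have hxm : dist x x₀ < ε * m := lt_of_lt_of_le hx (min_le_right _ _)
    obtain ⟨y, hyf, hyd⟩ := hΩ.isCompact_frontier.exists_infDist_eq_dist ⟨x₀, hx₀⟩ x
    have hxy : dist x y ≤ dist x x₀ := hyd ▸ Metric.infDist_le_dist_of_mem hx₀
    have hyball : y ∈ Metric.ball x₀ ε := by
      rw [Metric.mem_ball]
      have := dist_triangle y x x₀
      rw [dist_comm y x] at this
      linarith
    have hxball : x ∈ Metric.ball x₀ ε := by rw [Metric.mem_ball]; linarith
    have hyV : y ∈ V := h₃ (Metric.ball_subset_ball hεle₃ hyball)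
    have hy0 : ρ y = 0 := (hVf y hyV).1 hyf
    -- Lagrange multipliers: `x - y` is normal to the boundary at `y`
    obtain ⟨s, hs⟩ : ∃ s : ℝ, x - y = s • g y := by
      have hext : IsLocalExtrOn (fun z => ‖x - z‖ ^ 2) {z | ρ z = ρ y} y := by
        left
        filter_upwards [self_mem_nhdsWithin, nhdsWithin_le_nhds (hV.mem_nhds hyV)] with z hz hzV
        have hzf : z ∈ frontier Ω := (hVf z hzV).2 (by rw [← hy0]; exact hz)
        have h := Metric.infDist_le_dist_of_mem (x := x) hzf
        rw [hyd, dist_eq_norm, dist_eq_norm] at h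
        gcongr
      have hρs : HasStrictFDerivAt ρ (fderiv ℝ ρ y) y :=
        (hρ.contDiffAt (hV.mem_nhds hyV)).hasStrictFDerivAt (by simp)
      have hφs : HasStrictFDerivAt (fun z => ‖x - z‖ ^ 2)
          (2 • (innerSL ℝ (x - y)).comp (-(ContinuousLinearMap.id ℝ (E n)))) y := by
        exact (hasStrictFDerivAt_norm_sq (x - y)).comp y ((hasStrictFDerivAt_id y).const_sub x)
      obtain ⟨a, b, hab, heq⟩ := hext.exists_multipliers_of_hasStrictFDerivAt_1d hρs hφs
      have heq' : ∀ h, a * inner ℝ (g y) h = 2 * b * inner ℝ (x - y) h := by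
        intro h
        have h1 := congrArg (fun T : E n →L[ℝ] ℝ => T h) heq
        simp only [add_apply, smul_apply,
          ContinuousLinearMap.comp_apply, neg_apply,
          ContinuousLinearMap.id_apply, innerSL_apply_apply, inner_neg_right, smul_eq_mul,
          zero_apply, nsmul_eq_mul, Nat.cast_ofNat] at h1
        rw [hg_inner]
        linarith
      have hb : b ≠ 0 := by
        rintro rfl
        have h1 := heq' (g y)
        rw [real_inner_self_eq_norm_sq] at h1
        have h2 : ‖g y‖ ≠ 0 := norm_ne_zero_iff.2 (hg_ne y hyV)
        have h3 : a = 0 := by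
          have : a * ‖g y‖ ^ 2 = 0 := by linarith
          exact (mul_eq_zero.1 this).resolve_right (pow_ne_zero 2 h2)
        exact hab (by rw [h3]; rfl)
      refine ⟨a / (2 * b), ext_inner_right ℝ fun h => ?_⟩
      rw [real_inner_smul_left, div_mul_eq_mul_div, heq']
      field_simp
    have hseg : segment ℝ y x ⊆ Metric.ball x₀ ε := (convex_ball x₀ ε).segment_subset hyball hxball
    have hspos : 0 < s := by
      obtain ⟨z, hz, hzeq⟩ := domain_mvt (f := ρ) (f' := fderiv ℝ ρ) (s := Metric.ball x₀ ε)
        (x := y) (y := x) (fun z hz => ((hρ.contDiffAt (hV.mem_nhds (h₃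
          (Metric.ball_subset_ball hεle₃ hz)))).differentiableAt
            (by simp)).hasFDerivAt.hasFDerivWithinAt) (convex_ball x₀ ε) hyball hxball
      have hxρ : 0 < ρ x := (hVΩ x (h₃ (Metric.ball_subset_ball hεle₃ hxball))).1 hxΩ
      rw [hs, map_smul, ← hg_inner, hy0, sub_zero, smul_eq_mul] at hzeq
      have h5 : 0 < inner ℝ (g z) (g y) :=
        lt_of_le_of_lt (by positivity) (hinner z (hseg hz) y hyball)
      rw [hzeq] at hxρ
      exact (pos_iff_pos_of_mul_pos hxρ).2 h5
    have hgy : m < ‖g y‖ := by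
      have h5 := hinner y hyball y hyball
      rw [real_inner_self_eq_norm_sq] at h5
      have h6 : m ^ 2 < ‖g y‖ ^ 2 := by
        rw [hm]
        nlinarith [sq_nonneg ‖g x₀‖]
      exact lt_of_pow_lt_pow_left₀ 2 (norm_nonneg _) h6
    have hdist : dist x y = s * ‖g y‖ := by
      rw [dist_eq_norm, hs, norm_smul, Real.norm_eq_abs, abs_of_pos hspos]
    have hsε : s < ε := by
      have h6 : s * m ≤ s * ‖g y‖ := mul_le_mul_of_nonneg_left hgy.le hspos.le
      have h7 : s * m < ε * m := by linarith
      exact lt_of_mul_lt_mul_right h7 hmpos.le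
    have hΦy : Φ (y, s) = (x, 0) := by
      simp only [Φ, hy0, ← hs]
      simp
    have hΘy := h₁ (y, s) (by
      rw [← ball_prod_same]
      refine ⟨Metric.ball_subset_ball hεle₁ hyball, ?_⟩
      rw [Metric.mem_ball, dist_zero_right, Real.norm_eq_abs, abs_of_pos hspos]
      linarith)
    rw [hΦy] at hΘy
    simp only [hyd, hdist, hΘy]

/-- The distance to the boundary is `C²` with bounded second derivatives at all points of the
domain that are close to the boundary. -/
theorem IsSmoothBoundedDomain.exists_dist_regular (hΩ : IsSmoothBoundedDomain Ω) :
    ∃ δ > 0, ∃ C, 0 ≤ C ∧ ∀ y ∈ frontier Ω, ∀ x ∈ Ω ∩ Metric.ball y δ,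
      ContDiffAt ℝ 2 (fun z => Metric.infDist z (frontier Ω)) x ∧
        ‖fderiv ℝ (fderiv ℝ fun z => Metric.infDist z (frontier Ω)) x‖ ≤ C := by
  refine hΩ.isCompact_frontier.induction_on (p := fun s => ∃ δ > 0, ∃ C, 0 ≤ C ∧ ∀ y ∈ s,
    ∀ x ∈ Ω ∩ Metric.ball y δ,
      ContDiffAt ℝ 2 (fun z => Metric.infDist z (frontier Ω)) x ∧
        ‖fderiv ℝ (fderiv ℝ fun z => Metric.infDist z (frontier Ω)) x‖ ≤ C) ?_ ?_ ?_ ?_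
  · exact ⟨1, one_pos, 0, le_rfl, fun y hy => absurd hy (Set.notMem_empty y)⟩
  · rintro s t hst ⟨δ, hδ, C, hC, h⟩
    exact ⟨δ, hδ, C, hC, fun y hy => h y (hst hy)⟩
  · rintro s t ⟨δ, hδ, C, hC, h⟩ ⟨δ', hδ', C', hC', h'⟩
    refine ⟨min δ δ', lt_min hδ hδ', max C C', le_max_of_le_left hC, fun y hy x hx => ?_⟩
    rcases hy with hy | hy
    · obtain ⟨h1, h2⟩ := h y hy x ⟨hx.1, Metric.ball_subset_ball (min_le_left _ _) hx.2⟩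
      exact ⟨h1, h2.trans (le_max_left _ _)⟩
    · obtain ⟨h1, h2⟩ := h' y hy x ⟨hx.1, Metric.ball_subset_ball (min_le_right _ _) hx.2⟩
      exact ⟨h1, h2.trans (le_max_right _ _)⟩
  · intro x₀ hx₀
    obtain ⟨D, hD, hDe⟩ := hΩ.exists_local_dist hx₀
    have hD2 : ContinuousAt (fderiv ℝ (fderiv ℝ D)) x₀ :=
      (((hD.fderiv_right (m := 1) (by norm_num)).fderiv_right (m := 0)
        (by norm_num))).continuousAt
    have hb : ∀ᶠ x in nhds x₀, ‖fderiv ℝ (fderiv ℝ D) x‖ < ‖fderiv ℝ (fderiv ℝ D) x₀‖ + 1 := by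
      have hn : ContinuousAt (fun x => ‖fderiv ℝ (fderiv ℝ D) x‖) x₀ :=
        ContinuousAt.norm (E := E n →L[ℝ] E n →L[ℝ] ℝ) hD2
      exact hn.eventually_lt continuousAt_const (lt_add_one _)
    obtain ⟨ε, hε, h⟩ := Metric.eventually_nhds_iff_ball.1
      (hDe.and (hb.and (hD.eventually (by simp))))
    refine ⟨Metric.ball x₀ (ε / 2),
      mem_nhdsWithin_of_mem_nhds (Metric.ball_mem_nhds _ (by positivity)),
      ε / 2, by positivity, ‖fderiv ℝ (fderiv ℝ D) x₀‖ + 1, by positivity, fun y hy x hx => ?_⟩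
    have hxε : x ∈ Metric.ball x₀ ε := by
      rw [Metric.mem_ball] at hy ⊢
      have h1 : dist x y < ε / 2 := hx.2
      linarith [dist_triangle x y x₀]
    have heq : (fun z => Metric.infDist z (frontier Ω)) =ᶠ[nhds x] D := by
      filter_upwards [hΩ.isOpen.mem_nhds hx.1, Metric.isOpen_ball.mem_nhds hxε] with z hz hzε
      exact (h z hzε).1 hz
    refine ⟨(h x hxε).2.2.congr_of_eventuallyEq heq, ?_⟩
    rw [heq.fderiv.fderiv_eq]
    exact (h x hxε).2.1.le

/-- The distance to the boundary decreases at unit speed towards a nearest boundary point. -/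
theorem IsSmoothBoundedDomain.exists_fderiv_dist_eq (hΩ : IsSmoothBoundedDomain Ω)
    (hne : (frontier Ω).Nonempty) {x : E n} (hx : x ∈ Ω)
    (hd : DifferentiableAt ℝ (fun z => Metric.infDist z (frontier Ω)) x) :
    ∃ e : E n, ‖e‖ = 1 ∧ fderiv ℝ (fun z => Metric.infDist z (frontier Ω)) x e = -1 := by
  obtain ⟨y, hyf, hyd⟩ := hΩ.isCompact_frontier.exists_infDist_eq_dist hne x
  have hxy : x ≠ y := fun h => hΩ.notMem_of_mem_frontier hyf (h ▸ hx)
  have hpos : 0 < dist x y := dist_pos.2 hxy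
  set e := (dist x y)⁻¹ • (y - x)
  have he : ‖e‖ = 1 := by
    rw [norm_smul, norm_inv, Real.norm_eq_abs, abs_of_pos hpos, ← dist_eq_norm, dist_comm y x,
      inv_mul_cancel₀ hpos.ne']
  refine ⟨e, he, ?_⟩
  have hline := hasDerivAt_comp_line hd e
  have hlin : HasDerivWithinAt (fun τ : ℝ => Metric.infDist (x + τ • e) (frontier Ω)) (-1)
      (Set.Ici 0) 0 := by
    have h0 : HasDerivWithinAt (fun τ : ℝ => dist x y - τ) (-1) (Set.Ici 0) 0 :=
      ((hasDerivAt_id (0 : ℝ)).const_sub (dist x y)).hasDerivWithinAt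
    refine h0.congr_of_eventuallyEq ?_ (by simp [hyd])
    filter_upwards [self_mem_nhdsWithin, nhdsWithin_le_nhds (gt_mem_nhds hpos)] with τ hτ hτ2
    have hτ0 : 0 ≤ τ := hτ
    refine le_antisymm ?_ ?_
    · refine (Metric.infDist_le_dist_of_mem hyf).trans (le_of_eq ?_)
      have h2 : x + τ • e - y = (τ * (dist x y)⁻¹ - 1) • (y - x) := by
        simp only [e]
        rw [sub_smul, one_smul, smul_smul]
        abel
      have h3 : τ * (dist x y)⁻¹ - 1 ≤ 0 := by
        rw [← div_eq_mul_inv, sub_nonpos, div_le_one hpos]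
        exact hτ2.le
      rw [dist_eq_norm, h2, norm_smul, Real.norm_eq_abs, abs_of_nonpos h3, ← dist_eq_norm,
        dist_comm y x]
      field_simp
      ring
    · have h2 := Metric.infDist_le_infDist_add_dist (s := frontier Ω) (x := x) (y := x + τ • e)
      have h3 : dist x (x + τ • e) = τ := by
        rw [dist_eq_norm, sub_add_cancel_left, norm_neg, norm_smul, he, Real.norm_eq_abs,
          abs_of_nonneg hτ0, mul_one]
      rw [h3, hyd] at h2
      linarith
  exact (uniqueDiffOn_Ici (0 : ℝ) 0 (by simp)).eq_deriv _ hline.hasDerivWithinAt hlin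

end Distance

/-! ### Hessians as bilinear forms -/

section BilinearForms

variable {n : ℕ}

/-- The second derivative of `v` at `x` as a bilinear form. -/
noncomputable def D2 (v : E n → ℝ) (x : E n) : E n →L[ℝ] E n →L[ℝ] ℝ := fderiv ℝ (fderiv ℝ v) x

/-- The matrix of a bilinear form in the standard basis. -/
noncomputable def bilMat (β : E n →L[ℝ] E n →L[ℝ] ℝ) : Matrix (Fin n) (Fin n) ℝ :=
  Matrix.of fun i j => β (EuclideanSpace.single i 1) (EuclideanSpace.single j 1)

/-- The matrix `X + γ (tr X) I`. -/
noncomputable def augMat (γ : ℝ) (X : Matrix (Fin n) (Fin n) ℝ) : Matrix (Fin n) (Fin n) ℝ :=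
  X + (γ * X.trace) • (1 : Matrix (Fin n) (Fin n) ℝ)

theorem bilMat_apply_apply (β : E n →L[ℝ] E n →L[ℝ] ℝ) (ξ ζ : E n) :
    ∑ i, ∑ j, bilMat β i j * (ξ i * ζ j) = β ξ ζ := by
  have hξ : ∀ ξ : E n, ξ = ∑ i, ξ i • EuclideanSpace.single i (1 : ℝ) := fun ξ => by
    have := (EuclideanSpace.basisFun (Fin n) ℝ).sum_repr ξ
    simpa using this.symm
  conv_rhs => rw [hξ ξ, hξ ζ]
  simp only [map_sum, map_smul, FunLike.coe_sum, Finset.sum_apply,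
    FunLike.coe_smul, Pi.smul_apply, smul_eq_mul, Finset.mul_sum]
  rw [Finset.sum_comm]
  refine Finset.sum_congr rfl fun i _ => Finset.sum_congr rfl fun j _ => ?_
  simp only [bilMat, Matrix.of_apply]
  ring

theorem quad_bilMat (β : E n →L[ℝ] E n →L[ℝ] ℝ) (ξ : E n) : quad (bilMat β) ξ = β ξ ξ :=
  bilMat_apply_apply β ξ ξ

theorem trace_eq_sum_quad (X : Matrix (Fin n) (Fin n) ℝ) (b : OrthonormalBasis (Fin n) ℝ (E n)) :
    X.trace = ∑ a, quad X (b a) := by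
  have h := sum_spectralMat_mul b (fun _ => 1) X
  simp only [one_mul] at h
  rw [← h]
  simp [spectralMat, sum_basis_mul, Matrix.trace]

theorem quad_augMat (γ : ℝ) (X : Matrix (Fin n) (Fin n) ℝ)
    (b c : OrthonormalBasis (Fin n) ℝ (E n)) (a : Fin n) :
    quad (augMat γ X) (b a) = quad X (b a) + γ * ∑ d, quad X (c d) := by
  rw [augMat, quad_add, quad_smul_one, b.norm_eq_one, trace_eq_sum_quad X c]
  ring

/-- The zeroth order perturbation `γ (tr X) I` may be moved to the coefficients. -/
theorem sum_mul_quad_augMat (γ : ℝ) (X : Matrix (Fin n) (Fin n) ℝ)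
    (b : OrthonormalBasis (Fin n) ℝ (E n)) (p : Fin n → ℝ) :
    ∑ a, p a * quad (augMat γ X) (b a) = ∑ a, (p a + γ * ∑ c, p c) * quad X (b a) := by
  simp only [quad_augMat γ X b b, mul_add, add_mul, Finset.sum_add_distrib, ← Finset.sum_mul,
    ← Finset.mul_sum]
  ring

theorem continuous_augMat (γ : ℝ) :
    Continuous (augMat γ : Matrix (Fin n) (Fin n) ℝ → Matrix (Fin n) (Fin n) ℝ) := by
  unfold augMat
  have : Continuous fun X : Matrix (Fin n) (Fin n) ℝ => X.trace := continuous_id.matrix_trace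
  fun_prop

variable {Ω : Set (E n)}

theorem augHess_eq (γ : ℝ) (v : E n → ℝ) (x : E n) :
    augHess Ω γ v x = augMat γ (hess Ω v x) := rfl

theorem fderivWithin_closure_eq (hΩ : IsOpen Ω) {F : Type*} [NormedAddCommGroup F]
    [NormedSpace ℝ F] (v : E n → F) {x : E n} (hx : x ∈ Ω) :
    fderivWithin ℝ v (closure Ω) x = fderiv ℝ v x :=
  fderivWithin_of_mem_nhds (Filter.mem_of_superset (hΩ.mem_nhds hx) subset_closure)

theorem fderivWithin_closure_eventuallyEq (hΩ : IsOpen Ω) {F : Type*} [NormedAddCommGroup F]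
    [NormedSpace ℝ F] (v : E n → F) {x : E n} (hx : x ∈ Ω) :
    fderivWithin ℝ v (closure Ω) =ᶠ[nhds x] fderiv ℝ v := by
  filter_upwards [hΩ.mem_nhds hx] with y hy using fderivWithin_closure_eq hΩ v hy

theorem IsSmoothBoundedDomain.hess_eq (hΩ : IsSmoothBoundedDomain Ω) (v : E n → ℝ) {x : E n}
    (hx : x ∈ Ω) : hess Ω v x = bilMat (D2 v x) := by
  ext i j
  simp only [hess, bilMat, Matrix.of_apply]
  rw [iteratedFDerivWithin_two_apply' v hΩ.uniqueDiffOn (subset_closure hx),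
    fderivWithin_closure_eq hΩ.isOpen _ hx,
    (fderivWithin_closure_eventuallyEq hΩ.isOpen v hx).fderiv_eq]
  rfl

theorem IsSmoothBoundedDomain.contDiffAt (hΩ : IsSmoothBoundedDomain Ω) {m : WithTop ℕ∞}
    {v : E n → ℝ} (hv : ContDiffOn ℝ m v (closure Ω)) {x : E n} (hx : x ∈ Ω) :
    ContDiffAt ℝ m v x :=
  hv.contDiffAt (Filter.mem_of_superset (hΩ.isOpen.mem_nhds hx) subset_closure)

theorem D2_symm {v : E n → ℝ} {x : E n} (hv : ContDiffAt ℝ 2 v x) (ξ ζ : E n) :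
    D2 v x ξ ζ = D2 v x ζ ξ :=
  (hv.isSymmSndFDerivAt (by simp)).eq ξ ζ

theorem D2_sub {v w : E n → ℝ} {x : E n} (hv : ContDiffAt ℝ 2 v x) (hw : ContDiffAt ℝ 2 w x) :
    D2 (fun y => v y - w y) x = D2 v x - D2 w x := by
  have hd : ∀ {z : E n → ℝ}, ContDiffAt ℝ 2 z x → DifferentiableAt ℝ (fderiv ℝ z) x := fun hz =>
    (hz.fderiv_right (m := 1) (by norm_num)).differentiableAt (by norm_num)
  have he : fderiv ℝ (fun y => v y - w y) =ᶠ[nhds x] fun y => fderiv ℝ v y - fderiv ℝ w y := by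
    filter_upwards [hv.eventually (by simp), hw.eventually (by simp)] with y h1 h2
    exact fderiv_fun_sub (h1.differentiableAt (by norm_num)) (h2.differentiableAt (by norm_num))
  rw [D2, he.fderiv_eq, fderiv_fun_sub (hd hv) (hd hw)]
  rfl

theorem D2_add {v w : E n → ℝ} {x : E n} (hv : ContDiffAt ℝ 2 v x) (hw : ContDiffAt ℝ 2 w x) :
    D2 (fun y => v y + w y) x = D2 v x + D2 w x := by
  have hd : ∀ {z : E n → ℝ}, ContDiffAt ℝ 2 z x → DifferentiableAt ℝ (fderiv ℝ z) x := fun hz =>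
    (hz.fderiv_right (m := 1) (by norm_num)).differentiableAt (by norm_num)
  have he : fderiv ℝ (fun y => v y + w y) =ᶠ[nhds x] fun y => fderiv ℝ v y + fderiv ℝ w y := by
    filter_upwards [hv.eventually (by simp), hw.eventually (by simp)] with y h1 h2
    exact fderiv_fun_add (h1.differentiableAt (by norm_num)) (h2.differentiableAt (by norm_num))
  rw [D2, he.fderiv_eq, fderiv_fun_add (hd hv) (hd hw)]
  rfl

theorem D2_const_mul {v : E n → ℝ} {x : E n} (c : ℝ) (hv : ContDiffAt ℝ 2 v x) :
    D2 (fun y => c * v y) x = c • D2 v x := by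
  have hd : DifferentiableAt ℝ (fderiv ℝ v) x :=
    (hv.fderiv_right (m := 1) (by norm_num)).differentiableAt (by norm_num)
  have he : fderiv ℝ (fun y => c * v y) =ᶠ[nhds x] fun y => c • fderiv ℝ v y := by
    filter_upwards [hv.eventually (by simp)] with y h1
    exact fderiv_const_mul (h1.differentiableAt (by norm_num)) c
  rw [D2, he.fderiv_eq, fderiv_fun_const_smul hd c]
  rfl

theorem D2_const (c : ℝ) (x : E n) : D2 (fun _ => c) x = 0 := by
  have h : fderiv ℝ (fun _ : E n => c) = fun _ => 0 := by
    ext1 y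
    exact fderiv_const_apply c
  rw [D2, h]
  exact fderiv_const_apply _

/-- The Hessian of a square. -/
theorem D2_sq {v : E n → ℝ} {x : E n} (hv : ContDiffAt ℝ 2 v x) (ξ : E n) :
    D2 (fun y => v y ^ 2) x ξ ξ = 2 * fderiv ℝ v x ξ ^ 2 + 2 * v x * D2 v x ξ ξ := by
  have hd : DifferentiableAt ℝ (fderiv ℝ v) x :=
    (hv.fderiv_right (m := 1) (by norm_num)).differentiableAt (by norm_num)
  have hd1 : DifferentiableAt ℝ v x := hv.differentiableAt (by norm_num)
  have he : fderiv ℝ (fun y => v y ^ 2) =ᶠ[nhds x] fun y => (2 * v y) • fderiv ℝ v y := by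
    filter_upwards [hv.eventually (by simp)] with y h1
    have := ((h1.differentiableAt (by norm_num)).hasFDerivAt.pow 2).fderiv
    simpa using this
  have h2 : HasFDerivAt (fun y => (2 * v y) • fderiv ℝ v y)
      ((2 * v x) • fderiv ℝ (fderiv ℝ v) x + ((2 : ℝ) • fderiv ℝ v x).smulRight (fderiv ℝ v x)) x :=
    (hd1.hasFDerivAt.const_mul 2).smul hd.hasFDerivAt
  rw [D2, he.fderiv_eq, h2.fderiv]
  simp only [add_apply, smul_apply, ContinuousLinearMap.smulRight_apply, smul_eq_mul, D2]
  ring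

theorem D2_norm_sq (x₀ x ξ : E n) : D2 (fun y => ‖y - x₀‖ ^ 2) x ξ ξ = 2 * ‖ξ‖ ^ 2 := by
  have he : fderiv ℝ (fun y : E n => ‖y - x₀‖ ^ 2) = fun y => 2 • innerSL ℝ (y - x₀) := by
    ext1 y
    have := ((hasStrictFDerivAt_norm_sq (y - x₀)).hasFDerivAt.comp y
      ((hasFDerivAt_id y).sub_const x₀)).fderiv
    simpa [Function.comp_def] using this
  have h2 : HasFDerivAt (fun y : E n => 2 • innerSL ℝ (y - x₀)) (2 • innerSL ℝ) x := by
    have := ((innerSL ℝ (E := E n)).hasFDerivAt (x := x - x₀)).comp x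
      ((hasFDerivAt_id x).sub_const x₀)
    exact this.const_smul 2
  rw [D2, he, h2.fderiv]
  simp only [nsmul_eq_mul, Nat.cast_ofNat, FunLike.coe_smul, Pi.smul_apply]
  exact congrArg (2 * ·) (real_inner_self_eq_norm_sq ξ)

end BilinearForms

/-! ### The linearized operator -/

section Linearization

variable {n : ℕ} {Ω : Set (E n)} {γ : ℝ} {Γ : Set (Fin n → ℝ)} {f : (Fin n → ℝ) → ℝ}
  {ψ φ w : E n → ℝ} {η : ℝ → ℝ} {ε₀ ε : ℝ} {u : E n → ℝ}

/-- The facts about the linearized operator at a point `x` that enter the barrier argument. In the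
orthonormal basis `b` both the coefficients (with eigenvalues `q a`) and the Hessian of `u` are
diagonal. The constants are `θ` (ellipticity) and `M` (size of the right-hand side and of its first
derivatives). The field `alternative` says that the operator is uniformly elliptic at `x` unless
`u - w` is a strict supersolution there, and `differentiated` is a bound for the right-hand side of
the equation differentiated once. -/
structure IsLinearization (Ω : Set (E n)) (γ : ℝ) (f : (Fin n → ℝ) → ℝ) (w u : E n → ℝ)
    (θ M : ℝ) (x : E n) (b : OrthonormalBasis (Fin n) ℝ (E n)) (q : Fin n → ℝ) : Prop where
  pos : ∀ a, 0 < q a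
  sum_eq : ∑ a, q a = (1 + n * γ) * traceCoeff Ω γ f u x
  le_trace : θ ≤ traceCoeff Ω γ f u x
  linOp_eq : ∀ v : E n → ℝ, linOp Ω γ f u v x = ∑ a, q a * D2 v x (b a) (b a)
  diag : ∀ a ξ, D2 u x (b a) ξ = D2 u x (b a) (b a) * inner ℝ (b a) ξ
  radial_nonneg : 0 ≤ ∑ a, q a * D2 u x (b a) (b a)
  radial_le : ∑ a, q a * D2 u x (b a) (b a) ≤ M
  laplacian_nonneg : 0 ≤ ∑ a, D2 u x (b a) (b a)
  subsolution : 0 ≤ ∑ a, q a * (D2 w x (b a) (b a) - D2 u x (b a) (b a))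
  alternative : (∀ a, θ * traceCoeff Ω γ f u x ≤ q a) ∨
    θ * (1 + traceCoeff Ω γ f u x) ≤ ∑ a, q a * (D2 w x (b a) (b a) - D2 u x (b a) (b a))
  differentiated : ∀ ξ, |∑ a, q a * fderiv ℝ (D2 u) x ξ (b a) (b a)| ≤ M * ‖ξ‖

theorem continuousOn_augHess (hΩ : IsSmoothBoundedDomain Ω) {v : E n → ℝ}
    (hv : ContDiffOn ℝ 2 v (closure Ω)) : ContinuousOn (augHess Ω γ v) (closure Ω) := by
  refine (continuous_augMat γ).comp_continuousOn ?_
  refine continuousOn_pi.2 fun i => continuousOn_pi.2 fun j => ?_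
  have h : ContinuousOn (iteratedFDerivWithin ℝ 2 v (closure Ω)) (closure Ω) :=
    hv.continuousOn_iteratedFDerivWithin (by norm_num) hΩ.uniqueDiffOn
  exact (continuous_eval_const _).comp_continuousOn h

theorem IsApproxSolution.rhs_pos (hψ0 : ∀ x ∈ Ω, 0 ≤ ψ x) (hε₀ : 0 < ε₀) (hη : IsCutoff ε₀ η)
    (hε : 0 < ε) {x : E n} (hx : x ∈ Ω) : 0 < ψ x + ε * η (ψ x) := by
  have h1 := hψ0 x hx
  have h2 := (hη.mem_Icc _ h1).1
  rcases h1.lt_or_eq with h | h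
  · have := mul_nonneg hε.le h2
    linarith
  · rw [← h, hη.eq_one 0 ⟨le_rfl, by positivity⟩]
    linarith

theorem IsApproxSolution.eigs_mem (hΓ : IsSymmetricCone Γ) (hf : StructureConditions Γ f)
    (hψ0 : ∀ x ∈ Ω, 0 ≤ ψ x) (hε₀ : 0 < ε₀) (hη : IsCutoff ε₀ η) (hε : 0 < ε)
    (hu : IsApproxSolution Ω γ Γ f ψ φ η ε u) {x : E n} (hx : x ∈ Ω) :
    eigs (augHess Ω γ u x) ∈ Γ := by
  by_contra hcon
  have h1 : eigs (augHess Ω γ u x) ∈ frontier Γ := by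
    rw [hΓ.isOpen.frontier_eq]
    exact ⟨hu.admissible x hx, hcon⟩
  have h2 : specFun f (augHess Ω γ u x) = 0 := hf.zero _ h1
  have h3 := IsApproxSolution.rhs_pos hψ0 hε₀ hη hε hx
  rw [← hu.equation x hx, h2] at h3
  exact lt_irrefl _ h3

/-- The solution of the approximating problem has a smaller right-hand side than `w`. -/
theorem IsApproxSolution.specFun_le (hψ0 : ∀ x ∈ Ω, 0 ≤ ψ x)
    (hw : IsSubsolution Ω γ Γ f ψ φ w)
    (hwε₀ : ∀ x ∈ closure Ω, ε₀ ≤ specFun f (augHess Ω γ w x)) (hη : IsCutoff ε₀ η) (hε : 0 < ε)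
    (hεε₀ : ε ≤ ε₀ / 2) (hu : IsApproxSolution Ω γ Γ f ψ φ η ε u) {x : E n} (hx : x ∈ Ω) :
    specFun f (augHess Ω γ u x) ≤ specFun f (augHess Ω γ w x) := by
  rw [hu.equation x hx]
  rcases lt_or_ge (ψ x) (ε₀ / 2) with h | h
  · refine le_trans ?_ (hwε₀ x (subset_closure hx))
    have := mul_le_mul_of_nonneg_left (hη.mem_Icc _ (hψ0 x hx)).2 hε.le
    linarith
  · rw [hη.eq_zero _ h, mul_zero, add_zero]
    exact hw.ge_rhs x hx

theorem sum_spectralMat_basis_mul (b : OrthonormalBasis (Fin n) ℝ (E n)) (l : Fin n → ℝ)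
    (a : Fin n) (ξ : E n) :
    ∑ i, ∑ j, spectralMat b l i j * (b a i * ξ j) = l a * inner ℝ (b a) ξ := by
  have h : ∀ c, ∑ i, ∑ j, l c * (b c i * b c j) * (b a i * ξ j) =
      l c * (inner ℝ (b c) (b a) * inner ℝ (b c) ξ) := by
    intro c
    rw [inner_eq_sum, inner_eq_sum, Finset.sum_mul_sum, Finset.mul_sum]
    simp only [Finset.mul_sum]
    exact Finset.sum_congr rfl fun i _ => Finset.sum_congr rfl fun j _ => by ring
  simp only [spectralMat, Matrix.of_apply, Finset.sum_mul]
  rw [Finset.sum_comm_cycle]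
  simp_rw [h, inner_basis_basis]
  simp

/-- Eigenvectors of `D²u + γ Δu I` are eigenvectors of `D²u`. -/
theorem IsSmoothBoundedDomain.D2_eigBasis (hΩ : IsSmoothBoundedDomain Ω) {x : E n} (hx : x ∈ Ω)
    (hu : ContDiffAt ℝ 2 u x) (a : Fin n) (ξ : E n) :
    D2 u x (eigBasis (augHess Ω γ u x) a) ξ =
      D2 u x (eigBasis (augHess Ω γ u x) a) (eigBasis (augHess Ω γ u x) a) *
        inner ℝ (eigBasis (augHess Ω γ u x) a) ξ := by
  set A := augHess Ω γ u x with hA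
  have hsymm : A.IsSymm := by
    ext i j
    simp only [hA, augHess_eq, augMat, hΩ.hess_eq u hx, bilMat, Matrix.transpose_apply,
      Matrix.add_apply, Matrix.of_apply, Matrix.smul_apply, Matrix.one_apply, eq_comm (a := j)]
    rw [D2_symm hu]
  have hspec : A = spectralMat (eigBasis A) (eigs A) := by
    rw [← symPart_eq_spectralMat, symPart_of_isSymm hsymm]
  have key : ∀ ζ, D2 u x (eigBasis A a) ζ =
      (eigs A a - γ * (bilMat (D2 u x)).trace) * inner ℝ (eigBasis A a) ζ := by
    intro ζ
    have h1 := sum_spectralMat_basis_mul (eigBasis A) (eigs A) a ζ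
    rw [← hspec] at h1
    simp only [hA, augHess_eq, augMat, hΩ.hess_eq u hx, Matrix.add_apply, Matrix.smul_apply,
      add_mul, Finset.sum_add_distrib, bilMat_apply_apply] at h1
    have h2 : ∑ i, ∑ j, (γ * (bilMat (D2 u x)).trace) • (1 : Matrix (Fin n) (Fin n) ℝ) i j *
        (eigBasis A a i * ζ j) = γ * (bilMat (D2 u x)).trace * inner ℝ (eigBasis A a) ζ := by
      rw [inner_eq_sum, Finset.mul_sum]
      refine Finset.sum_congr rfl fun i _ => ?_
      simp [Matrix.one_apply]
    simp only [hA, augHess_eq, augMat, hΩ.hess_eq u hx] at h2 ⊢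
    rw [h2] at h1
    linarith
  rw [key ξ, key (eigBasis A a), inner_basis_basis]
  simp

/-- Differentiating the equation in the direction `ξ`. -/
theorem IsSmoothBoundedDomain.hasDerivAt_specFun_augHess (hΩ : IsSmoothBoundedDomain Ω)
    (hΓ : IsSymmetricCone Γ) (hf : StructureConditions Γ f) {x : E n} (hx : x ∈ Ω)
    (hu : ContDiffAt ℝ 3 u x) (hmem : eigs (augHess Ω γ u x) ∈ Γ) (ξ : E n) :
    HasDerivAt (fun s : ℝ => specFun f (augHess Ω γ u (x + s • ξ)))
      (∑ a, (grad f (eigs (augHess Ω γ u x)) a +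
          γ * ∑ c, grad f (eigs (augHess Ω γ u x)) c) *
        fderiv ℝ (D2 u) x ξ (eigBasis (augHess Ω γ u x) a) (eigBasis (augHess Ω γ u x) a)) 0 := by
  have hline : HasDerivAt (fun s : ℝ => x + s • ξ) ξ 0 := by
    simpa using ((hasDerivAt_id (0 : ℝ)).smul_const ξ).const_add x
  have hD : DifferentiableAt ℝ (D2 u) x :=
    ((hu.fderiv_right (m := 2) (by norm_num)).fderiv_right (m := 1)
      (by norm_num)).differentiableAt (by norm_num)
  have h1 : HasDerivAt (fun s : ℝ => D2 u (x + s • ξ)) (fderiv ℝ (D2 u) x ξ) 0 :=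
    hasDerivAt_comp_line (F := E n →L[ℝ] E n →L[ℝ] ℝ) hD ξ
  have hev : ∀ᶠ s : ℝ in nhds 0, x + s • ξ ∈ Ω := by
    have hc : ContinuousAt (fun s : ℝ => x + s • ξ) 0 := hline.continuousAt
    exact hc.eventually (by simpa using hΩ.isOpen.mem_nhds hx)
  have h2 : ∀ i j, HasDerivAt (fun s : ℝ => bilMat (D2 u (x + s • ξ)) i j)
      (bilMat (fderiv ℝ (D2 u) x ξ) i j) 0 := fun i j => by
    have := (h1.clm_apply (hasDerivAt_const (0 : ℝ) (EuclideanSpace.single i (1 : ℝ)))).clm_apply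
      (hasDerivAt_const (0 : ℝ) (EuclideanSpace.single j (1 : ℝ)))
    simpa [bilMat] using this
  have h3 : HasDerivAt (fun s : ℝ => (bilMat (D2 u (x + s • ξ))).trace)
      (bilMat (fderiv ℝ (D2 u) x ξ)).trace 0 := by
    simp only [Matrix.trace, Matrix.diag_apply]
    exact HasDerivAt.fun_sum fun i _ => h2 i i
  have h4 : ∀ i j, HasDerivAt (fun s : ℝ => augMat γ (bilMat (D2 u (x + s • ξ))) i j)
      (augMat γ (bilMat (fderiv ℝ (D2 u) x ξ)) i j) 0 := fun i j =>
    (h2 i j).add ((h3.const_mul γ).mul_const _)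
  have h0 : augMat γ (bilMat (D2 u (x + (0 : ℝ) • ξ))) = augHess Ω γ u x := by
    rw [augHess_eq, hΩ.hess_eq u hx]
    simp
  have h5 := hf.hasDerivAt_specFun_comp hΓ (A := fun s => augMat γ (bilMat (D2 u (x + s • ξ))))
    (by rw [h0]; exact hmem) h4
  rw [h0, sum_gradMat_mul, sum_mul_quad_augMat] at h5
  simp_rw [quad_bilMat] at h5
  refine h5.congr_of_eventuallyEq ?_
  filter_upwards [hev] with s hs
  rw [augHess_eq, hΩ.hess_eq u hs]

/-- All approximate solutions have linearizations with uniform constants. -/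
theorem exists_isLinearization (hn : 2 ≤ n) (hΩ : IsSmoothBoundedDomain Ω) (hγ : 0 ≤ γ)
    (hΓ : IsSymmetricCone Γ) (hf : StructureConditions Γ f)
    (hψ : ContDiffOn ℝ ∞ ψ (closure Ω)) (hψ0 : ∀ x ∈ Ω, 0 ≤ ψ x)
    (hw : IsSubsolution Ω γ Γ f ψ φ w) (hε₀ : 0 < ε₀)
    (hwε₀ : ∀ x ∈ closure Ω, ε₀ ≤ specFun f (augHess Ω γ w x)) (hη : IsCutoff ε₀ η) :
    ∃ θ > 0, ∃ M, 0 ≤ M ∧ ∀ ε, 0 < ε → ε ≤ ε₀ / 2 → ∀ u, IsApproxSolution Ω γ Γ f ψ φ η ε u →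
      ∀ x ∈ Ω, ∃ b q, IsLinearization Ω γ f w u θ M x b q := by
  have hS : IsCompact (augHess Ω γ w '' closure Ω) :=
    hΩ.isCompact_closure.image_of_continuousOn (continuousOn_augHess hΩ hw.contDiffOn)
  have hSΓ : ∀ X ∈ augHess Ω γ w '' closure Ω, eigs X ∈ Γ := by
    rintro _ ⟨x, hx, rfl⟩
    exact hw.mem_cone x hx
  obtain ⟨c, hc, hctr⟩ := hf.exists_trace_lower_bound (by omega) hΓ hS hSΓ
  obtain ⟨θ, hθ, halt⟩ := hf.exists_elliptic_or_large hΓ hS hSΓ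
  have hψcl : Set.MapsTo ψ (closure Ω) (Set.Ici 0) := by
    intro x hx
    have := closure_minimal (s := Set.image ψ Ω) (t := Set.Ici 0) (by
      rintro _ ⟨y, hy, rfl⟩
      exact hψ0 y hy) isClosed_Ici
    exact this ((hψ.continuousOn.image_closure) ⟨x, hx, rfl⟩)
  have hηψ : ContDiffOn ℝ ∞ (fun y => η (ψ y)) (closure Ω) := hη.contDiffOn.comp hψ hψcl
  obtain ⟨M₁, hM₁⟩ := hΩ.isCompact_closure.exists_bound_of_continuousOn
    (hψ.continuousOn_fderivWithin hΩ.uniqueDiffOn (by simp))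
  obtain ⟨M₂, hM₂⟩ := hΩ.isCompact_closure.exists_bound_of_continuousOn
    (hηψ.continuousOn_fderivWithin hΩ.uniqueDiffOn (by simp))
  obtain ⟨M₃, hM₃⟩ := hΩ.isCompact_closure.exists_bound_of_continuousOn hψ.continuousOn
  have hθm : 0 < min c θ := lt_min hc hθ
  refine ⟨min c θ, hθm, |M₁| + ε₀ * |M₂| + |M₃| + ε₀, by positivity,
    fun ε hε hεε₀ u hu x hx => ?_⟩
  have hxc := subset_closure hx
  have hmem := hu.eigs_mem hΓ hf hψ0 hε₀ hη hε hx
  have hle := hu.specFun_le hψ0 hw hwε₀ hη hε hεε₀ hx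
  have hu3 : ContDiffAt ℝ 3 u x := (hΩ.contDiffAt hu.contDiffOn hx).of_le (by norm_num)
  have hu2 : ContDiffAt ℝ 2 u x := hu3.of_le (by norm_num)
  set A := augHess Ω γ u x with hA
  set p := grad f (eigs A) with hp
  have hppos : ∀ a, 0 < p a := fun a => hf.deriv_pos _ hmem a
  have hT0 : 0 ≤ ∑ c, p c := Finset.sum_nonneg fun a _ => (hppos a).le
  have hT : traceCoeff Ω γ f u x = ∑ a, p a := by
    rw [traceCoeff, hf.specDeriv_eq hΓ hmem, gradMat, trace_spectralMat]
  have hquad : ∀ v : E n → ℝ, ∑ a, p a * quad (augHess Ω γ v x) (eigBasis A a) =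
      ∑ a, (p a + γ * ∑ c, p c) * D2 v x (eigBasis A a) (eigBasis A a) := fun v => by
    rw [augHess_eq, sum_mul_quad_augMat, hΩ.hess_eq v hx]
    simp_rw [quad_bilMat]
  have hradial : ∑ a, (p a + γ * ∑ c, p c) * D2 u x (eigBasis A a) (eigBasis A a) =
      ∑ a, p a * eigs A a := by
    rw [← hquad]
    simp_rw [← hA, quad_eigBasis_self]
  have hdiff : ∑ i, ∑ j, gradMat f A i j * (augHess Ω γ w x - A) i j =
      ∑ a, (p a + γ * ∑ c, p c) *
        (D2 w x (eigBasis A a) (eigBasis A a) - D2 u x (eigBasis A a) (eigBasis A a)) := by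
    rw [sum_gradMat_mul]
    simp_rw [quad_sub, mul_sub, Finset.sum_sub_distrib]
    rw [hquad w, ← hquad u]
  have hq : ∀ a, p a ≤ p a + γ * ∑ c, p c := fun a =>
    le_add_of_nonneg_right (mul_nonneg hγ hT0)
  have hcT : c ≤ ∑ a, p a := hctr _ ⟨x, hxc, rfl⟩ A hmem hle
  refine ⟨eigBasis A, fun a => p a + γ * ∑ c, p c, ⟨?_, ?_, ?_, ?_, ?_, ?_, ?_, ?_, ?_, ?_, ?_⟩⟩
  · exact fun a => (hppos a).trans_le (hq a)
  · rw [hT, Finset.sum_add_distrib]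
    simp
    ring
  · rw [hT]
    exact (min_le_left _ _).trans hcT
  · intro v
    rw [← hquad v, linOp, hT, ← hA, hf.specDeriv_eq hΓ hmem, sum_gradMat_mul, augHess_eq]
    simp_rw [quad_augMat γ _ _ (eigBasis A), mul_add, Finset.sum_add_distrib, ← Finset.sum_mul,
      ← trace_eq_sum_quad]
    ring
  · exact hΩ.D2_eigBasis hx hu2
  · rw [hradial]
    exact hf.sum_grad_mul_nonneg hΓ hmem
  · rw [hradial]
    refine (hf.sum_grad_mul_le hΓ hmem).trans ?_
    change specFun f A ≤ _
    rw [hA, hu.equation x hx]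
    have h1 := (le_abs_self _).trans (hM₃ x hxc)
    have h2 := mul_le_mul_of_nonneg_left (hη.mem_Icc _ (hψ0 x hx)).2 hε.le
    have h3 := le_abs_self M₃
    have h4 : 0 ≤ |M₁| + ε₀ * |M₂| := by positivity
    linarith
  · have h1 := hf.sum_pos (by omega) hΓ hmem
    have h2 : ∑ a, eigs A a = (1 + n * γ) * ∑ a, D2 u x (eigBasis A a) (eigBasis A a) := by
      have h3 : ∀ a, eigs A a = D2 u x (eigBasis A a) (eigBasis A a) +
          γ * ∑ d, D2 u x (eigBasis A d) (eigBasis A d) := fun a => by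
        have h4 := quad_augMat γ (hess Ω u x) (eigBasis A) (eigBasis A) a
        rw [← augHess_eq, ← hA, quad_eigBasis_self] at h4
        simpa only [hΩ.hess_eq u hx, quad_bilMat] using h4
      simp_rw [h3, Finset.sum_add_distrib]
      rw [Finset.sum_const, Finset.card_univ, Fintype.card_fin, nsmul_eq_mul]
      ring
    rw [h2] at h1
    exact (pos_of_mul_pos_right h1 (by positivity)).le
  · rw [← hdiff]
    have h := hf.specFun_le_tangent hΓ hmem (hw.mem_cone x hxc)
    linarith
  · rw [hT, ← hdiff]
    rcases halt _ ⟨x, hxc, rfl⟩ A hmem hle with h | h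
    · left
      intro a
      exact ((mul_le_mul_of_nonneg_right (min_le_right _ _) hT0).trans (h a)).trans (hq a)
    · right
      exact (mul_le_mul_of_nonneg_right (min_le_right _ _) (by linarith)).trans h
  · intro ξ
    have h1 := hΩ.hasDerivAt_specFun_augHess (γ := γ) hΓ hf hx hu3 hmem ξ
    have hline : HasDerivAt (fun s : ℝ => x + s • ξ) ξ 0 := by
      simpa using ((hasDerivAt_id (0 : ℝ)).smul_const ξ).const_add x
    have hev : ∀ᶠ s : ℝ in nhds 0, x + s • ξ ∈ Ω :=
      hline.continuousAt.eventually (by simpa using hΩ.isOpen.mem_nhds hx)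
    have h2 : HasDerivAt (fun s : ℝ => ψ (x + s • ξ) + ε * η (ψ (x + s • ξ)))
        (fderiv ℝ ψ x ξ + ε * fderiv ℝ (fun y => η (ψ y)) x ξ) 0 :=
      (hasDerivAt_comp_line ((hΩ.contDiffAt hψ hx).differentiableAt (by simp)) ξ).add
        ((hasDerivAt_comp_line (v := fun y => η (ψ y))
          ((hΩ.contDiffAt hηψ hx).differentiableAt (by simp)) ξ).const_mul ε)
    have h3 := (h1.congr_of_eventuallyEq (f₁ := fun s : ℝ => ψ (x + s • ξ) +
      ε * η (ψ (x + s • ξ))) (by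
        filter_upwards [hev] with s hs using (hu.equation _ hs).symm)).unique h2
    rw [h3]
    have h4 := hM₁ x hxc
    have h5 := hM₂ x hxc
    rw [fderivWithin_closure_eq hΩ.isOpen _ hx] at h4 h5
    have h6 : |fderiv ℝ ψ x ξ| ≤ |M₁| * ‖ξ‖ := (ContinuousLinearMap.le_opNorm _ _).trans
      (mul_le_mul_of_nonneg_right (h4.trans (le_abs_self _)) (norm_nonneg _))
    have h7 : |fderiv ℝ (fun y => η (ψ y)) x ξ| ≤ |M₂| * ‖ξ‖ :=
      (ContinuousLinearMap.le_opNorm _ _).trans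
        (mul_le_mul_of_nonneg_right (h5.trans (le_abs_self _)) (norm_nonneg _))
    have h8 : |ε * fderiv ℝ (fun y => η (ψ y)) x ξ| ≤ ε₀ * (|M₂| * ‖ξ‖) := by
      rw [abs_mul, abs_of_pos hε]
      exact mul_le_mul (by linarith) h7 (abs_nonneg _) hε₀.le
    have h9 : 0 ≤ (|M₃| + ε₀) * ‖ξ‖ := by positivity
    calc _ ≤ _ := abs_add_le _ _
      _ ≤ |M₁| * ‖ξ‖ + ε₀ * (|M₂| * ‖ξ‖) := add_le_add h6 h8
      _ ≤ _ := by linarith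

end Linearization

/-! ### The maximum principle -/

section MaximumPrinciple

variable {n : ℕ}

theorem D2_apply_eq_deriv_deriv {v : E n → ℝ} {x : E n} (hv : ContDiffAt ℝ 2 v x) (ξ : E n) :
    deriv (deriv fun s : ℝ => v (x + s • ξ)) 0 = D2 v x ξ ξ := by
  have hc : ContinuousAt (fun s : ℝ => x + s • ξ) 0 := by fun_prop
  have hev : ∀ᶠ s : ℝ in nhds 0, ContDiffAt ℝ 2 v (x + s • ξ) :=
    hc.eventually (by simpa using hv.eventually (by simp))
  have h1 : deriv (fun s : ℝ => v (x + s • ξ)) =ᶠ[nhds 0] fun s => fderiv ℝ v (x + s • ξ) ξ := by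
    filter_upwards [hev] with s hs
    have h := hasDerivAt_comp_line (hs.differentiableAt (by norm_num)) ξ
    have h2 := HasDerivAt.comp_sub_const (f := fun t : ℝ => v (x + s • ξ + t • ξ)) s s
      (by simpa using h)
    refine HasDerivAt.deriv ?_
    convert h2 using 3
    rw [add_assoc, ← add_smul]
    congr 2
    ring
  rw [h1.deriv_eq]
  have hd : DifferentiableAt ℝ (fderiv ℝ v) x :=
    (hv.fderiv_right (m := 1) (by norm_num)).differentiableAt (by norm_num)
  have h2 := (hasDerivAt_comp_line hd ξ).clm_apply (hasDerivAt_const (0 : ℝ) ξ)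
  simpa [D2] using h2.deriv

/-- The Hessian is non-positive at a local maximum. -/
theorem D2_nonpos_of_isLocalMax {v : E n → ℝ} {x : E n} (hv : ContDiffAt ℝ 2 v x)
    (hmax : IsLocalMax v x) (ξ : E n) : D2 v x ξ ξ ≤ 0 := by
  by_contra! hcon
  rw [← D2_apply_eq_deriv_deriv hv] at hcon
  have hc : ContinuousAt (fun s : ℝ => x + s • ξ) 0 := by fun_prop
  have hd := hasDerivAt_comp_line (hv.differentiableAt (by norm_num)) ξ
  have hmax' : IsLocalMax (fun s : ℝ => v (x + s • ξ)) 0 := by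
    have h : ∀ᶠ y in nhds (x + (0 : ℝ) • ξ), v y ≤ v x := by
      rw [zero_smul, add_zero]
      exact hmax
    have h2 := hc.eventually h
    simpa [IsLocalMax, IsMaxFilter] using h2
  have hmin := isLocalMin_of_deriv_deriv_pos hcon hmax'.deriv_eq_zero hd.continuousAt
  -- a function with both a local maximum and a local minimum is locally constant
  have hconst : (fun s : ℝ => v (x + s • ξ)) =ᶠ[nhds 0] fun _ => v (x + (0 : ℝ) • ξ) := by
    filter_upwards [hmax', hmin] with s h1 h2 using le_antisymm h1 h2
  have h0 : deriv (deriv fun s : ℝ => v (x + s • ξ)) 0 = 0 := by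
    rw [hconst.deriv.deriv_eq]
    simp
  rw [h0] at hcon
  exact lt_irrefl _ hcon

/-- The weak maximum principle, for a subsolution of a (possibly very discontinuous and degenerate)
elliptic operator at all points where it is positive. -/
theorem le_zero_of_subsolution (hn : 0 < n) {S : Set (E n)} (hS : IsCompact S) {v : E n → ℝ}
    (hv : ContinuousOn v S)
    (h : ∀ x ∈ S, 0 < v x → S ∈ nhds x ∧ ContDiffAt ℝ 2 v x ∧
      ∃ (b : OrthonormalBasis (Fin n) ℝ (E n)) (q : Fin n → ℝ), (∀ a, 0 < q a) ∧
        0 ≤ ∑ a, q a * D2 v x (b a) (b a)) :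
    ∀ x ∈ S, v x ≤ 0 := by
  intro x₁ hx₁
  by_contra! hcon
  obtain ⟨R, hR⟩ := hS.isBounded.exists_norm_le
  have hτ : 0 < v x₁ / (2 * (R ^ 2 + 1)) := by positivity
  set τ := v x₁ / (2 * (R ^ 2 + 1)) with hτdef
  have hτR : τ * R ^ 2 < v x₁ := by
    have : τ * (2 * (R ^ 2 + 1)) = v x₁ := by rw [hτdef]; field_simp
    nlinarith [sq_nonneg R]
  have hcn : ContinuousOn (fun x : E n => v x + τ * ‖x - 0‖ ^ 2) S := by
    have : Continuous fun x : E n => τ * ‖x - 0‖ ^ 2 := by fun_prop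
    exact hv.add this.continuousOn
  obtain ⟨x, hxS, hxmax⟩ := hS.exists_isMaxOn ⟨x₁, hx₁⟩ hcn
  have hpos : 0 < v x := by
    have h1 : v x₁ + τ * ‖x₁ - 0‖ ^ 2 ≤ v x + τ * ‖x - 0‖ ^ 2 := hxmax hx₁
    have h2 : ‖x - 0‖ ^ 2 ≤ R ^ 2 := by
      rw [sub_zero]
      exact pow_le_pow_left₀ (norm_nonneg _) (hR x hxS) 2
    have h3 := mul_le_mul_of_nonneg_left h2 hτ.le
    have h4 : 0 ≤ τ * ‖x₁ - 0‖ ^ 2 := by positivity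
    linarith
  obtain ⟨hSx, hvx, b, q, hq, hsum⟩ := h x hxS hpos
  have hnorm : ContDiffAt ℝ 2 (fun x : E n => ‖x - 0‖ ^ 2) x :=
    (contDiff_id.sub contDiff_const).norm_sq ℝ |>.contDiffAt
  have hloc : IsLocalMax (fun x : E n => v x + τ * ‖x - 0‖ ^ 2) x :=
    hxmax.isLocalMax hSx
  have hle : ∑ a, q a * D2 (fun x : E n => v x + τ * ‖x - 0‖ ^ 2) x (b a) (b a) ≤ 0 :=
    Finset.sum_nonpos fun a _ => mul_nonpos_of_nonneg_of_nonpos (hq a).le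
      (D2_nonpos_of_isLocalMax (hvx.add (contDiffAt_const.mul hnorm)) hloc _)
  have heq : ∑ a, q a * D2 (fun x : E n => v x + τ * ‖x - 0‖ ^ 2) x (b a) (b a) =
      ∑ a, q a * D2 v x (b a) (b a) + 2 * τ * ∑ a, q a := by
    rw [D2_add hvx (contDiffAt_const.mul hnorm), D2_const_mul _ hnorm, Finset.mul_sum,
      ← Finset.sum_add_distrib]
    refine Finset.sum_congr rfl fun a _ => ?_
    simp only [add_apply, smul_apply, D2_norm_sq, b.norm_eq_one, smul_eq_mul]
    ring
  have hqs : 0 < ∑ a, q a := Finset.sum_pos (fun a _ => hq a) ⟨⟨0, hn⟩, Finset.mem_univ _⟩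
  rw [heq] at hle
  have : 0 < 2 * τ * ∑ a, q a := by positivity
  linarith

end MaximumPrinciple

/-! ### Derivatives up to the boundary -/

section GradientBound

variable {n : ℕ} {Ω : Set (E n)}

/-- Differentiation in a fixed direction commutes with taking the Hessian. -/
theorem D2_fderiv_apply {u : E n → ℝ} {x : E n} (hu : ContDiffAt ℝ 3 u x) (ξ ζ : E n) :
    D2 (fun y => fderiv ℝ u y ξ) x ζ ζ = fderiv ℝ (D2 u) x ξ ζ ζ := by
  have hu1 : ContDiffAt ℝ 2 (fderiv ℝ u) x := hu.fderiv_right (m := 2) (by norm_num)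
  have hu2 : ContDiffAt ℝ 1 (D2 u) x := hu1.fderiv_right (m := 1) (by norm_num)
  have hD : DifferentiableAt ℝ (D2 u) x := hu2.differentiableAt (by norm_num)
  have hev : ∀ᶠ y in nhds x, ContDiffAt ℝ 3 u y := hu.eventually (by simp)
  have h1 : fderiv ℝ (fun y => fderiv ℝ u y ξ) =ᶠ[nhds x] fun y => (D2 u y).flip ξ := by
    filter_upwards [hev] with y hy
    have hd : DifferentiableAt ℝ (fderiv ℝ u) y :=
      (hy.fderiv_right (m := 2) (by norm_num)).differentiableAt (by norm_num)
    have := (hd.hasFDerivAt.clm_apply (hasFDerivAt_const ξ y)).fderiv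
    rw [this]
    ext k
    simp [D2]
  -- second derivatives at `x` of `y ↦ Du(y)ξ`, evaluated along a line
  have h2 : ∀ y, (fun y => (D2 u y).flip ξ) y ζ = D2 u y ζ ξ := fun y => rfl
  have hdf : DifferentiableAt ℝ (fun y => (D2 u y).flip ξ) x := by
    have : ContDiffAt ℝ 1 (fderiv ℝ (fun y => fderiv ℝ u y ξ)) x :=
      (hu1.clm_apply contDiffAt_const).fderiv_right (m := 1) (by norm_num)
    exact (this.differentiableAt (by norm_num)).congr_of_eventuallyEq h1.symm
  have h3 : fderiv ℝ (fun y => (D2 u y).flip ξ) x ζ ζ = fderiv ℝ (D2 u) x ζ ζ ξ := by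
    have a1 := (hasDerivAt_comp_line hdf ζ).clm_apply (hasDerivAt_const (0 : ℝ) ζ)
    have a2 := ((hasDerivAt_comp_line (F := E n →L[ℝ] E n →L[ℝ] ℝ) hD ζ).clm_apply
      (hasDerivAt_const (0 : ℝ) ζ)).clm_apply (hasDerivAt_const (0 : ℝ) ξ)
    have a3 := a1.unique a2
    simpa using a3
  have h4 : fderiv ℝ (D2 u) x ζ ζ ξ = fderiv ℝ (D2 u) x ζ ξ ζ := by
    have a1 := ((hasDerivAt_comp_line (F := E n →L[ℝ] E n →L[ℝ] ℝ) hD ζ).clm_apply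
      (hasDerivAt_const (0 : ℝ) ζ)).clm_apply (hasDerivAt_const (0 : ℝ) ξ)
    have a2 := ((hasDerivAt_comp_line (F := E n →L[ℝ] E n →L[ℝ] ℝ) hD ζ).clm_apply
      (hasDerivAt_const (0 : ℝ) ξ)).clm_apply (hasDerivAt_const (0 : ℝ) ζ)
    have hc : ContinuousAt (fun s : ℝ => x + s • ζ) 0 := by fun_prop
    have a3 := a1.congr_of_eventuallyEq (f₁ := fun s : ℝ => D2 u (x + s • ζ) ξ ζ) (by
      filter_upwards [hc.eventually (by simpa using hev)] with s hs
      exact D2_symm (hs.of_le (by norm_num)) _ _)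
    have a4 := a3.unique a2
    simpa using a4
  have h5 : fderiv ℝ (D2 u) x ζ ξ = fderiv ℝ (D2 u) x ξ ζ :=
    (hu1.isSymmSndFDerivAt (by simp)).eq ζ ξ
  rw [D2, h1.fderiv_eq, h3, h4, h5]

/-- A derivative up to the boundary, in an inward direction, is a limit of difference
quotients. -/
theorem tendsto_inward_quotient {v : E n → ℝ} {T : E n →L[ℝ] ℝ} {y h : E n}
    (hv : HasFDerivWithinAt v T (closure Ω) y)
    (hh : ∀ᶠ t in nhdsWithin (0 : ℝ) (Set.Ioi 0), y + t • h ∈ Ω) :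
    Filter.Tendsto (fun t : ℝ => t⁻¹ * (v (y + t • h) - v y)) (nhdsWithin 0 (Set.Ioi 0))
      (nhds (T h)) := by
  have h0 : Filter.Tendsto (fun t : ℝ => t • h) (nhdsWithin 0 (Set.Ioi 0)) (nhds 0) := by
    have : Continuous (fun t : ℝ => t • h) := by fun_prop
    have h2 := this.tendsto 0
    rw [zero_smul] at h2
    exact h2.mono_left nhdsWithin_le_nhds
  refine hv.lim (c := fun t : ℝ => t⁻¹) (d := fun t : ℝ => t • h) h0
    (hh.mono fun t ht => subset_closure ht) ?_
  refine tendsto_nhds_of_eventually_eq ?_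
  filter_upwards [self_mem_nhdsWithin] with t ht
  have ht0 : t ≠ 0 := ne_of_gt ht
  rw [smul_smul, inv_mul_cancel₀ ht0, one_smul]

theorem exists_D2_bound (hΩ : IsSmoothBoundedDomain Ω) {v : E n → ℝ}
    (hv : ContDiffOn ℝ 2 v (closure Ω)) : ∃ C, 0 ≤ C ∧ ∀ x ∈ Ω, ‖D2 v x‖ ≤ C := by
  obtain ⟨C, hC⟩ := hΩ.isCompact_closure.exists_bound_of_continuousOn
    (hv.continuousOn_iteratedFDerivWithin (m := 2) (by norm_num) hΩ.uniqueDiffOn)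
  refine ⟨|C|, abs_nonneg C, fun x hx => ?_⟩
  have h := (hC x (subset_closure hx)).trans (le_abs_self C)
  refine ContinuousLinearMap.opNorm_le_bound₂ _ (abs_nonneg C) fun ξ ζ => ?_
  have e : D2 v x ξ ζ = iteratedFDerivWithin ℝ 2 v (closure Ω) x ![ξ, ζ] := by
    rw [iteratedFDerivWithin_two_apply' v hΩ.uniqueDiffOn (subset_closure hx),
      fderivWithin_closure_eq hΩ.isOpen _ hx,
      (fderivWithin_closure_eventuallyEq hΩ.isOpen v hx).fderiv_eq]
    rfl
  rw [e]
  refine (ContinuousMultilinearMap.le_opNorm _ _).trans ?_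
  simp only [Fin.prod_univ_two, Matrix.cons_val_zero, Matrix.cons_val_one]
  rw [← mul_assoc]
  gcongr

theorem abs_D2_apply_le {v : E n → ℝ} {x : E n} {C : ℝ} (h : ‖D2 v x‖ ≤ C)
    {ξ ζ : E n} (hξ : ‖ξ‖ = 1) (hζ : ‖ζ‖ = 1) : |D2 v x ξ ζ| ≤ C := by
  have h1 := (D2 v x).le_opNorm₂ ξ ζ
  rw [hξ, hζ, mul_one, mul_one] at h1
  exact h1.trans h

theorem exists_fderivWithin_bound (hΩ : IsSmoothBoundedDomain Ω) {F : Type*}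
    [NormedAddCommGroup F] [NormedSpace ℝ F] {v : E n → F}
    (hv : ContDiffOn ℝ 1 v (closure Ω)) :
    ∃ C, 0 ≤ C ∧ ∀ x ∈ closure Ω, ‖fderivWithin ℝ v (closure Ω) x‖ ≤ C := by
  obtain ⟨C, hC⟩ := hΩ.isCompact_closure.exists_bound_of_continuousOn
    (hv.continuousOn_fderivWithin hΩ.uniqueDiffOn (by norm_num))
  exact ⟨|C|, abs_nonneg C, fun x hx => (hC x hx).trans (le_abs_self C)⟩

/-- In an orthonormal basis the squared derivatives of the distance add up to at least one. -/
theorem IsSmoothBoundedDomain.one_le_sum_fderiv_dist_sq (hΩ : IsSmoothBoundedDomain Ω)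
    (hne : (frontier Ω).Nonempty) {x : E n} (hx : x ∈ Ω)
    (hd : DifferentiableAt ℝ (fun z => Metric.infDist z (frontier Ω)) x)
    (b : OrthonormalBasis (Fin n) ℝ (E n)) :
    1 ≤ ∑ a, fderiv ℝ (fun z => Metric.infDist z (frontier Ω)) x (b a) ^ 2 := by
  obtain ⟨e, he, heq⟩ := hΩ.exists_fderiv_dist_eq hne hx hd
  set T := fderiv ℝ (fun z => Metric.infDist z (frontier Ω)) x
  have h1 : T e = ∑ a, inner ℝ (b a) e * T (b a) := by
    conv_lhs => rw [← b.sum_repr' e]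
    simp only [map_sum, map_smul, smul_eq_mul]
  have h2 : ∑ a, inner ℝ (b a) e ^ 2 = 1 := by
    have := b.sum_sq_norm_inner_right e
    rw [he] at this
    simpa using this
  have h3 := Finset.sum_mul_sq_le_sq_mul_sq Finset.univ (fun a => inner ℝ (b a) e)
    (fun a => T (b a))
  rw [← h1, h2, heq, one_mul] at h3
  linarith

end GradientBound

/-! ### Uniform bounds for solutions and their gradients -/

section AprioriEstimates

variable {n : ℕ} {Ω : Set (E n)} {γ : ℝ} {Γ : Set (Fin n → ℝ)} {f : (Fin n → ℝ) → ℝ}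
  {ψ φ w : E n → ℝ} {η : ℝ → ℝ} {ε₀ ε θ M : ℝ} {u : E n → ℝ}

theorem IsSmoothBoundedDomain.mem_nhds_closure (hΩ : IsSmoothBoundedDomain Ω) {x : E n}
    (hx : x ∈ Ω) : closure Ω ∈ nhds x :=
  Filter.mem_of_superset (hΩ.isOpen.mem_nhds hx) subset_closure

theorem le_trace_of_isLinearization {x : E n} {b : OrthonormalBasis (Fin n) ℝ (E n)}
    {q : Fin n → ℝ} (hγ : 0 ≤ γ) (hθ : 0 < θ) (h : IsLinearization Ω γ f w u θ M x b q) :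
    traceCoeff Ω γ f u x ≤ ∑ a, q a := by
  rw [h.sum_eq]
  have : 0 < traceCoeff Ω γ f u x := hθ.trans_le h.le_trace
  have : 0 ≤ n * γ * traceCoeff Ω γ f u x := by positivity
  linarith

/-- The comparison principle. -/
theorem subsolution_le (hn : 0 < n) (hΩ : IsSmoothBoundedDomain Ω)
    (hw : IsSubsolution Ω γ Γ f ψ φ w) (hu : IsApproxSolution Ω γ Γ f ψ φ η ε u)
    (hlin : ∀ x ∈ Ω, ∃ b q, IsLinearization Ω γ f w u θ M x b q) :
    ∀ x ∈ closure Ω, w x ≤ u x := by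
  have key := le_zero_of_subsolution hn hΩ.isCompact_closure (v := fun x => w x - u x)
    (hw.contDiffOn.continuousOn.sub hu.contDiffOn.continuousOn) (by
      intro x hx hpos
      rcases hΩ.mem_or_mem_frontier hx with h | h
      · have hu2 := (hΩ.contDiffAt hu.contDiffOn h).of_le (m := 2) (by norm_num)
        have hw2 := hΩ.contDiffAt hw.contDiffOn h
        obtain ⟨b, q, hl⟩ := hlin x h
        refine ⟨hΩ.mem_nhds_closure h, hw2.sub hu2, b, q, hl.pos, ?_⟩
        rw [D2_sub hw2 hu2]
        exact hl.subsolution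
      · rw [hw.boundary x h, hu.boundary x h, sub_self] at hpos
        exact absurd hpos (lt_irrefl _))
  exact fun x hx => sub_nonpos.1 (key x hx)

/-- A bound from above for solutions. -/
theorem solution_le (hn : 0 < n) (hΩ : IsSmoothBoundedDomain Ω) {C : ℝ}
    (hC : ∀ x ∈ frontier Ω, φ x ≤ C) (hu : IsApproxSolution Ω γ Γ f ψ φ η ε u)
    (hlin : ∀ x ∈ Ω, ∃ b q, IsLinearization Ω γ f w u θ M x b q) :
    ∀ x ∈ closure Ω, u x ≤ C := by
  have key := le_zero_of_subsolution hn hΩ.isCompact_closure (v := fun x => u x - C)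
    (hu.contDiffOn.continuousOn.sub continuousOn_const) (by
      intro x hx hpos
      rcases hΩ.mem_or_mem_frontier hx with h | h
      · have hu2 := (hΩ.contDiffAt hu.contDiffOn h).of_le (m := 2) (by norm_num)
        obtain ⟨b, q, hl⟩ := hlin x h
        refine ⟨hΩ.mem_nhds_closure h, hu2.sub contDiffAt_const, b, q, hl.pos, ?_⟩
        have e : D2 (fun y => u y - C) x = D2 u x := by
          rw [D2_sub hu2 contDiffAt_const, D2_const]
          exact sub_zero (G := E n →L[ℝ] E n →L[ℝ] ℝ) _
        rw [e]
        exact hl.radial_nonneg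
      · rw [hu.boundary x h] at hpos
        linarith [hC x h])
  exact fun x hx => sub_nonpos.1 (key x hx)

theorem IsSmoothBoundedDomain.exists_mem_frontier_dist_lt (hΩ : IsSmoothBoundedDomain Ω)
    (hne : (frontier Ω).Nonempty) {x : E n} {δ : ℝ}
    (hx : Metric.infDist x (frontier Ω) < δ) : ∃ y ∈ frontier Ω, x ∈ Metric.ball y δ := by
  obtain ⟨y, hy, hyd⟩ := hΩ.isCompact_frontier.exists_infDist_eq_dist hne x
  exact ⟨y, hy, by rw [Metric.mem_ball, ← hyd]; exact hx⟩

/-- Solutions grow at most linearly away from the boundary: the function `φ + C (d - N d²)` is a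
supersolution of the Laplace equation near the boundary. -/
theorem exists_boundary_upper_barrier (hn : 0 < n) (hΩ : IsSmoothBoundedDomain Ω)
    (hne : (frontier Ω).Nonempty) (hφ : ContDiffOn ℝ ∞ φ (closure Ω)) :
    ∃ C, 0 ≤ C ∧ ∃ δ > 0, ∀ (γ : ℝ) (Γ : Set (Fin n → ℝ)) (f : (Fin n → ℝ) → ℝ)
      (ψ w : E n → ℝ) (η : ℝ → ℝ) (ε θ M : ℝ) (u : E n → ℝ),
      IsApproxSolution Ω γ Γ f ψ φ η ε u →
      (∀ x ∈ Ω, ∃ b q, IsLinearization Ω γ f w u θ M x b q) →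
      ∀ x ∈ closure Ω, Metric.infDist x (frontier Ω) ≤ δ →
        u x ≤ φ x + C * Metric.infDist x (frontier Ω) := by
  obtain ⟨δ₀, hδ₀, C₀, hC₀, hreg⟩ := hΩ.exists_dist_regular
  obtain ⟨C₁, hC₁, hφ2⟩ := exists_D2_bound hΩ (hφ.of_le (WithTop.coe_le_coe.2 le_top))
  obtain ⟨C₂, hC₂⟩ := hΩ.isCompact_closure.exists_bound_of_continuousOn hφ.continuousOn
  have hn' : (0 : ℝ) < n := by exact_mod_cast hn
  set N := (n * C₀ + 1) / 2 with hN
  have hNpos : 0 < N := by positivity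
  set δ := min (δ₀ / 2) (1 / (2 * N)) with hδ
  have hδpos : 0 < δ := lt_min (by positivity) (by positivity)
  have hδN : N * δ ≤ 1 / 2 := by
    have h1 := mul_le_mul_of_nonneg_left (min_le_right (δ₀ / 2) (1 / (2 * N))) hNpos.le
    have h2 : N * (1 / (2 * N)) = 1 / 2 := by field_simp
    rw [h2] at h1
    exact h1
  set C := n * C₁ + 4 * |C₂| / δ with hC
  have hCpos : 0 ≤ C := by positivity
  refine ⟨C, hCpos, δ, hδpos, fun γ Γ f ψ w η ε θ M u hu hlin => ?_⟩
  set d : E n → ℝ := fun z => Metric.infDist z (frontier Ω) with hd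
  have hd0 : ∀ x, 0 ≤ d x := fun x => Metric.infDist_nonneg
  have hdc : Continuous d := Metric.continuous_infDist_pt _
  have hS : IsCompact (closure Ω ∩ {x | d x ≤ δ}) :=
    hΩ.isCompact_closure.inter_right (isClosed_le hdc continuous_const)
  have hule := solution_le hn hΩ (C := |C₂|) (fun x hx =>
    (le_abs_self _).trans ((hC₂ x (frontier_subset_closure hx)).trans (le_abs_self _))) hu hlin
  have key := le_zero_of_subsolution hn hS
    (v := fun x => u x - (φ x + C * (d x - N * d x ^ 2))) (by
      have h1 := hu.contDiffOn.continuousOn.mono (Set.inter_subset_left (t := {x | d x ≤ δ}))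
      have h2 := hφ.continuousOn.mono (Set.inter_subset_left (t := {x | d x ≤ δ}))
      have h3 : Continuous fun x => C * (d x - N * d x ^ 2) := by fun_prop
      exact h1.sub (h2.add h3.continuousOn)) (by
    rintro x ⟨hx, hxδ⟩ hpos
    have hxδ' : d x ≤ δ := hxδ
    rcases hΩ.mem_or_mem_frontier hx with h | h
    swap
    · have h0 : d x = 0 := Metric.infDist_zero_of_mem h
      rw [hu.boundary x h, h0] at hpos
      simp at hpos
    rcases hxδ'.lt_or_eq with hlt | heq
    swap
    · have h1 := hule x hx
      have h2 := (neg_abs_le _).trans' (neg_le_neg ((hC₂ x hx).trans (le_abs_self C₂)))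
      have h3 : δ / 2 ≤ δ - N * δ ^ 2 := by
        have := mul_le_mul_of_nonneg_right hδN hδpos.le
        linarith
      have h4 := mul_le_mul_of_nonneg_left h3 hCpos
      have h5 : C * (δ / 2) = n * C₁ * (δ / 2) + 2 * |C₂| := by
        rw [hC]
        field_simp
        ring
      have h6 : 0 ≤ n * C₁ * (δ / 2) := by positivity
      rw [heq] at hpos
      linarith
    obtain ⟨y, hy, hxy⟩ := hΩ.exists_mem_frontier_dist_lt hne (x := x) (δ := δ₀)
      (by
        have := min_le_left (δ₀ / 2) (1 / (2 * N))
        change d x < δ₀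
        linarith)
    obtain ⟨hdreg, hdC⟩ := hreg y hy x ⟨h, hxy⟩
    obtain ⟨b, q, hl⟩ := hlin x h
    have hu2 := (hΩ.contDiffAt hu.contDiffOn h).of_le (m := 2) (by norm_num)
    have hφ2' := (hΩ.contDiffAt hφ h).of_le (m := 2) (WithTop.coe_le_coe.2 le_top)
    have hd2 : ContDiffAt ℝ 2 (fun y => d y ^ 2) x := hdreg.pow 2
    have hb : ContDiffAt ℝ 2 (fun y => d y - N * d y ^ 2) x :=
      hdreg.sub (contDiffAt_const.mul hd2)
    refine ⟨?_, hu2.sub (hφ2'.add (contDiffAt_const.mul hb)), b, fun _ => 1,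
      fun _ => one_pos, ?_⟩
    · exact Filter.inter_mem (hΩ.mem_nhds_closure h)
        (Filter.mem_of_superset ((isOpen_lt hdc continuous_const).mem_nhds hlt)
          fun z (hz : d z < δ) => hz.le)
    · have hterm : ∀ a, D2 (fun x => u x - (φ x + C * (d x - N * d x ^ 2))) x (b a) (b a) =
          D2 u x (b a) (b a) - D2 φ x (b a) (b a) -
            C * ((1 - 2 * (N * d x)) * D2 d x (b a) (b a)
              - 2 * N * fderiv ℝ d x (b a) ^ 2) := by
        intro a
        rw [D2_sub hu2 (hφ2'.add (contDiffAt_const.mul hb)),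
          D2_add hφ2' (contDiffAt_const.mul hb), D2_const_mul _ hb,
          D2_sub hdreg (contDiffAt_const.mul hd2), D2_const_mul _ hd2]
        simp only [sub_apply, add_apply, smul_apply, smul_eq_mul, D2_sq hdreg]
        ring
      have h1 := hl.laplacian_nonneg
      have h2 : ∑ a, D2 φ x (b a) (b a) ≤ n * C₁ := by
        have : ∑ a : Fin n, D2 φ x (b a) (b a) ≤ ∑ _a : Fin n, C₁ := Finset.sum_le_sum
          fun a _ => (le_abs_self _).trans
            (abs_D2_apply_le (hφ2 x h) (b.norm_eq_one a) (b.norm_eq_one a))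
        simpa using this
      have hNd : N * d x ≤ 1 / 2 := (mul_le_mul_of_nonneg_left hxδ' hNpos.le).trans hδN
      have hNd0 : 0 ≤ N * d x := mul_nonneg hNpos.le (hd0 x)
      have h3 : ∑ a, (1 - 2 * (N * d x)) * D2 d x (b a) (b a) ≤ n * C₀ := by
        have : ∑ a : Fin n, (1 - 2 * (N * d x)) * D2 d x (b a) (b a) ≤ ∑ _a : Fin n, C₀ := by
          refine Finset.sum_le_sum fun a _ => (le_abs_self _).trans ?_
          rw [abs_mul, abs_of_nonneg (by linarith : 0 ≤ 1 - 2 * (N * d x))]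
          have h5 := abs_D2_apply_le (v := d) hdC (b.norm_eq_one a) (b.norm_eq_one a)
          calc _ ≤ 1 * |D2 d x (b a) (b a)| :=
                mul_le_mul_of_nonneg_right (by linarith) (abs_nonneg _)
            _ ≤ C₀ := by rwa [one_mul]
        simpa using this
      have h4 := hΩ.one_le_sum_fderiv_dist_sq hne h (hdreg.differentiableAt (by norm_num)) b
      simp_rw [one_mul, hterm, Finset.sum_sub_distrib, ← Finset.mul_sum,
        Finset.sum_sub_distrib]
      rw [← Finset.mul_sum Finset.univ (fun a => fderiv ℝ d x (b a) ^ 2) (2 * N)]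
      have h5 : (∑ a, (1 - 2 * (N * d x)) * D2 d x (b a) (b a)) -
          2 * N * ∑ a, fderiv ℝ d x (b a) ^ 2 ≤ -1 := by
        have h6 : 2 * N * 1 ≤ 2 * N * ∑ a, fderiv ℝ d x (b a) ^ 2 :=
          mul_le_mul_of_nonneg_left h4 (by positivity)
        have h7 : 2 * N = n * C₀ + 1 := by rw [hN]; ring
        linarith
      have h6 := mul_le_mul_of_nonneg_left h5 hCpos
      have h7 : n * C₁ ≤ C := by
        rw [hC]
        have : 0 ≤ 4 * |C₂| / δ := by positivity
        linarith
      linarith)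
  intro x hx hxδ
  have h1 := key x ⟨hx, hxδ⟩
  have h2 : 0 ≤ C * (N * d x ^ 2) := by positivity
  change u x ≤ φ x + C * d x
  linarith

/-- The gradient of a solution is bounded at the boundary. -/
theorem exists_boundary_gradient_bound (hn : 0 < n) (hΩ : IsSmoothBoundedDomain Ω)
    (hne : (frontier Ω).Nonempty) (hφ : ContDiffOn ℝ ∞ φ (closure Ω))
    (hw : IsSubsolution Ω γ Γ f ψ φ w) :
    ∃ C, 0 ≤ C ∧ ∀ (η : ℝ → ℝ) (ε θ M : ℝ) (u : E n → ℝ),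
      IsApproxSolution Ω γ Γ f ψ φ η ε u →
      (∀ x ∈ Ω, ∃ b q, IsLinearization Ω γ f w u θ M x b q) →
      ∀ y ∈ frontier Ω, ‖fderivWithin ℝ u (closure Ω) y‖ ≤ C := by
  obtain ⟨C, hC, δ, hδ, hbar⟩ := exists_boundary_upper_barrier hn hΩ hne hφ
  obtain ⟨C₁, hC₁, hw1⟩ := exists_fderivWithin_bound hΩ (hw.contDiffOn.of_le (by norm_num))
  obtain ⟨C₂, hC₂, hφ1⟩ := exists_fderivWithin_bound hΩ (hφ.of_le (WithTop.coe_le_coe.2 le_top))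
  refine ⟨C + C₁ + C₂, by positivity, fun η ε θ M u hu hlin y hy => ?_⟩
  have hyc := frontier_subset_closure hy
  refine hΩ.norm_le_of_inward hy (by positivity) fun h hh => ?_
  have hder : ∀ {v : E n → ℝ} {m : WithTop ℕ∞}, ContDiffOn ℝ m v (closure Ω) → m ≠ 0 →
      HasFDerivWithinAt v (fderivWithin ℝ v (closure Ω) y) (closure Ω) y := fun hv hm =>
    (hv.differentiableOn hm y hyc).hasFDerivWithinAt
  have hqu := tendsto_inward_quotient (hder hu.contDiffOn (by norm_num)) hh
  have hqw := tendsto_inward_quotient (hder hw.contDiffOn (by norm_num)) hh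
  have hqφ := tendsto_inward_quotient (hder hφ (by simp)) hh
  have hlow : fderivWithin ℝ w (closure Ω) y h ≤ fderivWithin ℝ u (closure Ω) y h := by
    refine le_of_tendsto_of_tendsto hqw hqu ?_
    filter_upwards [hh, self_mem_nhdsWithin] with t ht ht0
    have ht0' : (0 : ℝ) < t := ht0
    have h1 := subsolution_le hn hΩ hw hu hlin _ (subset_closure ht)
    rw [hw.boundary y hy, hu.boundary y hy]
    gcongr
  have hup : fderivWithin ℝ u (closure Ω) y h ≤ fderivWithin ℝ φ (closure Ω) y h + C * ‖h‖ := by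
    refine le_of_tendsto_of_tendsto hqu (hqφ.add_const (C * ‖h‖)) ?_
    have hcl : Filter.Tendsto (fun t : ℝ => ‖t • h‖) (nhdsWithin 0 (Set.Ioi 0)) (nhds 0) := by
      have : Continuous (fun t : ℝ => ‖t • h‖) := by fun_prop
      have h2 := this.tendsto 0
      rw [zero_smul, norm_zero] at h2
      exact h2.mono_left nhdsWithin_le_nhds
    filter_upwards [hh, self_mem_nhdsWithin, hcl.eventually (gt_mem_nhds hδ)] with t ht ht0 htδ
    have ht0' : (0 : ℝ) < t := ht0
    have hdist : Metric.infDist (y + t • h) (frontier Ω) ≤ t * ‖h‖ := by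
      refine (Metric.infDist_le_dist_of_mem hy).trans (le_of_eq ?_)
      rw [dist_eq_norm, add_sub_cancel_left, norm_smul, Real.norm_eq_abs, abs_of_pos ht0']
    have hdist2 : t * ‖h‖ < δ := by
      rw [norm_smul, Real.norm_eq_abs, abs_of_pos ht0'] at htδ
      exact htδ
    have h1 := hbar γ Γ f ψ w η ε θ M u hu hlin _ (subset_closure ht)
      (hdist.trans hdist2.le)
    rw [hu.boundary y hy]
    have h2 := mul_le_mul_of_nonneg_left hdist hC
    have h3 : t⁻¹ * (t * (C * ‖h‖)) = C * ‖h‖ := by field_simp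
    rw [← h3, ← mul_add]
    refine mul_le_mul_of_nonneg_left ?_ (inv_pos.2 ht0').le
    linarith
  have a1 : |fderivWithin ℝ w (closure Ω) y h| ≤ C₁ * ‖h‖ :=
    (ContinuousLinearMap.le_opNorm _ _).trans
      (mul_le_mul_of_nonneg_right (hw1 y hyc) (norm_nonneg _))
  have a2 : |fderivWithin ℝ φ (closure Ω) y h| ≤ C₂ * ‖h‖ :=
    (ContinuousLinearMap.le_opNorm _ _).trans
      (mul_le_mul_of_nonneg_right (hφ1 y hyc) (norm_nonneg _))
  have a3 : 0 ≤ C * ‖h‖ := by positivity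
  have a4 : 0 ≤ C₁ * ‖h‖ := by positivity
  have a5 : 0 ≤ C₂ * ‖h‖ := by positivity
  rw [abs_le] at a1 a2 ⊢
  constructor <;> linarith [a1.1, a2.2]

/-- The global gradient estimate: derivatives of a solution are controlled by the maximum principle
for the linearized operator and their boundary values. -/
theorem exists_gradient_bound (hn : 0 < n) (hΩ : IsSmoothBoundedDomain Ω) (hγ : 0 ≤ γ)
    (hne : (frontier Ω).Nonempty) (hφ : ContDiffOn ℝ ∞ φ (closure Ω))
    (hw : IsSubsolution Ω γ Γ f ψ φ w) (hθ : 0 < θ) (hM : 0 ≤ M) :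
    ∃ C, 0 ≤ C ∧ ∀ (η : ℝ → ℝ) (ε : ℝ) (u : E n → ℝ),
      IsApproxSolution Ω γ Γ f ψ φ η ε u →
      (∀ x ∈ Ω, ∃ b q, IsLinearization Ω γ f w u θ M x b q) →
      ∀ y ∈ closure Ω, ‖fderivWithin ℝ u (closure Ω) y‖ ≤ C := by
  obtain ⟨C, hC, hbd⟩ := exists_boundary_gradient_bound hn hΩ hne hφ hw
  obtain ⟨R, hR⟩ := hΩ.isCompact_closure.isBounded.exists_norm_le
  set A := M / θ with hA
  have hA0 : 0 ≤ A := div_nonneg hM hθ.le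
  refine ⟨C + A * R ^ 2, by positivity, fun η ε u hu hlin => ?_⟩
  have main : ∀ ξ : E n, ∀ x ∈ closure Ω,
      fderivWithin ℝ u (closure Ω) x ξ ≤ (C + A * R ^ 2) * ‖ξ‖ := by
    intro ξ
    have hcont : ContinuousOn (fun x => fderivWithin ℝ u (closure Ω) x ξ) (closure Ω) :=
      (hu.contDiffOn.continuousOn_fderivWithin hΩ.uniqueDiffOn (by norm_num)).clm_apply
        continuousOn_const
    have key := le_zero_of_subsolution hn hΩ.isCompact_closure
      (v := fun x => fderivWithin ℝ u (closure Ω) x ξ +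
        (A * ‖ξ‖ * ‖x - 0‖ ^ 2 - (C + A * R ^ 2) * ‖ξ‖)) (by
        have : Continuous fun x : E n => A * ‖ξ‖ * ‖x - 0‖ ^ 2 - (C + A * R ^ 2) * ‖ξ‖ := by
          fun_prop
        exact hcont.add this.continuousOn) (by
      intro x hx hpos
      rcases hΩ.mem_or_mem_frontier hx with h | h
      swap
      · have h1 : fderivWithin ℝ u (closure Ω) x ξ ≤ C * ‖ξ‖ :=
          (le_abs_self _).trans ((ContinuousLinearMap.le_opNorm _ _).trans
            (mul_le_mul_of_nonneg_right (hbd η ε θ M u hu hlin x h) (norm_nonneg _)))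
        have h2 : ‖x - 0‖ ^ 2 ≤ R ^ 2 := by
          rw [sub_zero]
          exact pow_le_pow_left₀ (norm_nonneg _) (hR x hx) 2
        have h3 := mul_le_mul_of_nonneg_left h2 (mul_nonneg hA0 (norm_nonneg ξ))
        linarith
      obtain ⟨b, q, hl⟩ := hlin x h
      have hu3 := (hΩ.contDiffAt hu.contDiffOn h).of_le (m := 3) (by norm_num)
      have hDu : ContDiffAt ℝ 2 (fun y => fderiv ℝ u y ξ) x :=
        (hu3.fderiv_right (m := 2) (by norm_num)).clm_apply contDiffAt_const
      have hev : (fun x => fderivWithin ℝ u (closure Ω) x ξ +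
          (A * ‖ξ‖ * ‖x - 0‖ ^ 2 - (C + A * R ^ 2) * ‖ξ‖)) =ᶠ[nhds x]
          fun y => fderiv ℝ u y ξ + (A * ‖ξ‖ * ‖y - 0‖ ^ 2 - (C + A * R ^ 2) * ‖ξ‖) := by
        filter_upwards [fderivWithin_closure_eventuallyEq hΩ.isOpen u h] with y hy
        rw [hy]
      have hnorm : ContDiffAt ℝ 2 (fun x : E n => ‖x - 0‖ ^ 2) x :=
        (contDiff_id.sub contDiff_const).norm_sq ℝ |>.contDiffAt
      have hpoly : ContDiffAt ℝ 2
          (fun y : E n => A * ‖ξ‖ * ‖y - 0‖ ^ 2 - (C + A * R ^ 2) * ‖ξ‖) x :=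
        (contDiffAt_const.mul hnorm).sub contDiffAt_const
      refine ⟨hΩ.mem_nhds_closure h, (hDu.add hpoly).congr_of_eventuallyEq hev, b, q, hl.pos, ?_⟩
      have hD2 : ∀ a, D2 (fun x => fderivWithin ℝ u (closure Ω) x ξ +
          (A * ‖ξ‖ * ‖x - 0‖ ^ 2 - (C + A * R ^ 2) * ‖ξ‖)) x (b a) (b a) =
          fderiv ℝ (D2 u) x ξ (b a) (b a) + 2 * (A * ‖ξ‖) := by
        intro a
        rw [D2, hev.fderiv.fderiv_eq]
        change D2 _ x (b a) (b a) = _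
        rw [D2_add hDu hpoly, D2_sub (contDiffAt_const.mul hnorm) contDiffAt_const,
          D2_const_mul _ hnorm, D2_const]
        simp only [add_apply, sub_apply, zero_apply, smul_apply, smul_eq_mul, D2_norm_sq,
          b.norm_eq_one,
          D2_fderiv_apply hu3]
        ring
      simp_rw [hD2, mul_add, Finset.sum_add_distrib, ← Finset.sum_mul]
      have h1 := (neg_abs_le _).trans' (neg_le_neg (hl.differentiated ξ))
      have h2 := hl.le_trace.trans (le_trace_of_isLinearization hγ hθ hl)
      have h3 : θ * (2 * (A * ‖ξ‖)) ≤ (∑ a, q a) * (2 * (A * ‖ξ‖)) :=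
        mul_le_mul_of_nonneg_right h2 (by positivity)
      have h4 : θ * (2 * (A * ‖ξ‖)) = 2 * (M * ‖ξ‖) := by
        rw [hA]
        field_simp
      have h5 : 0 ≤ M * ‖ξ‖ := by positivity
      linarith)
    intro x hx
    have h1 := key x hx
    have h2 : 0 ≤ A * ‖ξ‖ * ‖x - 0‖ ^ 2 := by positivity
    linarith
  intro x hx
  refine ContinuousLinearMap.opNorm_le_bound _ (by positivity) fun ξ => ?_
  rw [Real.norm_eq_abs, abs_le]
  have h1 := main ξ x hx
  have h2 := main (-ξ) x hx
  rw [map_neg, norm_neg] at h2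
  constructor <;> linarith

end AprioriEstimates

/-! ### The squares of the tangential derivatives -/

section FrameTerm

variable {n : ℕ}

/-- The quadratic terms, weighted by `w`, absorb the linear ones although one weight may be small:
the radial identity controls the corresponding linear term by the others. -/
theorem neg_le_sum_sq_sub {q l w : Fin n → ℝ} {M S : ℝ} (hq : ∀ a, 0 < q a) (hS : 0 ≤ S)
    (hw : ∀ a, 0 ≤ w a) {r : Fin n} (hr : ∀ a, a ≠ r → 1 / 2 ≤ w a)
    (h0 : 0 ≤ ∑ a, q a * l a) (hM : ∑ a, q a * l a ≤ M) :
    -(S * M + 2 * S ^ 2 * ∑ a, q a) ≤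
      (∑ a, q a * (l a ^ 2 * w a)) - S * ∑ a, q a * |l a| := by
  classical
  have hsplit : ∀ g : Fin n → ℝ, ∑ a, g a = g r + ∑ a ∈ Finset.univ.erase r, g a := fun g =>
    (Finset.add_sum_erase _ g (Finset.mem_univ r)).symm
  have h1 : |∑ a ∈ Finset.univ.erase r, q a * l a| ≤
      ∑ a ∈ Finset.univ.erase r, q a * |l a| := by
    refine (Finset.abs_sum_le_sum_abs _ _).trans (le_of_eq ?_)
    exact Finset.sum_congr rfl fun a _ => by rw [abs_mul, abs_of_pos (hq a)]
  have h2 : q r * |l r| ≤ M + ∑ a ∈ Finset.univ.erase r, q a * |l a| := by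
    rw [hsplit] at h0 hM
    have h3 : q r * |l r| = |q r * l r| := by rw [abs_mul, abs_of_pos (hq r)]
    rw [h3]
    rw [abs_le] at h1 ⊢
    constructor <;> linarith [h1.1, h1.2, h0.trans hM]
  have h3 : S * ∑ a, q a * |l a| ≤
      S * M + ∑ a ∈ Finset.univ.erase r, 2 * S * (q a * |l a|) := by
    rw [hsplit, ← Finset.mul_sum]
    have := mul_le_mul_of_nonneg_left h2 hS
    linarith
  have h4 : ∑ a ∈ Finset.univ.erase r, 2 * S * (q a * |l a|) ≤
      ∑ a ∈ Finset.univ.erase r, (q a * (l a ^ 2 * w a) + 2 * S ^ 2 * q a) := by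
    refine Finset.sum_le_sum fun a ha => ?_
    have h5 : l a ^ 2 * (1 / 2) ≤ l a ^ 2 * w a :=
      mul_le_mul_of_nonneg_left (hr a (Finset.ne_of_mem_erase ha)) (sq_nonneg _)
    have h6 : 0 ≤ (|l a| - 2 * S) ^ 2 := sq_nonneg _
    have h7 : 2 * S * |l a| ≤ l a ^ 2 * w a + 2 * S ^ 2 := by
      rw [sub_sq, sq_abs] at h6
      linarith
    have h8 := mul_le_mul_of_nonneg_left h7 (hq a).le
    linarith
  have h9 : ∑ a ∈ Finset.univ.erase r, (q a * (l a ^ 2 * w a) + 2 * S ^ 2 * q a) ≤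
      ∑ a, (q a * (l a ^ 2 * w a) + 2 * S ^ 2 * q a) := by
    refine Finset.sum_le_sum_of_subset_of_nonneg (Finset.erase_subset _ _) fun a _ _ => ?_
    have := (hq a).le
    have := hw a
    positivity
  rw [Finset.sum_add_distrib (s := Finset.univ), ← Finset.mul_sum (s := Finset.univ)] at h9
  linarith

/-- All but one of the vectors of an orthonormal basis have a substantial projection to the
hyperplane spanned by `n - 1` vectors of another one. -/
theorem exists_forall_ne_half_le (hn : 0 < n) (b : OrthonormalBasis (Fin n) ℝ (E n))
    {e : Fin n → E n} (he : Orthonormal ℝ e) :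
    ∃ r, ∀ a, a ≠ r → 1 / 2 ≤
      ∑ l ∈ (Finset.univ : Finset (Fin n)).filter (fun l : Fin n => (l : ℕ) + 1 < n),
        inner ℝ (b a) (e l) ^ 2 := by
  have hcard : Fintype.card (Fin n) = Module.finrank ℝ (E n) := by simp
  have : Nonempty (Fin n) := ⟨⟨0, hn⟩⟩
  have hspan : ⊤ ≤ Submodule.span ℝ (Set.range e) :=
    (he.linearIndependent.span_eq_top_of_card_eq_finrank hcard).ge
  set c := OrthonormalBasis.mk he hspan with hc
  have hce : ∀ l, c l = e l := fun l => by rw [hc, OrthonormalBasis.coe_mk]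
  set k : Fin n := ⟨n - 1, by omega⟩ with hk
  have hrow : ∀ a, ∑ l, inner ℝ (b a) (e l) ^ 2 = 1 := by
    intro a
    have h := c.sum_sq_norm_inner_left (b a)
    simp only [Real.norm_eq_abs, sq_abs, b.norm_eq_one, hce] at h
    simpa using h
  have hcol : ∑ a, inner ℝ (b a) (e k) ^ 2 = 1 := by
    have h := b.sum_sq_norm_inner_right (e k)
    simp only [Real.norm_eq_abs, sq_abs, he.1 k] at h
    simpa using h
  have hnot : (Finset.univ : Finset (Fin n)).filter (fun l : Fin n => ¬ (l : ℕ) + 1 < n) =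
      {k} := by
    ext l
    simp only [Finset.mem_filter, Finset.mem_univ, true_and, Finset.mem_singleton, hk,
      Fin.ext_iff]
    omega
  have hw : ∀ a, ∑ l ∈ (Finset.univ : Finset (Fin n)).filter (fun l : Fin n => (l : ℕ) + 1 < n),
      inner ℝ (b a) (e l) ^ 2 = 1 - inner ℝ (b a) (e k) ^ 2 := by
    intro a
    have h := Finset.sum_filter_add_sum_filter_not Finset.univ
      (fun l : Fin n => (l : ℕ) + 1 < n) (fun l => inner ℝ (b a) (e l) ^ 2)
    rw [hnot, Finset.sum_singleton, hrow] at h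
    linarith
  simp only [hw]
  by_cases h : ∃ r, 1 / 2 < inner ℝ (b r) (e k) ^ 2
  · obtain ⟨r, hr⟩ := h
    refine ⟨r, fun a ha => ?_⟩
    have h1 : inner ℝ (b a) (e k) ^ 2 + inner ℝ (b r) (e k) ^ 2 ≤
        ∑ a, inner ℝ (b a) (e k) ^ 2 := by
      rw [← Finset.sum_pair (f := fun a => inner ℝ (b a) (e k) ^ 2) ha]
      exact Finset.sum_le_sum_of_subset_of_nonneg (Finset.subset_univ _)
        fun _ _ _ => sq_nonneg _
    linarith
  · push Not at h
    exact ⟨k, fun a _ => by linarith [h a]⟩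

section DirectionalDerivative

variable {z : E n → ℝ} {e : E n → E n} {x : E n}

theorem contDiffAt_fderiv_frame (hz : ContDiffAt ℝ 3 z x) (he : ContDiffAt ℝ 2 e x) :
    ContDiffAt ℝ 2 (fun y => fderiv ℝ z y (e y)) x :=
  (hz.fderiv_right (m := 2) (by norm_num)).clm_apply he

theorem fderiv_fderiv_frame (hz : ContDiffAt ℝ 2 z x) (he : ContDiffAt ℝ 1 e x) (ξ : E n) :
    fderiv ℝ (fun y => fderiv ℝ z y (e y)) x ξ =
      D2 z x ξ (e x) + fderiv ℝ z x (fderiv ℝ e x ξ) := by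
  have h1 : DifferentiableAt ℝ (fderiv ℝ z) x :=
    (hz.fderiv_right (m := 1) (by norm_num)).differentiableAt (by norm_num)
  rw [fderiv_clm_apply h1 (he.differentiableAt (by norm_num))]
  simp only [add_apply, ContinuousLinearMap.comp_apply, ContinuousLinearMap.flip_apply]
  rw [add_comm]
  rfl

/-- The Hessian of a derivative of `z` along a vector field. -/
theorem D2_fderiv_frame (hz : ContDiffAt ℝ 3 z x) (he : ContDiffAt ℝ 2 e x) (ξ : E n) :
    D2 (fun y => fderiv ℝ z y (e y)) x ξ ξ =
      fderiv ℝ (D2 z) x ξ ξ (e x) + 2 * D2 z x ξ (fderiv ℝ e x ξ) +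
        fderiv ℝ z x (fderiv ℝ (fderiv ℝ e) x ξ ξ) := by
  have hp := contDiffAt_fderiv_frame hz he
  have hz1 : ContDiffAt ℝ 2 (fderiv ℝ z) x := hz.fderiv_right (m := 2) (by norm_num)
  have hz2 : ContDiffAt ℝ 1 (D2 z) x := hz1.fderiv_right (m := 1) (by norm_num)
  have hDz : DifferentiableAt ℝ (D2 z) x := hz2.differentiableAt (by norm_num)
  have hDe : DifferentiableAt ℝ (fderiv ℝ e) x :=
    (he.fderiv_right (m := 1) (by norm_num)).differentiableAt (by norm_num)
  have hDp : DifferentiableAt ℝ (fderiv ℝ fun y => fderiv ℝ z y (e y)) x :=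
    (hp.fderiv_right (m := 1) (by norm_num)).differentiableAt (by norm_num)
  have hev : (fun y => fderiv ℝ (fun y => fderiv ℝ z y (e y)) y ξ) =ᶠ[nhds x]
      fun y => D2 z y ξ (e y) + fderiv ℝ z y (fderiv ℝ e y ξ) := by
    filter_upwards [hz.eventually (by simp), he.eventually (by simp)] with y h1 h2
    exact fderiv_fderiv_frame (h1.of_le (by norm_num)) (h2.of_le (by norm_num)) ξ
  have h1 : D2 (fun y => fderiv ℝ z y (e y)) x ξ ξ =
      fderiv ℝ (fun y => fderiv ℝ (fun y => fderiv ℝ z y (e y)) y ξ) x ξ := by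
    rw [fderiv_clm_apply hDp (differentiableAt_const ξ)]
    simp [D2]
  have ha : DifferentiableAt ℝ (fun y => D2 z y ξ) x := hDz.clm_apply (differentiableAt_const ξ)
  have hb : DifferentiableAt ℝ (fun y => fderiv ℝ e y ξ) x :=
    hDe.clm_apply (differentiableAt_const ξ)
  have hz1' : DifferentiableAt ℝ (fderiv ℝ z) x := hz1.differentiableAt (by norm_num)
  have he' : DifferentiableAt ℝ e x := he.differentiableAt (by norm_num)
  rw [h1, hev.fderiv_eq, fderiv_fun_add (ha.clm_apply he') (hz1'.clm_apply hb),
    fderiv_clm_apply ha he', fderiv_clm_apply hz1' hb,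
    fderiv_clm_apply hDz (differentiableAt_const ξ),
    fderiv_clm_apply hDe (differentiableAt_const ξ)]
  simp only [add_apply, ContinuousLinearMap.comp_apply, ContinuousLinearMap.flip_apply,
    fderiv_fun_const, Pi.zero_apply, zero_apply, map_zero]
  change D2 z x ξ (fderiv ℝ e x ξ) + (0 + fderiv ℝ (D2 z) x ξ ξ) (e x) +
    (fderiv ℝ z x (0 + fderiv ℝ (fderiv ℝ e) x ξ ξ) + D2 z x ξ (fderiv ℝ e x ξ)) = _
  simp only [zero_add]
  ring

/-- Symmetry of third derivatives. -/
theorem fderiv_D2_apply (hz : ContDiffAt ℝ 3 z x) (ξ ζ : E n) :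
    fderiv ℝ (D2 z) x ξ ξ ζ = fderiv ℝ (D2 z) x ζ ξ ξ := by
  rw [← D2_fderiv_apply hz ζ ξ, D2_fderiv_frame hz contDiffAt_const ξ]
  simp

end DirectionalDerivative

variable {Ω : Set (E n)} {γ : ℝ} {f : (Fin n → ℝ) → ℝ} {φ w u : E n → ℝ} {θ M : ℝ} {x : E n}
  {b : OrthonormalBasis (Fin n) ℝ (E n)} {q : Fin n → ℝ}

theorem abs_fderiv_sub_le {G C : ℝ} {ξ : E n} (hu : DifferentiableAt ℝ u x)
    (hφ : DifferentiableAt ℝ φ x) (hG : ‖fderiv ℝ u x‖ ≤ G) (hC : ‖fderiv ℝ φ x‖ ≤ C)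
    (hξ : ‖ξ‖ = 1) : |fderiv ℝ (fun y => u y - φ y) x ξ| ≤ G + C := by
  have h1 := ((fderiv ℝ u x).le_opNorm ξ).trans_eq (by rw [hξ, mul_one])
  have h2 := ((fderiv ℝ φ x).le_opNorm ξ).trans_eq (by rw [hξ, mul_one])
  rw [fderiv_fun_sub hu hφ]
  exact (abs_sub _ _).trans (add_le_add (h1.trans hG) (h2.trans hC))

/-- The second derivative of the square of `∇_e (u - φ)` in a direction of the basis, up to terms
of lower order. -/
theorem le_D2_sq_frame (hl : IsLinearization Ω γ f w u θ M x b q) (hu : ContDiffAt ℝ 3 u x)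
    (hφ : ContDiffAt ℝ 3 φ x) {e : E n → E n} (he : ContDiffAt ℝ 2 e x) {G C Λ : ℝ}
    (hG : ‖fderiv ℝ u x‖ ≤ G) (hC1 : ‖fderiv ℝ φ x‖ ≤ C) (hC2 : ‖D2 φ x‖ ≤ C)
    (hC3 : ∀ ξ, ‖ξ‖ = 1 → ‖fderiv ℝ (D2 φ) x ξ‖ ≤ C) (he0 : ‖e x‖ = 1) (he1 : ‖fderiv ℝ e x‖ ≤ Λ)
    (he2 : ∀ ξ, ‖ξ‖ = 1 → ‖fderiv ℝ (fderiv ℝ e) x ξ ξ‖ ≤ Λ) (a : Fin n) :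
    D2 u x (b a) (b a) ^ 2 * inner ℝ (b a) (e x) ^ 2
        + 2 * fderiv ℝ (fun y => u y - φ y) x (e x) * fderiv ℝ (D2 u) x (e x) (b a) (b a)
        - 4 * (G + C) * Λ * |D2 u x (b a) (b a)|
        - 2 * (G * Λ + C + 3 * C * Λ) * (G * Λ + C + 3 * C * Λ + (G + C)) ≤
      D2 (fun y => fderiv ℝ (fun y => u y - φ y) y (e y) ^ 2) x (b a) (b a) := by
  have hG0 : 0 ≤ G := (norm_nonneg _).trans hG
  have hC0 : 0 ≤ C := (norm_nonneg _).trans hC1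
  have hΛ0 : 0 ≤ Λ := (norm_nonneg _).trans he1
  have hba := b.norm_eq_one a
  have hpu := contDiffAt_fderiv_frame hu he
  have hpφ := contDiffAt_fderiv_frame hφ he
  have hd : ∀ {v : E n → ℝ}, ContDiffAt ℝ 2 v x → DifferentiableAt ℝ v x := fun hv =>
    hv.differentiableAt (by norm_num)
  have hev : (fun y => fderiv ℝ (fun y => u y - φ y) y (e y)) =ᶠ[nhds x]
      fun y => fderiv ℝ u y (e y) - fderiv ℝ φ y (e y) := by
    filter_upwards [hu.eventually (by simp), hφ.eventually (by simp)] with y h1 h2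
    rw [fderiv_fun_sub (h1.differentiableAt (by norm_num)) (h2.differentiableAt (by norm_num))]
    rfl
  have hp : ContDiffAt ℝ 2 (fun y => fderiv ℝ (fun y => u y - φ y) y (e y)) x :=
    (hpu.sub hpφ).congr_of_eventuallyEq hev
  have hP := abs_fderiv_sub_le (hu.differentiableAt (by norm_num))
    (hφ.differentiableAt (by norm_num)) hG hC1 he0
  set p := fderiv ℝ (fun y => u y - φ y) x (e x) with hpdef
  set l := D2 u x (b a) (b a) with hldef
  set c := inner ℝ (b a) (e x) with hcdef
  set T := fderiv ℝ (D2 u) x (e x) (b a) (b a) with hTdef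
  have hDe : ‖fderiv ℝ e x (b a)‖ ≤ Λ :=
    ((fderiv ℝ e x).le_opNorm _).trans (by rwa [hba, mul_one])
  have hDDe := he2 _ hba
  have lin : ∀ {v : E n → ℝ} {c : ℝ} {ξ : E n}, ‖fderiv ℝ v x‖ ≤ c → ‖ξ‖ ≤ Λ →
      |fderiv ℝ v x ξ| ≤ c * Λ := fun hv hξ =>
    ((fderiv ℝ _ x).le_opNorm _).trans
      (mul_le_mul hv hξ (norm_nonneg _) ((norm_nonneg _).trans hv))
  have bil : ∀ ξ, |D2 φ x (b a) ξ| ≤ C * ‖ξ‖ := fun ξ => by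
    have h := (D2 φ x).le_opNorm₂ (b a) ξ
    rw [hba, mul_one] at h
    exact h.trans (mul_le_mul_of_nonneg_right hC2 (norm_nonneg _))
  have hD1 : ∃ R, |R| ≤ G * Λ + C + 3 * C * Λ ∧
      fderiv ℝ (fun y => fderiv ℝ (fun y => u y - φ y) y (e y)) x (b a) = l * c + R := by
    refine ⟨fderiv ℝ u x (fderiv ℝ e x (b a)) -
      (D2 φ x (b a) (e x) + fderiv ℝ φ x (fderiv ℝ e x (b a))), ?_, ?_⟩
    · have h1 := lin hG hDe
      have h2 := lin hC1 hDe
      have h3 := bil (e x)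
      rw [he0, mul_one] at h3
      have h4 : 0 ≤ C * Λ := by positivity
      rw [abs_le] at h1 h2 h3 ⊢
      constructor <;> linarith [h1.1, h1.2, h2.1, h2.2, h3.1, h3.2]
    · rw [hev.fderiv_eq, fderiv_fun_sub (hd hpu) (hd hpφ), sub_apply,
        fderiv_fderiv_frame (hu.of_le (by norm_num)) (he.of_le (by norm_num)),
        fderiv_fderiv_frame (hφ.of_le (by norm_num)) (he.of_le (by norm_num)), hl.diag]
      ring
  have hD2 : ∃ R, |R| ≤ G * Λ + C + 3 * C * Λ + 2 * Λ * |l| ∧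
      D2 (fun y => fderiv ℝ (fun y => u y - φ y) y (e y)) x (b a) (b a) = T + R := by
    refine ⟨2 * (l * inner ℝ (b a) (fderiv ℝ e x (b a))) +
      fderiv ℝ u x (fderiv ℝ (fderiv ℝ e) x (b a) (b a)) -
      (fderiv ℝ (D2 φ) x (b a) (b a) (e x) + 2 * D2 φ x (b a) (fderiv ℝ e x (b a)) +
        fderiv ℝ φ x (fderiv ℝ (fderiv ℝ e) x (b a) (b a))), ?_, ?_⟩
    · have h1 := lin hG hDDe
      have h2 := lin hC1 hDDe
      have h3 := (bil (fderiv ℝ e x (b a))).trans (mul_le_mul_of_nonneg_left hDe hC0)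
      have h4 : |fderiv ℝ (D2 φ) x (b a) (b a) (e x)| ≤ C := by
        have h5 := (fderiv ℝ (D2 φ) x (b a)).le_opNorm₂ (b a) (e x)
        rw [hba, he0, mul_one, mul_one] at h5
        exact h5.trans (hC3 _ hba)
      have h7 : |l * inner ℝ (b a) (fderiv ℝ e x (b a))| ≤ Λ * |l| := by
        rw [abs_mul, mul_comm]
        refine mul_le_mul_of_nonneg_right ((abs_real_inner_le_norm _ _).trans ?_) (abs_nonneg _)
        rwa [hba, one_mul]
      have h8 : 0 ≤ C * Λ := by positivity
      rw [abs_le] at h1 h2 h3 h4 h7 ⊢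
      constructor <;> linarith [h1.1, h1.2, h2.1, h2.2, h3.1, h3.2, h4.1, h4.2, h7.1, h7.2]
    · have e1 : D2 (fun y => fderiv ℝ (fun y => u y - φ y) y (e y)) x =
          D2 (fun y => fderiv ℝ u y (e y) - fderiv ℝ φ y (e y)) x := by
        rw [D2, hev.fderiv.fderiv_eq]
        rfl
      rw [e1, D2_sub hpu hpφ, sub_apply, sub_apply, D2_fderiv_frame hu he,
        D2_fderiv_frame hφ he, hl.diag, fderiv_D2_apply hu]
      ring
  obtain ⟨R₁, hR₁, e₁⟩ := hD1
  obtain ⟨R₂, hR₂, e₂⟩ := hD2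
  rw [D2_sq hp, e₁, e₂, ← hpdef]
  set B := G * Λ + C + 3 * C * Λ with hB
  have hB0 : 0 ≤ B := by positivity
  have i1 : R₁ ^ 2 ≤ B ^ 2 := sq_le_sq' (abs_le.1 hR₁).1 (abs_le.1 hR₁).2
  -- `2 (l c + R₁)² ≥ l² c² - 2 R₁²`
  have i2 : 0 ≤ (l * c + 2 * R₁) ^ 2 := sq_nonneg _
  have i3 : |p * R₂| ≤ (G + C) * (B + 2 * Λ * |l|) := by
    rw [abs_mul]
    exact mul_le_mul hP hR₂ (abs_nonneg _) (by positivity)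
  have i4 := (abs_le.1 i3).1
  linarith

/-- The sum over the tangential directions in the barrier contributes only terms that are bounded
by a multiple of `1 + ∑ q`: its quadratic part in the second derivatives of `u` has a sign. -/
theorem exists_frame_term_bound (hn : 0 < n) {G C Λ M : ℝ} (hG0 : 0 ≤ G) (hC0 : 0 ≤ C)
    (hΛ0 : 0 ≤ Λ) (hM0 : 0 ≤ M) :
    ∃ C', 0 ≤ C' ∧ ∀ (Ω : Set (E n)) (γ : ℝ) (f : (Fin n → ℝ) → ℝ) (φ w u : E n → ℝ) (θ : ℝ)
      (x : E n) (b : OrthonormalBasis (Fin n) ℝ (E n)) (q : Fin n → ℝ) (e : Fin n → E n → E n),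
      IsLinearization Ω γ f w u θ M x b q → ContDiffAt ℝ 3 u x → ContDiffAt ℝ 3 φ x →
      (∀ l, ContDiffAt ℝ 2 (e l) x) → ‖fderiv ℝ u x‖ ≤ G → ‖fderiv ℝ φ x‖ ≤ C →
      ‖D2 φ x‖ ≤ C → (∀ ξ, ‖ξ‖ = 1 → ‖fderiv ℝ (D2 φ) x ξ‖ ≤ C) → Orthonormal ℝ (fun l => e l x) →
      (∀ l, ‖fderiv ℝ (e l) x‖ ≤ Λ) →
      (∀ l ξ, ‖ξ‖ = 1 → ‖fderiv ℝ (fderiv ℝ (e l)) x ξ ξ‖ ≤ Λ) →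
      -(C' * (1 + ∑ a, q a)) ≤ ∑ a, q a * ∑ l ∈ (Finset.univ : Finset (Fin n)).filter
        (fun l : Fin n => (l : ℕ) + 1 < n),
        D2 (fun y => fderiv ℝ (fun y => u y - φ y) y (e l y) ^ 2) x (b a) (b a) := by
  set S := 4 * (G + C) * Λ * n with hS
  set B := 2 * (G * Λ + C + 3 * C * Λ) * (G * Λ + C + 3 * C * Λ + (G + C)) with hB
  refine ⟨S * M + n * (2 * (G + C) * M) + 2 * S ^ 2 + n * B, by positivity, ?_⟩
  intro Ω γ f φ w u θ x b q e hl hu hφ he hG hC1 hC2 hC3 ho he1 he2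
  set s := (Finset.univ : Finset (Fin n)).filter (fun l : Fin n => (l : ℕ) + 1 < n) with hs
  have hcard : (s.card : ℝ) ≤ n := by
    have := Finset.card_le_univ s
    rw [Fintype.card_fin] at this
    exact_mod_cast this
  obtain ⟨r, hr⟩ := exists_forall_ne_half_le hn b ho
  set p : Fin n → ℝ := fun l => fderiv ℝ (fun y => u y - φ y) x (e l x) with hp
  set T : Fin n → Fin n → ℝ := fun l a => fderiv ℝ (D2 u) x (e l x) (b a) (b a) with hT
  have hS0 : 0 ≤ S := by positivity
  have hB0 : 0 ≤ B := by positivity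
  have hpoint : ∀ a, D2 u x (b a) (b a) ^ 2 * (∑ l ∈ s, inner ℝ (b a) (e l x) ^ 2) +
      (∑ l ∈ s, 2 * p l * T l a) - S * |D2 u x (b a) (b a)| - n * B ≤
      ∑ l ∈ s, D2 (fun y => fderiv ℝ (fun y => u y - φ y) y (e l y) ^ 2) x (b a) (b a) := by
    intro a
    have h := Finset.sum_le_sum fun l (_ : l ∈ s) =>
      le_D2_sq_frame hl hu hφ (he l) hG hC1 hC2 hC3 (ho.1 l) (he1 l) (he2 l) a
    rw [Finset.sum_sub_distrib, Finset.sum_sub_distrib, Finset.sum_add_distrib,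
      ← Finset.mul_sum, Finset.sum_const, Finset.sum_const, nsmul_eq_mul, nsmul_eq_mul] at h
    have h1 : s.card * (4 * (G + C) * Λ * |D2 u x (b a) (b a)|) ≤
        n * (4 * (G + C) * Λ * |D2 u x (b a) (b a)|) :=
      mul_le_mul_of_nonneg_right hcard (by positivity)
    have h2 : s.card * B ≤ n * B := mul_le_mul_of_nonneg_right hcard hB0
    have h3 : n * (4 * (G + C) * Λ * |D2 u x (b a) (b a)|) = S * |D2 u x (b a) (b a)| := by
      rw [hS]
      ring
    linarith
  have hthird : -(n * (2 * (G + C) * M)) ≤ ∑ a, q a * ∑ l ∈ s, 2 * p l * T l a := by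
    have e1 : ∑ a, q a * ∑ l ∈ s, 2 * p l * T l a = ∑ l ∈ s, 2 * p l * ∑ a, q a * T l a := by
      simp only [Finset.mul_sum]
      rw [Finset.sum_comm]
      exact Finset.sum_congr rfl fun l _ => Finset.sum_congr rfl fun a _ => by ring
    have h1 : ∀ l ∈ s, -(2 * (G + C) * M) ≤ 2 * p l * ∑ a, q a * T l a := by
      intro l _
      have h2 := hl.differentiated (e l x)
      rw [ho.1 l, mul_one] at h2
      have h3 := abs_fderiv_sub_le (hu.differentiableAt (by norm_num))
        (hφ.differentiableAt (by norm_num)) hG hC1 (ho.1 l)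
      have h4 : |p l * ∑ a, q a * T l a| ≤ (G + C) * M := by
        rw [abs_mul]
        exact mul_le_mul h3 h2 (abs_nonneg _) (by positivity)
      linarith [(abs_le.1 h4).1]
    have h2 := Finset.card_nsmul_le_sum s _ _ h1
    rw [nsmul_eq_mul] at h2
    have h3 : s.card * (2 * (G + C) * M) ≤ n * (2 * (G + C) * M) :=
      mul_le_mul_of_nonneg_right hcard (by positivity)
    rw [e1]
    linarith
  have hsum := Finset.sum_le_sum fun a (_ : a ∈ Finset.univ) =>
    mul_le_mul_of_nonneg_left (hpoint a) (hl.pos a).le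
  have hquad := neg_le_sum_sq_sub hl.pos hS0
    (fun a => Finset.sum_nonneg fun l (_ : l ∈ s) => sq_nonneg (inner ℝ (b a) (e l x)))
    hr hl.radial_nonneg hl.radial_le
  have e2 : ∑ a, q a * (D2 u x (b a) (b a) ^ 2 * (∑ l ∈ s, inner ℝ (b a) (e l x) ^ 2) +
      (∑ l ∈ s, 2 * p l * T l a) - S * |D2 u x (b a) (b a)| - n * B) =
      (∑ a, q a * (D2 u x (b a) (b a) ^ 2 * ∑ l ∈ s, inner ℝ (b a) (e l x) ^ 2)) -
      S * (∑ a, q a * |D2 u x (b a) (b a)|) + (∑ a, q a * ∑ l ∈ s, 2 * p l * T l a) -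
      n * B * ∑ a, q a := by
    rw [Finset.mul_sum Finset.univ _ S, Finset.mul_sum Finset.univ _ (n * B),
      ← Finset.sum_sub_distrib, ← Finset.sum_add_distrib, ← Finset.sum_sub_distrib]
    exact Finset.sum_congr rfl fun a _ => by ring
  rw [e2] at hsum
  refine le_trans ?_ hsum
  have hQ : 0 ≤ ∑ a, q a := Finset.sum_nonneg fun a _ => (hl.pos a).le
  have j1 : 0 ≤ (S * M + n * (2 * (G + C) * M)) * ∑ a, q a := by positivity
  have j2 : 0 ≤ 2 * S ^ 2 + n * B := by positivity
  linarith

end FrameTerm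

/-! ### The barrier -/

section Barrier

variable {n : ℕ} {Ω : Set (E n)} {γ : ℝ} {Γ : Set (Fin n → ℝ)} {f : (Fin n → ℝ) → ℝ}
  {ψ φ w : E n → ℝ} {η : ℝ → ℝ} {ε₀ ε θ M : ℝ} {u : E n → ℝ} {x₀ x : E n} {r Λ : ℝ}
  {e : Fin n → E n → E n}

theorem IsSmoothBoundedDomain.frontier_nonempty (hn : 0 < n) (hΩ : IsSmoothBoundedDomain Ω) :
    (frontier Ω).Nonempty := by
  have : Nonempty (Fin n) := ⟨⟨0, hn⟩⟩
  by_contra h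
  rw [Set.not_nonempty_iff_eq_empty, ← isClopen_iff_frontier_eq_empty, isClopen_iff] at h
  rcases h with h | h
  · exact hΩ.isConnected.nonempty.ne_empty h
  · exact NormedSpace.unbounded_univ ℝ (E n) (h ▸ hΩ.isBounded)

theorem IsAdaptedFrame.contDiffAt (hΩ : IsSmoothBoundedDomain Ω)
    (he : IsAdaptedFrame Ω x₀ r Λ e) (hx : x ∈ Ω ∩ Metric.ball x₀ r) (l : Fin n) :
    ContDiffAt ℝ 2 (e l) x :=
  ((he.contDiffOn l).contDiffAt (Filter.inter_mem (hΩ.mem_nhds_closure hx.1)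
    (Metric.isOpen_ball.mem_nhds hx.2))).of_le (WithTop.coe_le_coe.2 le_top)

theorem IsAdaptedFrame.norm_fderiv_le (he : IsAdaptedFrame Ω x₀ r Λ e)
    (hx : x ∈ Ω ∩ Metric.ball x₀ r) (l : Fin n) : ‖fderiv ℝ (e l) x‖ ≤ Λ := by
  rw [← norm_iteratedFDeriv_one]
  exact he.bound x hx l 1 (by norm_num)

theorem IsAdaptedFrame.norm_fderiv_fderiv_apply_le (he : IsAdaptedFrame Ω x₀ r Λ e)
    (hx : x ∈ Ω ∩ Metric.ball x₀ r) (l : Fin n) (ξ : E n) (hξ : ‖ξ‖ = 1) :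
    ‖fderiv ℝ (fderiv ℝ (e l)) x ξ ξ‖ ≤ Λ := by
  have h1 := (iteratedFDeriv ℝ 2 (e l) x).le_opNorm ![ξ, ξ]
  rw [iteratedFDeriv_two_apply] at h1
  simp only [Fin.prod_univ_two, Matrix.cons_val_zero, Matrix.cons_val_one, hξ, mul_one] at h1
  exact h1.trans (he.bound x hx l 2 le_rfl)

theorem exists_fderiv_D2_bound (hΩ : IsSmoothBoundedDomain Ω)
    (hφ : ContDiffOn ℝ ∞ φ (closure Ω)) :
    ∃ C, 0 ≤ C ∧ ∀ x ∈ Ω, ∀ ξ, ‖ξ‖ = 1 → ‖fderiv ℝ (D2 φ) x ξ‖ ≤ C := by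
  have h1 : ContDiffOn ℝ 2 (fderivWithin ℝ φ (closure Ω)) (closure Ω) :=
    hφ.fderivWithin hΩ.uniqueDiffOn (m := 2) (WithTop.coe_le_coe.2 le_top)
  have h2 : ContDiffOn ℝ 1 (fderivWithin ℝ (fderivWithin ℝ φ (closure Ω)) (closure Ω))
      (closure Ω) := h1.fderivWithin hΩ.uniqueDiffOn (m := 1) (by norm_num)
  obtain ⟨C, hC, h3⟩ := exists_fderivWithin_bound hΩ h2
  refine ⟨C, hC, fun x hx ξ hξ => ?_⟩
  have e1 : fderivWithin ℝ (fderivWithin ℝ φ (closure Ω)) (closure Ω) =ᶠ[nhds x] D2 φ := by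
    filter_upwards [hΩ.isOpen.mem_nhds hx] with y hy
    rw [fderivWithin_closure_eq hΩ.isOpen _ hy,
      (fderivWithin_closure_eventuallyEq hΩ.isOpen φ hy).fderiv_eq]
    rfl
  have h4 := h3 x (subset_closure hx)
  rw [fderivWithin_closure_eq hΩ.isOpen _ hx, e1.fderiv_eq] at h4
  have h5 := ContinuousLinearMap.le_of_opNorm_le _ h4 ξ
  rw [hξ, mul_one] at h5
  exact h5

theorem D2_sum {ι : Type*} (s : Finset ι) {v : ι → E n → ℝ}
    (hv : ∀ i ∈ s, ContDiffAt ℝ 2 (v i) x) (ξ : E n) :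
    D2 (fun y => ∑ i ∈ s, v i y) x ξ ξ = ∑ i ∈ s, D2 (v i) x ξ ξ := by
  classical
  induction s using Finset.induction_on with
  | empty =>
    simp only [Finset.sum_empty, D2_const]
    rfl
  | insert i s hi ih =>
    simp only [Finset.sum_insert hi]
    rw [D2_add (hv i (Finset.mem_insert_self i s))
      (ContDiffAt.sum fun j hj => hv j (Finset.mem_insert_of_mem hj)), add_apply, add_apply,
      ih fun j hj => hv j (Finset.mem_insert_of_mem hj)]

/-- The sum of the squares of the tangential derivatives of `u - φ`. -/
noncomputable def tangentialEnergy (φ u : E n → ℝ) (e : Fin n → E n → E n) (y : E n) : ℝ :=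
  ∑ l ∈ (Finset.univ : Finset (Fin n)).filter (fun l : Fin n => (l : ℕ) + 1 < n),
    fderiv ℝ (fun y => u y - φ y) y (e l y) ^ 2

theorem contDiffAt_tangentialEnergy (hu : ContDiffAt ℝ 3 u x) (hφ : ContDiffAt ℝ 3 φ x)
    (he : ∀ l, ContDiffAt ℝ 2 (e l) x) : ContDiffAt ℝ 2 (tangentialEnergy φ u e) x :=
  ContDiffAt.sum fun l _ => (contDiffAt_fderiv_frame (hu.sub hφ) (he l)).pow 2

theorem D2_tangentialEnergy (hu : ContDiffAt ℝ 3 u x) (hφ : ContDiffAt ℝ 3 φ x)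
    (he : ∀ l, ContDiffAt ℝ 2 (e l) x) (ξ : E n) :
    D2 (tangentialEnergy φ u e) x ξ ξ =
      ∑ l ∈ (Finset.univ : Finset (Fin n)).filter (fun l : Fin n => (l : ℕ) + 1 < n),
        D2 (fun y => fderiv ℝ (fun y => u y - φ y) y (e l y) ^ 2) x ξ ξ :=
  D2_sum _ (fun l _ => (contDiffAt_fderiv_frame (hu.sub hφ) (he l)).pow 2) ξ

/-- In the interior the barrier can be written with unrestricted derivatives. -/
theorem barrier_eq (hΩ : IsOpen Ω) (hx : x ∈ Ω) (t δ A₁ A₂ A₃ A₄ N : ℝ) :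
    barrier Ω φ w u x₀ e t δ A₁ A₂ A₃ A₄ N x =
      1 / δ ^ 2 * (A₁ * (u x - w x) + t * Metric.infDist x (frontier Ω)
        - N / 2 * Metric.infDist x (frontier Ω) ^ 2 + A₃ * ‖x - x₀‖ ^ 2)
      - A₂ * (u x - w x) - A₄ * tangentialEnergy φ u e x := by
  rw [barrier, fderivWithin_closure_eq hΩ _ hx]
  rfl

theorem barrier_eventuallyEq (hΩ : IsOpen Ω) (hx : x ∈ Ω) (t δ A₁ A₂ A₃ A₄ N : ℝ) :
    barrier Ω φ w u x₀ e t δ A₁ A₂ A₃ A₄ N =ᶠ[nhds x] fun x =>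
      1 / δ ^ 2 * (A₁ * (u x - w x) + t * Metric.infDist x (frontier Ω)
        - N / 2 * Metric.infDist x (frontier Ω) ^ 2 + A₃ * ‖x - x₀‖ ^ 2)
      - A₂ * (u x - w x) - A₄ * tangentialEnergy φ u e x := by
  filter_upwards [hΩ.mem_nhds hx] with y hy using barrier_eq hΩ hy t δ A₁ A₂ A₃ A₄ N

theorem contDiffAt_barrier (hΩ : IsOpen Ω) (hx : x ∈ Ω) (hu : ContDiffAt ℝ 3 u x)
    (hφ : ContDiffAt ℝ 3 φ x) (hw : ContDiffAt ℝ 2 w x) (he : ∀ l, ContDiffAt ℝ 2 (e l) x)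
    (hd : ContDiffAt ℝ 2 (fun z => Metric.infDist z (frontier Ω)) x) (t δ A₁ A₂ A₃ A₄ N : ℝ) :
    ContDiffAt ℝ 2 (barrier Ω φ w u x₀ e t δ A₁ A₂ A₃ A₄ N) x := by
  refine ContDiffAt.congr_of_eventuallyEq ?_ (barrier_eventuallyEq hΩ hx t δ A₁ A₂ A₃ A₄ N)
  have huw : ContDiffAt ℝ 2 (fun x => u x - w x) x := (hu.of_le (by norm_num)).sub hw
  have hnorm : ContDiffAt ℝ 2 (fun x : E n => ‖x - x₀‖ ^ 2) x :=
    (contDiff_id.sub contDiff_const).norm_sq ℝ |>.contDiffAt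
  exact ((contDiffAt_const.mul ((((contDiffAt_const.mul huw).add (contDiffAt_const.mul hd)).sub
    (contDiffAt_const.mul (hd.pow 2))).add (contDiffAt_const.mul hnorm))).sub
    (contDiffAt_const.mul huw)).sub
    (contDiffAt_const.mul (contDiffAt_tangentialEnergy hu hφ he))

theorem D2_barrier (hΩ : IsOpen Ω) (hx : x ∈ Ω) (hu : ContDiffAt ℝ 3 u x)
    (hφ : ContDiffAt ℝ 3 φ x) (hw : ContDiffAt ℝ 2 w x) (he : ∀ l, ContDiffAt ℝ 2 (e l) x)
    (hd : ContDiffAt ℝ 2 (fun z => Metric.infDist z (frontier Ω)) x) (t δ A₁ A₂ A₃ A₄ N : ℝ)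
    {ξ : E n} (hξ : ‖ξ‖ = 1) :
    D2 (barrier Ω φ w u x₀ e t δ A₁ A₂ A₃ A₄ N) x ξ ξ =
      1 / δ ^ 2 * (-A₁ * (D2 w x ξ ξ - D2 u x ξ ξ)
        + (t - N * Metric.infDist x (frontier Ω)) *
          D2 (fun z => Metric.infDist z (frontier Ω)) x ξ ξ
        - N * fderiv ℝ (fun z => Metric.infDist z (frontier Ω)) x ξ ^ 2 + 2 * A₃)
      + A₂ * (D2 w x ξ ξ - D2 u x ξ ξ) - A₄ * D2 (tangentialEnergy φ u e) x ξ ξ := by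
  have hu2 : ContDiffAt ℝ 2 u x := hu.of_le (by norm_num)
  have huw : ContDiffAt ℝ 2 (fun x => u x - w x) x := hu2.sub hw
  have hnorm : ContDiffAt ℝ 2 (fun x : E n => ‖x - x₀‖ ^ 2) x :=
    (contDiff_id.sub contDiff_const).norm_sq ℝ |>.contDiffAt
  have hE := contDiffAt_tangentialEnergy hu hφ he
  set d : E n → ℝ := fun z => Metric.infDist z (frontier Ω) with hddef
  have hd2 : ContDiffAt ℝ 2 (fun y => d y ^ 2) x := hd.pow 2
  have h1 : ContDiffAt ℝ 2 (fun x => A₁ * (u x - w x)) x := contDiffAt_const.mul huw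
  have h2 : ContDiffAt ℝ 2 (fun x => t * d x) x := contDiffAt_const.mul hd
  have h3 : ContDiffAt ℝ 2 (fun x => N / 2 * d x ^ 2) x := contDiffAt_const.mul hd2
  have h4 : ContDiffAt ℝ 2 (fun x => A₃ * ‖x - x₀‖ ^ 2) x := contDiffAt_const.mul hnorm
  have h5 : ContDiffAt ℝ 2 (fun x => A₁ * (u x - w x) + t * d x - N / 2 * d x ^ 2
      + A₃ * ‖x - x₀‖ ^ 2) x := ((h1.add h2).sub h3).add h4
  have h6 : ContDiffAt ℝ 2 (fun x => A₂ * (u x - w x)) x := contDiffAt_const.mul huw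
  have h7 : ContDiffAt ℝ 2 (fun x => A₄ * tangentialEnergy φ u e x) x := contDiffAt_const.mul hE
  have h8 : ContDiffAt ℝ 2 (fun x => 1 / δ ^ 2 * (A₁ * (u x - w x) + t * d x - N / 2 * d x ^ 2
      + A₃ * ‖x - x₀‖ ^ 2)) x := contDiffAt_const.mul h5
  have e1 : D2 (barrier Ω φ w u x₀ e t δ A₁ A₂ A₃ A₄ N) x = D2 (fun x =>
      1 / δ ^ 2 * (A₁ * (u x - w x) + t * d x - N / 2 * d x ^ 2 + A₃ * ‖x - x₀‖ ^ 2)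
      - A₂ * (u x - w x) - A₄ * tangentialEnergy φ u e x) x := by
    rw [D2, (barrier_eventuallyEq hΩ hx t δ A₁ A₂ A₃ A₄ N).fderiv.fderiv_eq]
    rfl
  rw [e1, D2_sub (h8.sub h6) h7, D2_sub h8 h6, D2_const_mul _ h5, D2_add ((h1.add h2).sub h3) h4,
    D2_sub (h1.add h2) h3, D2_add h1 h2, D2_const_mul _ huw, D2_const_mul _ huw,
    D2_const_mul _ hd, D2_const_mul _ hd2, D2_const_mul _ hnorm, D2_const_mul _ hE,
    D2_sub hu2 hw]
  simp only [sub_apply, add_apply, smul_apply, smul_eq_mul, D2_sq hd, D2_norm_sq, hξ]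
  ring

/-- The differential inequality for the barrier, in terms of the constants that control the
derivatives of the distance (`C₀`) and the tangential energy (`C'`). -/
theorem linOp_barrier_le (hΩ : IsSmoothBoundedDomain Ω) (hne : (frontier Ω).Nonempty)
    (hγ : 0 ≤ γ) (hx : x ∈ Ω)
    (hu : ContDiffAt ℝ 3 u x) (hφ : ContDiffAt ℝ 3 φ x) (hw : ContDiffAt ℝ 2 w x)
    (he : ∀ l, ContDiffAt ℝ 2 (e l) x)
    (hd : ContDiffAt ℝ 2 (fun z => Metric.infDist z (frontier Ω)) x)
    {b : OrthonormalBasis (Fin n) ℝ (E n)} {q : Fin n → ℝ} (hθ : 0 < θ)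
    (hl : IsLinearization Ω γ f w u θ M x b q) {C₀ C' t δ A₁ A₂ A₃ A₄ N K : ℝ}
    (hC₀ : ‖D2 (fun z => Metric.infDist z (frontier Ω)) x‖ ≤ C₀) (hC' : 0 ≤ C')
    (hE : -(C' * (1 + ∑ a, q a)) ≤ ∑ a, q a * D2 (tangentialEnergy φ u e) x (b a) (b a))
    (hA₄ : 0 ≤ A₄) (hA₃ : 0 ≤ A₃) (hN : 0 ≤ N) (hA₂ : 0 ≤ A₂) (hδ : 0 < δ) (hδ1 : δ ≤ 1)
    (ht : t ≤ 1) (hNd : N * Metric.infDist x (frontier Ω) ≤ t) (hA : 2 * A₂ ≤ A₁)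
    (hNθ : (C₀ + 2 * A₃) * (1 + n * γ) + 2 ≤ N * θ)
    (hAθ : (C₀ + 2 * A₃) * (1 + n * γ) + 1 ≤ A₁ / 2 * θ)
    (hK : δ * (K + A₄ * C' * (2 + n * γ)) ≤ min 1 θ) :
    linOp Ω γ f u (barrier Ω φ w u x₀ e t δ A₁ A₂ A₃ A₄ N) x ≤
      -K * (1 + traceCoeff Ω γ f u x) := by
  have hC₀0 : 0 ≤ C₀ :=
    (norm_nonneg (E := E n →L[ℝ] E n →L[ℝ] ℝ) _).trans hC₀
  rw [hl.linOp_eq]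
  have hD := fun a => D2_barrier (x₀ := x₀) hΩ.isOpen hx hu hφ hw he hd t δ A₁ A₂ A₃ A₄ N
    (b.norm_eq_one a)
  simp only [hD]
  set d : E n → ℝ := fun z => Metric.infDist z (frontier Ω) with hddef
  set T := traceCoeff Ω γ f u x with hT
  set U := ∑ a, q a * (D2 w x (b a) (b a) - D2 u x (b a) (b a)) with hU
  set Q := ∑ a, q a with hQ
  set V := ∑ a, q a * D2 d x (b a) (b a) with hV
  set G := ∑ a, q a * fderiv ℝ d x (b a) ^ 2 with hG
  set W := ∑ a, q a * D2 (tangentialEnergy φ u e) x (b a) (b a) with hW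
  have hsum : ∑ a, q a * (1 / δ ^ 2 * (-A₁ * (D2 w x (b a) (b a) - D2 u x (b a) (b a))
        + (t - N * Metric.infDist x (frontier Ω)) * D2 d x (b a) (b a)
        - N * fderiv ℝ d x (b a) ^ 2 + 2 * A₃)
      + A₂ * (D2 w x (b a) (b a) - D2 u x (b a) (b a))
      - A₄ * D2 (tangentialEnergy φ u e) x (b a) (b a)) =
      1 / δ ^ 2 * (-A₁ * U + (t - N * d x) * V - N * G + 2 * A₃ * Q) + A₂ * U - A₄ * W := by
    rw [hU, hV, hG, hW, hQ]
    simp only [Finset.mul_sum, ← Finset.sum_add_distrib, ← Finset.sum_sub_distrib]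
    exact Finset.sum_congr rfl fun a _ => by ring
  rw [hsum]
  have hTθ : θ ≤ T := hl.le_trace
  have hT0 : 0 < T := hθ.trans_le hTθ
  have hQT : Q = (1 + n * γ) * T := hl.sum_eq
  have hm : (0 : ℝ) ≤ n * γ := by positivity
  have hQ0 : 0 ≤ Q := by rw [hQT]; positivity
  have hU0 : 0 ≤ U := hl.subsolution
  have hG0 : 0 ≤ G := Finset.sum_nonneg fun a _ => mul_nonneg (hl.pos a).le (sq_nonneg _)
  have hV' : |V| ≤ C₀ * Q := by
    rw [hV, hQ, Finset.mul_sum]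
    refine (Finset.abs_sum_le_sum_abs _ _).trans (Finset.sum_le_sum fun a _ => ?_)
    rw [abs_mul, abs_of_pos (hl.pos a), mul_comm]
    exact mul_le_mul_of_nonneg_right
      (abs_D2_apply_le hC₀ (b.norm_eq_one a) (b.norm_eq_one a)) (hl.pos a).le
  have hd0 : 0 ≤ d x := Metric.infDist_nonneg
  have htV : (t - N * d x) * V ≤ C₀ * Q := by
    have h1 : |t - N * d x| ≤ 1 := by
      have h2 : 0 ≤ N * d x := mul_nonneg hN hd0
      have h3 : N * d x ≤ t := hNd
      rw [abs_le]
      constructor <;> linarith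
    have h2 : |(t - N * d x) * V| ≤ 1 * (C₀ * Q) := by
      rw [abs_mul]
      exact mul_le_mul h1 hV' (abs_nonneg _) zero_le_one
    linarith [le_abs_self ((t - N * d x) * V)]
  -- Either the operator is uniformly elliptic and the term `-N |∇d|²` dominates, or `u - w` is a
  -- strict supersolution.
  have hmain : -(A₁ / 2) * U + C₀ * Q - N * G + 2 * A₃ * Q ≤ -(min 1 θ * (1 + T)) := by
    have h1 : min 1 θ * T ≤ T := by
      have := mul_le_mul_of_nonneg_right (min_le_left 1 θ) hT0.le
      linarith
    rcases hl.alternative with hell | hbig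
    · have h2 : θ * T ≤ G := by
        have h3 := hΩ.one_le_sum_fderiv_dist_sq hne hx (hd.differentiableAt (by norm_num)) b
        have h4 := mul_le_mul_of_nonneg_left h3 (mul_nonneg hθ.le hT0.le)
        rw [mul_one, Finset.mul_sum] at h4
        exact h4.trans (Finset.sum_le_sum fun a _ =>
          mul_le_mul_of_nonneg_right (hell a) (sq_nonneg _))
      have h3 := mul_le_mul_of_nonneg_left h2 hN
      have h4 := mul_le_mul_of_nonneg_right hNθ hT0.le
      have h5 : 0 ≤ A₁ / 2 * U := mul_nonneg (by linarith) hU0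
      have h6 := min_le_right 1 θ
      rw [hQT]
      linarith
    · have h2 : θ * (1 + T) ≤ U := hbig
      have h3 := mul_le_mul_of_nonneg_left h2 (show 0 ≤ A₁ / 2 by linarith)
      have h4 := mul_le_mul_of_nonneg_right hAθ (show 0 ≤ 1 + T by linarith)
      have h5 : 0 ≤ N * G := mul_nonneg hN hG0
      have h6 : 0 ≤ (C₀ + 2 * A₃) * (1 + n * γ) := by positivity
      have h7 := min_le_left 1 θ
      rw [hQT]
      linarith
  have hinv : 1 ≤ 1 / δ := by rw [le_div_iff₀ hδ]; linarith
  have hinv2 : 1 / δ ≤ 1 / δ ^ 2 := by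
    have h1 := mul_le_mul_of_nonneg_right hinv (zero_le_one.trans hinv)
    have h2 : 1 / δ * (1 / δ) = 1 / δ ^ 2 := by field_simp
    linarith
  have hAU : A₂ * U ≤ 1 / δ ^ 2 * (A₁ / 2 * U) := by
    have h1 : A₂ * U ≤ A₁ / 2 * U := mul_le_mul_of_nonneg_right (by linarith) hU0
    have h2 : 0 ≤ A₁ / 2 * U := mul_nonneg (by linarith) hU0
    have h3 := mul_le_mul_of_nonneg_right (hinv.trans hinv2) h2
    linarith
  have hbr : 1 / δ ^ 2 * (-A₁ * U + (t - N * d x) * V - N * G + 2 * A₃ * Q) +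
      1 / δ ^ 2 * (A₁ / 2 * U) ≤ 1 / δ ^ 2 * -(min 1 θ * (1 + T)) := by
    rw [← mul_add]
    exact mul_le_mul_of_nonneg_left (by linarith) (by positivity)
  have hδK : (K + A₄ * C' * (2 + n * γ)) * (1 + T) ≤ 1 / δ ^ 2 * (min 1 θ * (1 + T)) := by
    have h1 : K + A₄ * C' * (2 + n * γ) ≤ 1 / δ * min 1 θ := by
      have h2 := mul_le_mul_of_nonneg_left hK (show 0 ≤ 1 / δ by positivity)
      have h3 : 1 / δ * (δ * (K + A₄ * C' * (2 + n * γ))) = K + A₄ * C' * (2 + n * γ) := by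
        field_simp
      linarith
    have h2 : 1 / δ * min 1 θ ≤ 1 / δ ^ 2 * min 1 θ :=
      mul_le_mul_of_nonneg_right hinv2 (le_min zero_le_one hθ.le)
    have h3 := mul_le_mul_of_nonneg_right (h1.trans h2) (show 0 ≤ 1 + T by linarith)
    linarith
  have hAW : -(A₄ * W) ≤ A₄ * C' * (2 + n * γ) * (1 + T) := by
    have h1 := mul_le_mul_of_nonneg_left hE hA₄
    have h2 : 1 + Q ≤ (2 + n * γ) * (1 + T) := by
      rw [hQT]
      linarith
    have h3 := mul_le_mul_of_nonneg_left h2 (mul_nonneg hA₄ hC')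
    linarith
  linarith

/-- The tangential derivatives of `u - φ` vanish at the boundary. -/
theorem fderivWithin_sub_eq_zero (hu : ContDiffOn ℝ 1 u (closure Ω))
    (hφ : ContDiffOn ℝ 1 φ (closure Ω)) (hb : ∀ y ∈ frontier Ω, u y = φ y)
    (hx : x ∈ frontier Ω) {ξ : E n} (hξ : ξ ∈ tangentConeAt ℝ (frontier Ω) x) :
    fderivWithin ℝ (fun y => u y - φ y) (closure Ω) x ξ = 0 := by
  have h1 : HasFDerivWithinAt (fun y => u y - φ y)
      (fderivWithin ℝ (fun y => u y - φ y) (closure Ω) x) (frontier Ω) x :=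
    (((hu.sub hφ).differentiableOn (by norm_num) x
      (frontier_subset_closure hx)).hasFDerivWithinAt).mono frontier_subset_closure
  have h2 : HasFDerivWithinAt (fun y => u y - φ y) (0 : E n →L[ℝ] ℝ) (frontier Ω) x :=
    (hasFDerivWithinAt_const (0 : ℝ) x (frontier Ω)).congr
      (fun y hy => sub_eq_zero.2 (hb y hy)) (sub_eq_zero.2 (hb x hx))
  exact h1.unique_on h2 hξ

/-- The barrier dominates `h` on the boundary of the local domain. -/
theorem le_barrier (hΩ : IsSmoothBoundedDomain Ω) (hφ : ContDiffOn ℝ ∞ φ (closure Ω))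
    (hw : IsSubsolution Ω γ Γ f ψ φ w) (hu : IsApproxSolution Ω γ Γ f ψ φ η ε u)
    (hwu : ∀ y ∈ closure Ω, w y ≤ u y) {G C : ℝ} (hG : ∀ y ∈ Ω, ‖fderiv ℝ u y‖ ≤ G)
    (hC : ∀ y ∈ Ω, ‖fderiv ℝ φ y‖ ≤ C) (hx₀ : x₀ ∈ frontier Ω)
    (he : IsAdaptedFrame Ω x₀ r Λ e) {t δ A₁ A₂ A₃ A₄ N Cbar : ℝ} (hA₄ : 0 ≤ A₄)
    (hA₂ : 0 ≤ A₂) (hN : 0 ≤ N) (hδ : 0 < δ) (hδ1 : δ ≤ 1) (hδr : δ < r) (hNδ : N * δ ≤ t)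
    (hA : 2 * A₂ ≤ A₁) (hA₃ : |Cbar| + A₄ * (n * (G + C) ^ 2) ≤ A₃) {h : E n → ℝ}
    (hb : ∀ x ∈ closure (localDomain Ω x₀ δ) ∩ frontier Ω, h x ≤ Cbar * ‖x - x₀‖ ^ 2)
    (hi : ∀ x ∈ closure (localDomain Ω x₀ δ), h x ≤ Cbar)
    (hx : x ∈ frontier (localDomain Ω x₀ δ)) :
    h x ≤ barrier Ω φ w u x₀ e t δ A₁ A₂ A₃ A₄ N x := by
  have hopen : IsOpen (localDomain Ω x₀ δ) := hΩ.isOpen.inter Metric.isOpen_ball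
  rw [hopen.frontier_eq] at hx
  obtain ⟨hxc, hxn⟩ := hx
  have hxΩ : x ∈ closure Ω := closure_mono Set.inter_subset_left hxc
  have hxδ : ‖x - x₀‖ ≤ δ := by
    have h1 : x ∈ Metric.closedBall x₀ δ :=
      Metric.closure_ball_subset_closedBall (closure_mono Set.inter_subset_right hxc)
    rwa [Metric.mem_closedBall, dist_eq_norm] at h1
  have hxr : x ∈ Metric.ball x₀ r := by
    rw [Metric.mem_ball, dist_eq_norm]
    linarith
  have hA₃C : |Cbar| ≤ A₃ := by
    have : 0 ≤ A₄ * (n * (G + C) ^ 2) := by positivity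
    linarith
  have hinv : 1 ≤ 1 / δ ^ 2 := by
    rw [le_div_iff₀ (by positivity), one_mul]
    exact pow_le_one₀ hδ.le hδ1
  rcases hΩ.mem_or_mem_frontier hxΩ with hxi | hxf
  · have hxe : ‖x - x₀‖ = δ := by
      refine le_antisymm hxδ (not_lt.1 fun hlt => hxn ⟨hxi, ?_⟩)
      rwa [Metric.mem_ball, dist_eq_norm]
    rw [barrier_eq hΩ.isOpen hxi, hxe]
    set d := Metric.infDist x (frontier Ω) with hd
    have hd0 : 0 ≤ d := Metric.infDist_nonneg
    have hdδ : d ≤ δ := by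
      have h1 := Metric.infDist_le_dist_of_mem hx₀ (x := x)
      rwa [dist_eq_norm, hxe] at h1
    have hu1 := (hΩ.contDiffAt hu.contDiffOn hxi).differentiableAt (by norm_num)
    have hφ1 := (hΩ.contDiffAt hφ hxi).differentiableAt (by simp)
    have hT : tangentialEnergy φ u e x ≤ n * (G + C) ^ 2 := by
      have h1 : ∀ l ∈ (Finset.univ : Finset (Fin n)).filter (fun l : Fin n => (l : ℕ) + 1 < n),
          fderiv ℝ (fun y => u y - φ y) x (e l x) ^ 2 ≤ (G + C) ^ 2 := fun l _ => by
        have h2 := abs_fderiv_sub_le hu1 hφ1 (hG x hxi) (hC x hxi)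
          ((he.orthonormal x ⟨hxΩ, hxr⟩).1 l)
        exact sq_le_sq' (abs_le.1 h2).1 (abs_le.1 h2).2
      have h2 := Finset.sum_le_card_nsmul _ _ _ h1
      rw [nsmul_eq_mul] at h2
      refine h2.trans (mul_le_mul_of_nonneg_right ?_ (sq_nonneg _))
      have h3 := Finset.card_le_univ
        ((Finset.univ : Finset (Fin n)).filter (fun l : Fin n => (l : ℕ) + 1 < n))
      rw [Fintype.card_fin] at h3
      exact_mod_cast h3
    have h1 := mul_le_mul_of_nonneg_left hT hA₄
    have hwu' : 0 ≤ u x - w x := sub_nonneg.2 (hwu x hxΩ)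
    have h2 : 0 ≤ t * d - N / 2 * d ^ 2 := by
      have h3 : N * d ≤ t := (mul_le_mul_of_nonneg_left hdδ hN).trans hNδ
      have h4 := mul_le_mul_of_nonneg_right h3 hd0
      have h5 : 0 ≤ N * d * d := by positivity
      linarith
    have h3 : 0 ≤ A₁ / 2 * (u x - w x) := mul_nonneg (by linarith) hwu'
    have h4 : A₂ * (u x - w x) ≤ A₁ / 2 * (u x - w x) :=
      mul_le_mul_of_nonneg_right (by linarith) hwu'
    have h5 := mul_le_mul_of_nonneg_right hinv
      (show 0 ≤ A₁ * (u x - w x) + (t * d - N / 2 * d ^ 2) by linarith)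
    have h6 : 1 / δ ^ 2 * (A₃ * δ ^ 2) = A₃ := by field_simp
    have h7 := hi x hxc
    have h8 := le_abs_self Cbar
    linarith
  · have hd : Metric.infDist x (frontier Ω) = 0 := Metric.infDist_zero_of_mem hxf
    have hsum : ∑ l ∈ (Finset.univ : Finset (Fin n)).filter (fun l : Fin n => (l : ℕ) + 1 < n),
        (fderivWithin ℝ (fun y => u y - φ y) (closure Ω) x (e l x)) ^ 2 = 0 := by
      refine Finset.sum_eq_zero fun l hl => ?_
      rw [fderivWithin_sub_eq_zero (hu.contDiffOn.of_le (by norm_num))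
        (hφ.of_le (WithTop.coe_le_coe.2 le_top)) hu.boundary hxf
        (he.tangent x ⟨hxf, hxr⟩ l (Finset.mem_filter.1 hl).2)]
      simp
    rw [barrier, hd, hsum, hu.boundary x hxf, hw.boundary x hxf]
    have h1 := hb x ⟨hxc, hxf⟩
    have h2 : Cbar * ‖x - x₀‖ ^ 2 ≤ A₃ * ‖x - x₀‖ ^ 2 :=
      mul_le_mul_of_nonneg_right ((le_abs_self _).trans hA₃C) (sq_nonneg _)
    have h3 : 0 ≤ A₃ * ‖x - x₀‖ ^ 2 := mul_nonneg ((abs_nonneg _).trans hA₃C) (sq_nonneg _)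
    have h4 := mul_le_mul_of_nonneg_right hinv h3
    linarith

end Barrier

end HessianBarrier

open HessianBarrier in
theorem theorem5p1
    (n : ℕ) (hn : 2 ≤ n)
    (Ω : Set (HessianBarrier.E n)) (hΩ : HessianBarrier.IsSmoothBoundedDomain Ω)
    (γ : ℝ) (hγ : 0 ≤ γ)
    (Γ : Set (Fin n → ℝ)) (hΓ : HessianBarrier.IsSymmetricCone Γ)
    (f : (Fin n → ℝ) → ℝ) (hf : HessianBarrier.StructureConditions Γ f)
    (ψ : HessianBarrier.E n → ℝ) (hψ : ContDiffOn ℝ ∞ ψ (closure Ω)) (hψ0 : ∀ x ∈ Ω, 0 ≤ ψ x)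
    (φ : HessianBarrier.E n → ℝ) (hφ : ContDiffOn ℝ ∞ φ (closure Ω))
    (w : HessianBarrier.E n → ℝ) (hw : HessianBarrier.IsSubsolution Ω γ Γ f ψ φ w)
    (ε₀ : ℝ) (hε₀ : 0 < ε₀)
    (hwε₀ : ∀ x ∈ closure Ω,
      ε₀ ≤ HessianBarrier.specFun f (HessianBarrier.augHess Ω γ w x))
    (η : ℝ → ℝ) (hη : HessianBarrier.IsCutoff ε₀ η)
    (r Λ : ℝ) (hr : 0 < r) (Cbar : ℝ) (K : ℝ) (hK : 0 < K)
    (A₄ : ℝ) (hA₄ : 0 < A₄) (κ : ℝ) (hκ : 0 < κ) :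
    ∃ t δ A₁ A₂ A₃ N : ℝ,
      (0 < t ∧ t < κ) ∧ (0 < δ ∧ δ < κ ∧ δ < r) ∧
      1 / κ < A₁ ∧ 1 / κ < A₂ ∧ 1 / κ < A₃ ∧ 1 / κ < N ∧ 2 * A₂ < A₁ ∧
      ∀ ε : ℝ, 0 < ε → ε ≤ ε₀ / 2 →
      ∀ u : HessianBarrier.E n → ℝ, HessianBarrier.IsApproxSolution Ω γ Γ f ψ φ η ε u →
      ∀ x₀ ∈ frontier Ω,
      ∀ e : Fin n → HessianBarrier.E n → HessianBarrier.E n,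
        HessianBarrier.IsAdaptedFrame Ω x₀ r Λ e →
        (∀ h : HessianBarrier.E n → ℝ,
          ContinuousOn h (closure (HessianBarrier.localDomain Ω x₀ δ)) →
          (∀ x ∈ closure (HessianBarrier.localDomain Ω x₀ δ) ∩ frontier Ω,
            h x ≤ Cbar * ‖x - x₀‖ ^ 2) →
          (∀ x ∈ closure (HessianBarrier.localDomain Ω x₀ δ), h x ≤ Cbar) →
          ∀ x ∈ frontier (HessianBarrier.localDomain Ω x₀ δ),
            h x ≤ HessianBarrier.barrier Ω φ w u x₀ e t δ A₁ A₂ A₃ A₄ N x) ∧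
        ContDiffOn ℝ 2 (HessianBarrier.barrier Ω φ w u x₀ e t δ A₁ A₂ A₃ A₄ N)
          (HessianBarrier.localDomain Ω x₀ δ) ∧
        ∀ x ∈ HessianBarrier.localDomain Ω x₀ δ,
          HessianBarrier.linOp Ω γ f u
              (HessianBarrier.barrier Ω φ w u x₀ e t δ A₁ A₂ A₃ A₄ N) x
            ≤ -K * (1 + HessianBarrier.traceCoeff Ω γ f u x) := by
  have hn0 : 0 < n := by omega
  have hne := hΩ.frontier_nonempty hn0
  obtain ⟨θ, hθ, M, hM, hlin⟩ :=
    exists_isLinearization hn hΩ hγ hΓ hf hψ hψ0 hw hε₀ hwε₀ hη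
  obtain ⟨G, hG0, hG⟩ := exists_gradient_bound hn0 hΩ hγ hne hφ hw hθ hM
  obtain ⟨c₁, hc₁, hφ1⟩ := exists_fderivWithin_bound hΩ (hφ.of_le (WithTop.coe_le_coe.2 le_top))
  obtain ⟨c₂, hc₂, hφ2⟩ := exists_D2_bound hΩ (hφ.of_le (WithTop.coe_le_coe.2 le_top))
  obtain ⟨c₃, hc₃, hφ3⟩ := exists_fderiv_D2_bound hΩ hφ
  set C := c₁ + c₂ + c₃ with hC
  have hC0 : 0 ≤ C := by positivity
  have hφ1' : ∀ y ∈ Ω, ‖fderiv ℝ φ y‖ ≤ C := fun y hy => by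
    have h := hφ1 y (subset_closure hy)
    rw [fderivWithin_closure_eq hΩ.isOpen _ hy] at h
    linarith
  have hφ2' : ∀ y ∈ Ω, ‖D2 φ y‖ ≤ C := fun y hy => (hφ2 y hy).trans (by linarith)
  have hφ3' : ∀ y ∈ Ω, ∀ ξ, ‖ξ‖ = 1 → ‖fderiv ℝ (D2 φ) y ξ‖ ≤ C := fun y hy ξ hξ =>
    (hφ3 y hy ξ hξ).trans (by linarith)
  obtain ⟨C', hC', hframe⟩ := exists_frame_term_bound hn0 hG0 hC0 (abs_nonneg Λ) hM
  obtain ⟨δ₀, hδ₀, C₀, hC₀, hreg⟩ := hΩ.exists_dist_regular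
  have hm : (0 : ℝ) ≤ n * γ := by positivity
  have hκ' : 0 < 1 / κ := by positivity
  set A₂ := 1 / κ + 1 with hA₂
  set A₃ := 1 / κ + 1 + (|Cbar| + A₄ * (n * (G + C) ^ 2)) with hA₃
  have hA₃0 : 0 ≤ |Cbar| + A₄ * (n * (G + C) ^ 2) := by positivity
  set S := (C₀ + 2 * A₃) * (1 + n * γ) + 2 with hS
  have hS0 : 0 ≤ S := by
    have : 0 ≤ A₃ := by linarith
    positivity
  -- `N` and `A₁` each beat the terms in `S`, in one case of the alternative.
  set N := 1 / κ + 1 + S / θ with hN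
  set A₁ := 2 * A₂ + 1 + 2 * (S / θ) with hA₁
  have hSθ : S / θ * θ = S := by field_simp
  have hSθ0 : 0 ≤ S / θ := by positivity
  have hN0 : 0 < N := by linarith
  set t := min κ 1 / 2 with ht
  have hmin : 0 < min κ 1 := lt_min hκ one_pos
  have ht0 : 0 < t := by positivity
  have htκ : t < κ := by linarith [min_le_left κ 1]
  have ht1 : t ≤ 1 := by linarith [min_le_right κ 1]
  set B := K + A₄ * C' * (2 + n * γ) with hB
  have hB0 : 0 < B := by positivity
  have hθ1 : 0 < min 1 θ := lt_min one_pos hθ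
  -- The radius is chosen last: `δ⁻²` has to beat `B`.
  obtain ⟨δ, hδ, h1⟩ := exists_between (show 0 < min (min (min κ r) (min 1 δ₀))
    (min (t / N) (min 1 θ / B)) by positivity)
  simp only [lt_min_iff] at h1
  obtain ⟨⟨⟨hδκ, hδr⟩, hδ1, hδδ₀⟩, hδt, hδB⟩ := h1
  have hNδ : N * δ ≤ t := by
    rw [lt_div_iff₀ hN0] at hδt
    linarith
  have hδB' : δ * B ≤ min 1 θ := by
    have h2 : min 1 θ / B * B = min 1 θ := by field_simp
    have h3 := mul_le_mul_of_nonneg_right (show δ ≤ min 1 θ / B from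
      hδB.le) hB0.le
    linarith
  refine ⟨t, δ, A₁, A₂, A₃, N, ⟨ht0, htκ⟩, ⟨hδ, hδκ, hδr⟩, by linarith, by linarith,
    by linarith, by linarith, by linarith, ?_⟩
  intro ε hε hεε₀ u hu x₀ hx₀ e he
  have hlinu := hlin ε hε hεε₀ u hu
  have hwu := subsolution_le hn0 hΩ hw hu hlinu
  have hGu : ∀ y ∈ Ω, ‖fderiv ℝ u y‖ ≤ G := fun y hy => by
    have h := hG η ε u hu hlinu y (subset_closure hy)
    rwa [fderivWithin_closure_eq hΩ.isOpen _ hy] at h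
  have hu3 : ∀ {x}, x ∈ Ω → ContDiffAt ℝ 3 u x := fun hx =>
    (hΩ.contDiffAt hu.contDiffOn hx).of_le (by norm_num)
  have hφ3c : ∀ {x}, x ∈ Ω → ContDiffAt ℝ 3 φ x := fun hx =>
    (hΩ.contDiffAt hφ hx).of_le (WithTop.coe_le_coe.2 le_top)
  have hsub : ∀ {x}, x ∈ localDomain Ω x₀ δ → x ∈ Ω ∩ Metric.ball x₀ r := fun hx =>
    ⟨hx.1, Metric.ball_subset_ball hδr.le hx.2⟩
  have hregx : ∀ {x}, x ∈ localDomain Ω x₀ δ → _ := fun {x} hx =>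
    hreg x₀ hx₀ x ⟨hx.1, Metric.ball_subset_ball hδδ₀.le hx.2⟩
  refine ⟨fun h _ hb hi x hx => ?_, fun x hx => ?_, fun x hx => ?_⟩
  · exact le_barrier hΩ hφ hw hu hwu hGu hφ1' hx₀ he hA₄.le (by linarith) hN0.le hδ hδ1.le hδr
      hNδ (by linarith) (by linarith) hb hi hx
  · exact (contDiffAt_barrier hΩ.isOpen hx.1 (hu3 hx.1) (hφ3c hx.1)
      (hΩ.contDiffAt hw.contDiffOn hx.1) (fun l => he.contDiffAt hΩ (hsub hx) l) (hregx hx).1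
      t δ A₁ A₂ A₃ A₄ N).contDiffWithinAt
  · obtain ⟨b, q, hl⟩ := hlinu x hx.1
    have hec := fun l => he.contDiffAt hΩ (hsub hx) l
    have hE := hframe Ω γ f φ w u θ x b q e hl (hu3 hx.1) (hφ3c hx.1) hec (hGu x hx.1)
      (hφ1' x hx.1) (hφ2' x hx.1) (hφ3' x hx.1)
      (he.orthonormal x ⟨subset_closure hx.1, (hsub hx).2⟩)
      (fun l => (he.norm_fderiv_le (hsub hx) l).trans (le_abs_self Λ))
      (fun l ξ hξ => (he.norm_fderiv_fderiv_apply_le (hsub hx) l ξ hξ).trans (le_abs_self Λ))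
    simp only [← D2_tangentialEnergy (hu3 hx.1) (hφ3c hx.1) hec] at hE
    have hdx : Metric.infDist x (frontier Ω) ≤ δ :=
      (Metric.infDist_le_dist_of_mem hx₀).trans (Metric.mem_ball.1 hx.2).le
    refine linOp_barrier_le hΩ hne hγ hx.1 (hu3 hx.1) (hφ3c hx.1)
      (hΩ.contDiffAt hw.contDiffOn hx.1) hec (hregx hx).1 hθ hl (hregx hx).2 hC' hE hA₄.le
      (by linarith) hN0.le (by linarith) hδ hδ1.le ht1
      ((mul_le_mul_of_nonneg_left hdx hN0.le).trans hNδ) (by linarith) ?_ ?_ hδB'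
    · have h2 : N * θ = (1 / κ + 1) * θ + S := by rw [hN, add_mul, hSθ]
      have h3 : 0 ≤ (1 / κ + 1) * θ := by positivity
      linarith
    · have h2 : A₁ / 2 * θ = (A₂ + 1 / 2) * θ + S / θ * θ := by
        rw [hA₁]
        ring
      have h3 : 0 ≤ (A₂ + 1 / 2) * θ := by positivity
      rw [hSθ] at h2
      linarith
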